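/- **Setting.** Let $\mathbb E$ be a finite-dimensional Euclidean space with norm $\|\cdot\|$ and dual norm $\|\cdot\|_*$, and let $p\ge 2$, $q=\lfloor p/2\rfloor$. Let $f:\mathbb E\to\mathbb R$ be convex and $p+1$ times continuously differentiable with $0<M_{p+1}(f)<\infty$, where $M_j(f)=\sup_x\|D^jf(x)\|$, and let $\psi:\mathbb E\to\mathbb R\cup\{+\infty\}$ be closed and convex. Let $x^*$ minimize $F=f+\psi$ over $\operatorname{dom}\psi$, $F^*=F(x^*)$, $x_0\in\operatorname{dom}\psi$, $R_0=\|x_0-x^*\|$. Assume $D_0=\sup\{\|z-x^*\|: z\in\operatorname{dom}\psi,\ F(z)\le F(x_0)\}<\infty$ and $F_S=\sup\{F(z):z\in\operatorname{dom}\psi,\ \|z-x^*\|\le 2R_0\}<\infty$. Put $d_{p+1}(x)=\frac1{p+1}\|x\|^{p+1}$, $H=\frac{6M_{p+1}(f)}{(p-1)!}$, $L=\frac32$, $\mu=\frac12$, $\kappa=\frac13$, $f_y(x)=f(x)+Hd_{p+1}(x-y)$, $\varphi_y=f_y+\psi$, $$\rho_y(x)=\sum_{j=1}^{q}\tfrac1{(2j)!}D^{2j}f(y)[x-y]^{2j}+Hd_{p+1}(x-y),$$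 and $\beta_{\rho}(x,z)=\rho(z)-\rho(x)-\langle\nabla\rho(x),z-x\rangle$. Let $\beta\in[0,1/p]$, $\varepsilon>0$ and $\lambda\in\{L,2L\}$. **Algorithm.** Let $A_k=\frac{1-\beta}{2^pH}\left(\frac{k}{p+1}\right)^{p+1}$, $a_{k+1}=A_{k+1}-A_k$ and $\Psi_0(x)=d_{p+1}(x-x_0)$. For $k=0,1,\dots$, as long as $F(x_k)-F^*>\varepsilon$: let $\upsilon_k$ minimize $\Psi_k$ over $\operatorname{dom}\psi$, and let $y_k=\frac{A_k}{A_{k+1}}x_k+\frac{a_{k+1}}{A_{k+1}}\upsilon_k$. Starting at $z_0=y_k$, make the inner iterations $$z_{i+1}=\operatorname*{argmin}_{z}\{\langle\nabla f_{y_k}(z_i),z-z_i\rangle+\psi(z)+\lambda\beta_{\rho_{y_k}}(z_i,z)\},\qquad g_{i+1}=\lambda(\nabla\rho_{y_k}(z_i)-\nabla\rho_{y_k}(z_{i+1}))-\nabla f_{y_k}(z_i),$$ until $\|\nabla f_{y_k}(z_{i+1})+g_{i+1}\|_*\le\beta\|\nabla f(z_{i+1})+g_{i+1}\|_*$. Let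 $T_k$ be the last $z_{i+1}$, choose any $x_{k+1}\in\operatorname{dom}\psi$ with $F(x_{k+1})\le F(T_k)$, and put $\Psi_{k+1}(x)=\Psi_k(x)+a_{k+1}[f(T_k)+\langle\nabla f(T_k),x-T_k\rangle+\psi(x)]$. **Theorem.** (1) *Outer iterations.* Let $$N=(2p+2)\left(\frac{3pM_{p+1}(f)}{(p-1)(p+1)(p-1)!\,\varepsilon}\right)^{\frac1{p+1}}R_0 .$$ After any number $K\ge N$ of outer iterations $F(x_K)-F^*\le\varepsilon$; so at most $\lceil N\rceil$ outer iterations are made before an $\varepsilon$-solution is found. (2) *Oracle.* With $H$ given, outer iterations $0,\dots,K-1$ depend on $f$ only through its derivatives of order at most $2q$ (the value included) at the points $x_k$ ($k\le K$), $y_k$ and inner iterates $z_i$ ($k<K$): an execution for $f$ is also an execution for every $2q$ times continuously differentiable $f'$ with the same derivatives of order at most $2q$ at these points. (3) *Inner iterations.* Consider an outer iteration $k$ with $F(x_k)\le F(x_0)$ and write $y=y_k$. If $p\ge4$, assume that $f_{y}$ is $L$-smooth and $\mu$-strongly convex relative to $\rho_{y}$, i.e. that $L\rho_{y}-f_{y}$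 and $f_{y}-\mu\rho_{y}$ are convex. Let $$D_1=\left(\tfrac{(p+1)2^{p-1}}{3H}\left(\max\{F(x_0),F_S\}-F^*\right)\right)^{\frac1{p+1}}.$$ Then $F(y)\le\max\{F(x_0),F_S\}$, and all $z_i$, $i\ge1$, computed by the inner method satisfy $\|z_i-x^*\|\le D_1+\max\{D_0,2^{\frac{p-1}{p+1}}R_0\}$. Suppose further that $\beta>0$, that $F(z_i)-F^*\ge\varepsilon$ and $\|z_i-x^*\|\le D$ for all computed $z_i$, $i\ge1$, and that * $\sigma>0$ and $\beta_{\rho_y}(x,z)\ge\frac{\sigma}{p+1}\|z-x\|^{p+1}$ for all $x,z\in\mathbb E$; * $\|\nabla^2\rho_y(z)\|\le\overline L$ for all $z\in\operatorname{dom}\psi$ with $\|z-y\|\le\Delta$ and $\varphi_y(z)\le\varphi_y(y)$, where $\Delta=\left(\frac{p+1}{2\sigma L}(F(y)-F^*)\right)^{\frac1{p+1}}$; * $\theta:\mathbb R_+\to\mathbb R_+$ is convex, $\theta(0)=0$, and $\beta_{\rho_y}(x,z)\le\theta(\|x-z\|)$ whenever $\|x-y\|\le D_1$ and $z\in\mathbb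 E$. Then the inner method stops, with a pair $(z_i,g_i)$ such that $g_i\in\partial\psi(z_i)$ and $\|\nabla f_y(z_i)+g_i\|_*\le\beta\|\nabla f(z_i)+g_i\|_*$, after at most $$1+\frac{2(p+1)}{\kappa}\log\left(\frac{\frac{D(\lambda-\mu)\overline L}{\beta}\left(\frac{2(p+1)}{\sigma}\,\theta(D_1)\right)^{\frac1{p+1}}}{\varepsilon}\right)=O\!\left(\log\tfrac1\varepsilon\right)$$ inner iterations. (4) *Explicit constants.* For every $y\in\operatorname{dom}\psi$: the number $\sigma=\frac56H2^{-(p-1)}$ is admissible in (3). If $p\le3$, then $f_y$ is $L$-smooth and $\mu$-strongly convex relative to $\rho_y$. If $M_{2j}(f)<\infty$ for $1\le j\le q$, then, for every $\sigma>0$ and the corresponding $\Delta$, $$\overline L=\tfrac{M_4(f)}2\Delta^2+M_2(f)+\left(\tfrac{M_{p+1}(f)}{(p-1)!}+pH\right)\Delta^{p-1}$$ is admissible in (3) (without the term with $M_4(f)$ if $p=2$), and so is, with $R=D_1$, $$\theta(\tau)=\sum_{j=1}^q\tfrac{M_{2j}(f)}{(2j)!}\,b_{2j}(\tau)+\tfrac{H}{p+1}\,b_{p+1}(\tau),\qquad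 b_n(\tau)=(R+\tau)^n-R^n-nR^{n-1}\tau .$$ -/

import Mathlib

namespace BiOPT

noncomputable section

variable {E : Type*} [NormedAddCommGroup E] [InnerProductSpace ℝ E]

/-! The space `E` carries a Euclidean norm; gradients are elements of the dual `E →L[ℝ] ℝ`,
whose operator norm is the dual norm. -/

/-- The data of `min { f x + ψ x : x ∈ dom ψ }`. The extended-valued function `ψ` is given by its
domain `Q` (where it is finite) and its real values on `Q`; outside `Q` it is `+∞` and the
values of the field `ψ` there are never used. -/
structure Problem (E : Type*) where
  f : E → ℝ
  Q : Set E
  ψ : E → ℝ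

/-- The objective `F = f + ψ` (meaningful on `Q`). -/
def Problem.F (P : Problem E) (x : E) : ℝ := P.f x + P.ψ x

/-- `ψ` is a closed convex function: convex on its domain, with closed epigraph. -/
def Problem.ClosedConvex (P : Problem E) : Prop :=
  ConvexOn ℝ P.Q P.ψ ∧ IsClosed {w : E × ℝ | w.1 ∈ P.Q ∧ P.ψ w.1 ≤ w.2}

/-- `g ∈ ∂ψ(x)`. -/
def Problem.IsSubgradient (P : Problem E) (x : E) (g : E →L[ℝ] ℝ) : Prop :=
  x ∈ P.Q ∧ ∀ w ∈ P.Q, P.ψ x + g (w - x) ≤ P.ψ w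

/-- `M_j(f) < +∞`. -/
def MFinite (f : E → ℝ) (j : ℕ) : Prop :=
  BddAbove (Set.range fun x : E => ‖iteratedFDeriv ℝ j f x‖)

/-- `M_j(f)`, the supremum over `x` of the norm of the symmetric form `D^j f(x)`. -/
def M (f : E → ℝ) (j : ℕ) : ℝ := ⨆ x : E, ‖iteratedFDeriv ℝ j f x‖

/-- The prox-function `d_{p+1}(x) = ‖x‖^{p+1} / (p+1)`. -/
def d (p : ℕ) (x : E) : ℝ := ‖x‖ ^ (p + 1) / ((p : ℝ) + 1)

/-- `f_{y,H}^p(x) = f(x) + H d_{p+1}(x - y)`. -/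
def proxSmooth (f : E → ℝ) (p : ℕ) (H : ℝ) (y x : E) : ℝ := f x + H * d p (x - y)

/-- `φ(x) = f_{y,H}^p(x) + ψ(x)` (meaningful on `Q`). -/
def Problem.phi (P : Problem E) (p : ℕ) (H : ℝ) (y x : E) : ℝ :=
  proxSmooth P.f p H y x + P.ψ x

/-- The scaling function
`ρ_{y,H}(x) = ∑_{j=1}^{q} D^{2j} f(y)[x-y]^{2j} / (2j)! + H d_{p+1}(x-y)`, `q = ⌊p/2⌋`. -/
def scaling (f : E → ℝ) (p : ℕ) (H : ℝ) (y x : E) : ℝ :=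
  (∑ j ∈ Finset.Icc 1 (p / 2),
    iteratedFDeriv ℝ (2 * j) f y (fun _ => x - y) / ((2 * j).factorial : ℝ)) + H * d p (x - y)

/-- The Bregman distance `β_ρ(x,y) = ρ(y) - ρ(x) - ⟨∇ρ(x), y - x⟩`. -/
def bregman (ρ : E → ℝ) (x y : E) : ℝ := ρ y - ρ x - fderiv ℝ ρ x (y - x)

/-- `h` is `L`-smooth relative to `ρ`. -/
def RelSmooth (h ρ : E → ℝ) (L : ℝ) : Prop :=
  ConvexOn ℝ Set.univ fun x => L * ρ x - h x

/-- `h` is `μ`-strongly convex relative to `ρ`. -/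
def RelStronglyConvex (h ρ : E → ℝ) (μ : ℝ) : Prop :=
  ConvexOn ℝ Set.univ fun x => h x - μ * ρ x

/-- `ρ` is uniformly convex of degree `p+1` with modulus `σ`. -/
def UniformlyConvex (ρ : E → ℝ) (p : ℕ) (σ : ℝ) : Prop :=
  ∀ x y : E, σ / ((p : ℝ) + 1) * ‖y - x‖ ^ (p + 1) ≤ bregman ρ x y

/-- `ρ` is norm-dominated on `S` by `θ : ℝ₊ → ℝ₊`. -/
def NormDominated (ρ : E → ℝ) (S : Set E) (θ : ℝ → ℝ) : Prop :=
  ConvexOn ℝ (Set.Ici 0) θ ∧ θ 0 = 0 ∧ (∀ τ, 0 ≤ τ → 0 ≤ θ τ) ∧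
    ∀ x ∈ S, ∀ y : E, bregman ρ x y ≤ θ ‖x - y‖

/-- The acceptable solutions `(x, g) ∈ 𝒜(y, β)` of the proximal problem centred at `y`. -/
def Problem.Acceptable (P : Problem E) (p : ℕ) (H β : ℝ) (y x : E) (g : E →L[ℝ] ℝ) : Prop :=
  P.IsSubgradient x g ∧
    ‖fderiv ℝ (proxSmooth P.f p H y) x + g‖ ≤ β * ‖fderiv ℝ P.f x + g‖

/-! ### Parameters -/

/-- The relative smoothness constant `L = 3/2`. -/
def relL : ℝ := 3 / 2

/-- The relative strong convexity constant `μ = 1/2`. -/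
def relMu : ℝ := 1 / 2

/-- The condition number `κ = μ / L = 1/3`. -/
def relKappa : ℝ := relMu / relL

/-- `H = 6 M_{p+1}(f) / (p-1)!`. -/
def regH (f : E → ℝ) (p : ℕ) : ℝ := 6 * M f (p + 1) / ((p - 1).factorial : ℝ)

/-- `A_k = (c_p / 2)^p (k / (p+1))^{p+1}` with `c_p = ((1-β)/H)^{1/p}`. -/
def coefA (p : ℕ) (H β : ℝ) (k : ℕ) : ℝ :=
  (((1 - β) / H) ^ (1 / (p : ℝ)) / 2) ^ p * ((k : ℝ) / ((p : ℝ) + 1)) ^ (p + 1)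

/-! ### The lower level: Bregman composite gradient method -/

/-- `z'` is the point produced from `z` by one step with coefficient `lam`:
`z' = argmin_w { ⟨∇f_{y,H}^p(z), w - z⟩ + ψ(w) + lam β_ρ(z, w) }`. -/
def Problem.InnerStep (P : Problem E) (p : ℕ) (H lam : ℝ) (y z z' : E) : Prop :=
  z' ∈ P.Q ∧ IsMinOn
    (fun w => fderiv ℝ (proxSmooth P.f p H y) z (w - z) + P.ψ w
      + lam * bregman (scaling P.f p H y) z w) P.Q z'

/-- The subgradient of `ψ` at `z'` delivered by the step from `z` to `z'`:
`g = lam (∇ρ(z) - ∇ρ(z')) - ∇f_{y,H}^p(z)`. -/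
def Problem.innerSubgrad (P : Problem E) (p : ℕ) (H lam : ℝ) (y z z' : E) : E →L[ℝ] ℝ :=
  lam • (fderiv ℝ (scaling P.f p H y) z - fderiv ℝ (scaling P.f p H y) z')
    - fderiv ℝ (proxSmooth P.f p H y) z

/-- The stopping test of the inner loop, made after the step from `z` to `z'`. -/
def Problem.Stops (P : Problem E) (p : ℕ) (H β lam : ℝ) (y z z' : E) : Prop :=
  ‖fderiv ℝ (proxSmooth P.f p H y) z' + P.innerSubgrad p H lam y z z'‖
    ≤ β * ‖fderiv ℝ P.f z' + P.innerSubgrad p H lam y z z'‖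

/-- The inner loop has not stopped during its first `i` iterations, so that iteration number
`i + 1`, which computes `z (i + 1)`, is performed. -/
def Problem.Active (P : Problem E) (p : ℕ) (H β lam : ℝ) (y : E) (z : ℕ → E) (i : ℕ) : Prop :=
  ∀ j < i, ¬ P.Stops p H β lam y (z j) (z (j + 1))

/-- `z` is a sequence of iterates of the inner loop started at `y`. What follows the stopping
iteration is irrelevant and unconstrained. -/
def Problem.IsInnerRun (P : Problem E) (p : ℕ) (H β lam : ℝ) (y : E) (z : ℕ → E) : Prop :=
  z 0 = y ∧
    ∀ i, P.Active p H β lam y z i → P.InnerStep p H lam y (z i) (z (i + 1))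

/-! ### The upper level: accelerated inexact proximal-point method -/

/-- The quantities computed by the bi-level method: upper-level points `x k`, `υ k`, `y k`, the
inner iterates `z k i` at the upper-level iteration `k`, and `m k + 1`, the number of inner
iterations made there. -/
structure Trace (E : Type*) where
  x : ℕ → E
  υ : ℕ → E
  y : ℕ → E
  z : ℕ → ℕ → E
  m : ℕ → ℕ

/-- The output `T_k` of the inner loop. -/
def Trace.T (t : Trace E) (k : ℕ) : E := t.z k (t.m k + 1)

/-- The estimating functions: `Ψ_0(x) = d_{p+1}(x - x_0)` and
`Ψ_{k+1}(x) = Ψ_k(x) + a_{k+1} [f(T_k) + ⟨∇f(T_k), x - T_k⟩ + ψ(x)]`. -/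
def Problem.estSeq (P : Problem E) (p : ℕ) (H β : ℝ) (x₀ : E) (T : ℕ → E) : ℕ → E → ℝ
  | 0 => fun x => d p (x - x₀)
  | k + 1 => fun x => P.estSeq p H β x₀ T k x +
      (coefA p H β (k + 1) - coefA p H β k) *
        (P.f (T k) + fderiv ℝ P.f (T k) (x - T k) + P.ψ x)

/-- `t` records an execution of the first `K` iterations of the bi-level method started at `x₀`,
together with the points `υ_K` and `y_K` that open the next iteration. The minimizer of `Ψ_k`
is sought on `Q`: for `k ≥ 1`, `Ψ_k = +∞` elsewhere, and for `k = 0` it is `x₀ ∈ Q` anyway. -/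
structure Problem.IsRun (P : Problem E) (p : ℕ) (H β lam : ℝ) (x₀ : E) (K : ℕ)
    (t : Trace E) : Prop where
  start : t.x 0 = x₀
  argmin : ∀ k ≤ K, t.υ k ∈ P.Q ∧ IsMinOn (P.estSeq p H β x₀ t.T k) P.Q (t.υ k)
  combine : ∀ k ≤ K, t.y k = (coefA p H β k / coefA p H β (k + 1)) • t.x k +
    ((coefA p H β (k + 1) - coefA p H β k) / coefA p H β (k + 1)) • t.υ k
  inner : ∀ k < K, P.IsInnerRun p H β lam (t.y k) (t.z k)
  running : ∀ k < K, P.Active p H β lam (t.y k) (t.z k) (t.m k)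
  stopped : ∀ k < K, P.Stops p H β lam (t.y k) (t.z k (t.m k)) (t.T k)
  next : ∀ k < K, t.x (k + 1) ∈ P.Q ∧ P.F (t.x (k + 1)) ≤ P.F (t.T k)

/-- The points at which the first `K` iterations call the oracle of `f`. -/
def Trace.queried (t : Trace E) (K : ℕ) : Set E :=
  {w | (∃ k ≤ K, w = t.x k) ∨ (∃ k < K, w = t.y k) ∨ ∃ k < K, ∃ i ≤ t.m k + 1, w = t.z k i}

/-! ### Constants of the complexity bounds -/

/-- `(2p+2) (3 p M_{p+1}(f) / ((p-1)(p+1)(p-1)! ε))^{1/(p+1)} R₀`. -/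
def outerBound (f : E → ℝ) (p : ℕ) (ε R₀ : ℝ) : ℝ :=
  (2 * (p : ℝ) + 2) *
    (3 * p * M f (p + 1) / (((p : ℝ) - 1) * ((p : ℝ) + 1) * ((p - 1).factorial : ℝ) * ε))
      ^ (1 / ((p : ℝ) + 1)) * R₀

/-- `1 + (2(p+1)/κ) log ((D (lam - μ) Lbar / β) ((2(p+1)/σ) Θ)^{1/(p+1)} / ε)`. -/
def innerBound (p : ℕ) (β lam ε σ Lbar D Θ : ℝ) : ℝ :=
  1 + 2 * ((p : ℝ) + 1) / relKappa *
    Real.log (D * (lam - relMu) * Lbar / β *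
      (2 * ((p : ℝ) + 1) / σ * Θ) ^ (1 / ((p : ℝ) + 1)) / ε)

/-- The points of `Q` whose value does not exceed `F(x₀)`. -/
def Problem.initLevel (P : Problem E) (x₀ : E) : Set E := {z ∈ P.Q | P.F z ≤ P.F x₀}

/-- `D₀ = max { ‖z - x*‖ : z ∈ dom ψ, F(z) ≤ F(x₀) }`. -/
def Problem.D₀ (P : Problem E) (xs x₀ : E) : ℝ := sSup ((fun z => ‖z - xs‖) '' P.initLevel x₀)

/-- `S = { z ∈ dom ψ : ‖z - x*‖ ≤ 2 R₀ }`, `R₀ = ‖x₀ - x*‖`. -/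
def Problem.S (P : Problem E) (xs x₀ : E) : Set E := {z ∈ P.Q | ‖z - xs‖ ≤ 2 * ‖x₀ - xs‖}

/-- `F_S = sup_{z ∈ S} F(z)`. -/
def Problem.FS (P : Problem E) (xs x₀ : E) : ℝ := sSup (P.F '' P.S xs x₀)

/-- `D₁ = ( (p+1) 2^{p-1} / (3H) (max{F(x₀), F_S} - F*) )^{1/(p+1)}`. -/
def Problem.D₁ (P : Problem E) (p : ℕ) (H : ℝ) (xs x₀ : E) : ℝ :=
  (((p : ℝ) + 1) * 2 ^ (p - 1) / (3 * H) * (max (P.F x₀) (P.FS xs x₀) - P.F xs))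
    ^ (1 / ((p : ℝ) + 1))

/-- `D = D₁ + max { D₀, 2^{(p-1)/(p+1)} R₀ }`. -/
def Problem.Dmax (P : Problem E) (p : ℕ) (H : ℝ) (xs x₀ : E) : ℝ :=
  P.D₁ p H xs x₀ +
    max (P.D₀ xs x₀) ((2 : ℝ) ^ (((p : ℝ) - 1) / ((p : ℝ) + 1)) * ‖x₀ - xs‖)

/-- `Δ = ( (p+1)/(2σL) (F(y) - F*) )^{1/(p+1)}`. -/
def Problem.radius (P : Problem E) (p : ℕ) (xs : E) (σ : ℝ) (y : E) : ℝ :=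
  (((p : ℝ) + 1) / (2 * σ * relL) * (P.F y - P.F xs)) ^ (1 / ((p : ℝ) + 1))

/-- `ℒ(y, Δ) = { z ∈ dom ψ : ‖y - z‖ ≤ Δ, φ(z) ≤ φ(y) }`. -/
def Problem.levelSet (P : Problem E) (p : ℕ) (H : ℝ) (y : E) (Δ : ℝ) : Set E :=
  {z ∈ P.Q | ‖y - z‖ ≤ Δ ∧ P.phi p H y z ≤ P.phi p H y y}

/-- `‖∇²ρ_{y,H}‖ ≤ Lbar` on the level set `ℒ(y, Δ)`. -/
def Problem.HessianBounded (P : Problem E) (p : ℕ) (H : ℝ) (xs : E) (σ : ℝ) (y : E)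
    (Lbar : ℝ) : Prop :=
  ∀ z ∈ P.levelSet p H y (P.radius p xs σ y),
    ‖iteratedFDeriv ℝ 2 (scaling P.f p H y) z‖ ≤ Lbar

/-- `σ₀ = (5/6) H 2^{-(p-1)}`. -/
def sigma₀ (p : ℕ) (H : ℝ) : ℝ := 5 / 6 * H / 2 ^ (p - 1)

/-- `M₄/2 Δ² + M₂ + (M_{p+1}/(p-1)! + pH) Δ^{p-1}`, without the first term if `p = 2`, where `f`
need not have fourth derivatives. -/
def hessianBound (f : E → ℝ) (p : ℕ) (H Δ : ℝ) : ℝ :=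
  (if 3 ≤ p then M f 4 / 2 * Δ ^ 2 else 0) + M f 2 + (M f (p + 1) / ((p - 1).factorial : ℝ) + p * H) * Δ ^ (p - 1)

/-- `b_n(R, τ) = (R+τ)^n - R^n - n R^{n-1} τ`, the Bregman distance of `r ↦ r^n` from `R` to
`R + τ`. -/
def powBregman (n : ℕ) (R τ : ℝ) : ℝ := (R + τ) ^ n - R ^ n - n * R ^ (n - 1) * τ

/-- `θ_R(τ) = ∑_{j=1}^{q} M_{2j}(f)/(2j)! b_{2j}(R, τ) + H/(p+1) b_{p+1}(R, τ)`. -/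
def thetaBound (f : E → ℝ) (p : ℕ) (H R τ : ℝ) : ℝ :=
  (∑ j ∈ Finset.Icc 1 (p / 2),
    M f (2 * j) / ((2 * j).factorial : ℝ) * powBregman (2 * j) R τ)
    + H / ((p : ℝ) + 1) * powBregman (p + 1) R τ

end

end BiOPT

open BiOPT

namespace BiOPT

/-! ### Symmetric multilinear maps and Taylor's formula -/

section Diagonal

universe u
variable {E : Type u} [NormedAddCommGroup E] [NormedSpace ℝ E]

/-! Outer iterations. Let G = ∇f(T_k) + g, a subgradient of F at T_k. The stopping test says that G
+ H∇d_{p+1}(T_k − y_k) has norm at most β‖G‖. Squaring this and applying weighted AM-GM, where β ≤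
1/p enters, gives ⟨G, y_k − T_k⟩ ≥ c_p ‖G‖^{(p+1)/p} with c_p = ((1−β)/H)^{1/p}
(`inner_ge_of_norm_add_le`). The function Ψ_k is d_{p+1}(· − x₀) plus an affine function plus A_k ψ,
so it grows away from υ_k like 2^{-(p-1)}‖·‖^{p+1}/(p+1). The A_k increase slowly enough for these
two gains to absorb the error a_{k+1}‖G‖‖x − υ_k‖ (`estSeq_step`). Hence A_k F(x_k) ≤ min Ψ_k for
all k. With Ψ_k ≤ d_{p+1}(· − x₀) + A_k F at x*, this bounds both F(x_K) − F* and ‖υ_K − x*‖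
(`main_bound`).

Scaling function. The even Taylor part of D²f at y is the average of the Taylor polynomials at h and
−h, so up to (H/6)‖h‖^{p-1} it is the average of two positive semidefinite Hessians of f. Therefore
ρ keeps 5/6 of its power term. For p = 3 the odd term is controlled by positivity of D²f at y ± 2h.

Inner iterations. One step gives φ(z') + λβ_ρ(z', w) ≤ φ(w) + (λ − μ)β_ρ(z, w) for every w in the
domain (`step_le`). No minimizer of φ is used: with w = z_{i+1}, a later iterate, φ(w) is below the
earlier values, so the Bregman distances to it contract by 5/6 at each step, and β_ρ(z_i, z_{i+1})
decays linearly. Uniform convexity makes the step short and the Hessian bound makes its residual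
small, whereas a failed test keeps the residual above β‖∇f + g‖ ≥ βε/D. Comparing the two yields the
logarithm (`succ_le_log`).

Localization. The radius Δ shrinks as σ grows, so confining the iterates to it needs an upper bound
for every admissible σ (`modulus_le`), matched with `radius_bound`. For p = 2 the decrease of φ
alone is too weak, and the sharper constant 5/6 of relative strong convexity is used. -/

lemma apply_iteratedFDeriv_of_comp_eq {G : Type*} [NormedAddCommGroup G] [NormedSpace ℝ G]
    (L : G →L[ℝ] G) {g : E → G} {n : ℕ} (hg : ContDiff ℝ n g) (h : L ∘ g = g) (x : E)
    (m : Fin n → E) : L (iteratedFDeriv ℝ n g x m) = iteratedFDeriv ℝ n g x m := by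
  have := L.iteratedFDeriv_comp_left hg.contDiffAt (x := x) (i := n) le_rfl
  rw [h] at this
  exact (congrArg (fun A => A m) this).symm

/-- Symmetry of the Hessian says that `flip` composed with D²f is D²f; a linear map that fixes a
function fixes the values of its iterated derivatives. -/
lemma iteratedFDeriv_fderiv_fderiv_swap {F : Type*} [NormedAddCommGroup F] [NormedSpace ℝ F]
    {f : E → F} {n : ℕ} (hf : ContDiff ℝ (n + 2 : ℕ) f) (x : E) (m : Fin n → E) (v w : E) :
    iteratedFDeriv ℝ n (fderiv ℝ (fderiv ℝ f)) x m v w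
      = iteratedFDeriv ℝ n (fderiv ℝ (fderiv ℝ f)) x m w v := by
  have hf' : ContDiff ℝ (n + 1 : ℕ) (fderiv ℝ f) := hf.fderiv_right (by norm_cast)
  have hf'' : ContDiff ℝ n (fderiv ℝ (fderiv ℝ f)) := hf'.fderiv_right (by norm_cast)
  have hsymm : fderiv ℝ (fderiv ℝ f) =
      (ContinuousLinearMap.flipₗᵢ ℝ E E F) ∘ fderiv ℝ (fderiv ℝ f) := by
    ext y v w
    exact second_derivative_symmetric
      (fun z => (hf.differentiable (by simp) z).hasFDerivAt)
      ((hf'.differentiable (by simp) y).hasFDerivAt) v w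
  have := apply_iteratedFDeriv_of_comp_eq (G := E →L[ℝ] E →L[ℝ] F)
    ((ContinuousLinearMap.flipₗᵢ ℝ E E F).toContinuousLinearEquiv :
      (E →L[ℝ] E →L[ℝ] F) →L[ℝ] (E →L[ℝ] E →L[ℝ] F)) hf'' hsymm.symm x m
  exact (congrArg (fun A => A v w) this).symm

/-- All the partial linear maps of `Dⁿ⁺¹ f(x)` at the diagonal point `(h, …, h)` agree. -/
def DiagSymm {F : Type*} [NormedAddCommGroup F] [NormedSpace ℝ F] (f : E → F) (n : ℕ)
    (x : E) : Prop :=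
  ∀ (h v : E) (i : Fin (n + 1)),
    iteratedFDeriv ℝ (n + 1) f x (Function.update (fun _ => h) i v)
      = iteratedFDeriv ℝ n (fderiv ℝ f) x (fun _ => h) v

lemma diagSymm_zero {F : Type*} [NormedAddCommGroup F] [NormedSpace ℝ F] (f : E → F) (x : E) :
    DiagSymm f 0 x := by
  intro h v i
  obtain rfl : i = Fin.last 0 := Fin.ext (by omega)
  rw [iteratedFDeriv_succ_apply_right]
  simp

/-- The last slot belongs to the innermost derivative, so v placed there needs no argument. From any
other slot the hypothesis on `fderiv ℝ f` extracts v, and symmetry of second derivatives exchanges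
it with the h of the last slot. -/
lemma DiagSymm.succ {F : Type*} [NormedAddCommGroup F] [NormedSpace ℝ F] {f : E → F} {n : ℕ}
    {x : E} (hf : ContDiff ℝ (n + 2 : ℕ) f) (ih : DiagSymm (fderiv ℝ f) n x) :
    DiagSymm f (n + 1) x := by
  intro h v i
  rw [iteratedFDeriv_succ_apply_right]
  induction i using Fin.lastCases with
  | last =>
    congr 2
    · ext j
      simp [Fin.init, (Fin.castSucc_lt_last j).ne]
    · simp
  | cast i =>
    have h1 : Fin.init (Function.update (fun _ : Fin (n + 2) => h) i.castSucc v)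
        = Function.update (fun _ => h) i v := by
      rw [Fin.init_update_castSucc]; rfl
    have h2 : Function.update (fun _ : Fin (n + 2) => h) i.castSucc v (Fin.last (n + 1)) = h := by
      rw [Function.update_of_ne (Fin.castSucc_lt_last i).ne']
    rw [h1, h2, ih, iteratedFDeriv_fderiv_fderiv_swap hf, iteratedFDeriv_succ_apply_right]
    rfl

/-- The induction replaces the target F by `E →L[ℝ] F`, which is why F lives in the universe of E.
-/
lemma diagSymm (n : ℕ) :
    ∀ {F : Type u} [NormedAddCommGroup F] [NormedSpace ℝ F] {f : E → F},
    ContDiff ℝ (n + 1 : ℕ) f → ∀ x : E, DiagSymm f n x := by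
  induction n with
  | zero => exact fun _ x => diagSymm_zero _ x
  | succ n ih => exact fun hf x => (ih (hf.fderiv_right (by norm_cast)) x).succ hf

/-- ℝ need not share the universe of E, but the dual of E does; so one derivative is taken before
the general statement applies. -/
lemma diagSymm_real {f : E → ℝ} {n : ℕ} (hf : ContDiff ℝ (n + 1 : ℕ) f) (x : E) :
    DiagSymm f n x := by
  cases n with
  | zero => exact diagSymm_zero _ x
  | succ n => exact (diagSymm n (hf.fderiv_right (by norm_cast)) x).succ hf

/-- The form `h ↦ Dⁿ⁺¹ f(y)[h]ⁿ⁺¹` has derivative `(n + 1) Dⁿ (∇f)(y)[h]ⁿ`. -/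
lemma DiagSymm.hasFDerivAt {F : Type*} [NormedAddCommGroup F] [NormedSpace ℝ F]
    {f : E → F} {n : ℕ} {y : E} (hf : DiagSymm f n y) (h : E) :
    HasFDerivAt (fun x => iteratedFDeriv ℝ (n + 1) f y (fun _ => x))
      (((n : ℝ) + 1) • iteratedFDeriv ℝ n (fderiv ℝ f) y (fun _ => h)) h := by
  have hdiag : HasFDerivAt (fun x : E => (fun _ : Fin (n + 1) => x))
      (ContinuousLinearMap.pi fun _ => ContinuousLinearMap.id ℝ E) h :=
    (ContinuousLinearMap.pi fun _ : Fin (n + 1) => ContinuousLinearMap.id ℝ E).hasFDerivAt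
  have := ((iteratedFDeriv ℝ (n + 1) f y).hasFDerivAt (fun _ => h)).comp h hdiag
  refine this.congr_fderiv ?_
  ext v
  simp [ContinuousMultilinearMap.linearDeriv_apply, hf h v, ← Nat.cast_smul_eq_nsmul ℝ]

end Diagonal

/-! ### Taylor's formula with a norm bound for the remainder -/

section TaylorBound

universe u
variable {E : Type u} [NormedAddCommGroup E] [NormedSpace ℝ E]

/-- The Taylor polynomial with `n` terms of `f` at `y`. -/
noncomputable def taylorPoly {F : Type u} [NormedAddCommGroup F] [NormedSpace ℝ F]
    (f : E → F) (n : ℕ) (y h : E) : F :=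
  ∑ i ∈ Finset.range n, ((i.factorial : ℝ)⁻¹) • iteratedFDeriv ℝ i f y (fun _ => h)

lemma hasFDerivAt_taylorPoly {F : Type u} [NormedAddCommGroup F] [NormedSpace ℝ F]
    {f : E → F} {n : ℕ} (hf : ContDiff ℝ n f) (y h : E) :
    HasFDerivAt (taylorPoly f (n + 1) y) (taylorPoly (fderiv ℝ f) n y h) h := by
  have h0 : HasFDerivAt (fun x : E =>
      (((0 : ℕ).factorial : ℝ)⁻¹) • iteratedFDeriv ℝ 0 f y (fun _ => x)) (0 : E →L[ℝ] F) h := by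
    simpa using hasFDerivAt_const (f y) h
  have hs : ∀ i ∈ Finset.range n, HasFDerivAt (fun x : E =>
      (((i + 1).factorial : ℝ)⁻¹) • iteratedFDeriv ℝ (i + 1) f y (fun _ => x))
      (((i.factorial : ℝ)⁻¹) • iteratedFDeriv ℝ i (fderiv ℝ f) y (fun _ => h)) h := by
    intro i hi
    have hfi : ContDiff ℝ (i + 1 : ℕ) f := hf.of_le (by
      exact_mod_cast Nat.succ_le_of_lt (Finset.mem_range.1 hi))
    refine (((diagSymm i hfi y).hasFDerivAt h).const_smul _).congr_fderiv ?_
    rw [smul_smul]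
    congr 1
    rw [Nat.factorial_succ]
    push_cast
    have : (i.factorial : ℝ) ≠ 0 := by positivity
    field_simp
  have := (HasFDerivAt.fun_sum hs).add h0
  rw [add_zero] at this
  refine this.congr_of_eventuallyEq (Filter.Eventually.of_forall fun x => ?_)
  simp only [taylorPoly, Finset.sum_range_succ' _ n]
  rfl

/-- Along the segment from y to y + h, the derivative of the remainder of f is the remainder of ∇f,
one order lower, applied to h. Integrating its bound gives an induction on n over all targets. -/
lemma norm_sub_taylorPoly_le (n : ℕ) :
    ∀ {F : Type u} [NormedAddCommGroup F] [NormedSpace ℝ F] {f : E → F} {C : ℝ},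
    ContDiff ℝ n f → (∀ x, ‖iteratedFDeriv ℝ n f x‖ ≤ C) → ∀ y h : E,
    ‖f (y + h) - taylorPoly f n y h‖ ≤ C * ‖h‖ ^ n / (n.factorial : ℝ) := by
  induction n with
  | zero =>
    intro F _ _ f C hf hC y h
    simpa [taylorPoly] using hC (y + h)
  | succ n ih =>
    intro F _ _ f C hf hC y h
    have hf' : ContDiff ℝ n (fderiv ℝ f) := hf.fderiv_right (by norm_cast)
    have hd : Differentiable ℝ f := hf.differentiable (by simp)
    have ih' := ih hf' (C := C) (fun x => by rw [norm_iteratedFDeriv_fderiv]; exact hC x) y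
    set r : ℝ → F := fun s => f (y + s • h) - taylorPoly f (n + 1) y (s • h) with hr
    have hline : ∀ s : ℝ, HasDerivAt (fun s : ℝ => s • h) h s := fun s => by
      simpa using (hasDerivAt_id s).smul_const h
    have hder : ∀ s : ℝ, HasDerivAt r
        ((fderiv ℝ f (y + s • h) - taylorPoly (fderiv ℝ f) n y (s • h)) h) s := by
      intro s
      have h1 : HasDerivAt (fun s : ℝ => f (y + s • h)) (fderiv ℝ f (y + s • h) h) s :=
        (hd _).hasFDerivAt.comp_hasDerivAt s ((hline s).const_add y)
      have h2 := (hasFDerivAt_taylorPoly (n := n) (hf.of_le (by norm_cast; omega)) y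
        (s • h)).comp_hasDerivAt s (hline s)
      exact h1.sub h2
    have hB : ∀ s : ℝ, HasDerivAt
        (fun s : ℝ => C * ‖h‖ ^ (n + 1) / ((n + 1).factorial : ℝ) * s ^ (n + 1))
        (C * ‖h‖ ^ (n + 1) / (n.factorial : ℝ) * s ^ n) s := by
      intro s
      have := (hasDerivAt_pow (n + 1) s).const_mul (C * ‖h‖ ^ (n + 1) / ((n + 1).factorial : ℝ))
      refine this.congr_deriv ?_
      rw [Nat.factorial_succ]
      push_cast
      have : (n.factorial : ℝ) ≠ 0 := by positivity
      field_simp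
    have := image_norm_le_of_norm_deriv_right_le_deriv_boundary (a := 0) (b := 1) (f := r)
      (fun s _ => (hder s).continuousAt.continuousWithinAt)
      (fun s _ => (hder s).hasDerivWithinAt)
      (B := fun s : ℝ => C * ‖h‖ ^ (n + 1) / ((n + 1).factorial : ℝ) * s ^ (n + 1))
      (by
        have : ∀ i : ℕ, iteratedFDeriv ℝ (i + 1) f y (fun _ => 0) = 0 := fun i =>
          (iteratedFDeriv ℝ (i + 1) f y).map_zero
        simp [hr, taylorPoly, Finset.sum_range_succ', this]) hB
      (fun s hs => by
        have h1 := ih' (s • h)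
        rw [norm_smul, Real.norm_of_nonneg hs.1] at h1
        calc _ ≤ _ := ContinuousLinearMap.le_opNorm _ _
          _ ≤ C * (s * ‖h‖) ^ n / n.factorial * ‖h‖ := by gcongr
          _ = _ := by ring)
      (x := 1) (by simp)
    simpa [hr] using this

end TaylorBound

end BiOPT

namespace BiOPT

/-! ### Convexity through first and second derivatives -/

section Convexity

variable {E : Type*} [NormedAddCommGroup E] [InnerProductSpace ℝ E]

/-- `g` is twice differentiable with first derivative `g'` and second derivative `g''`. -/
structure HasSecondDeriv (g : E → ℝ) (g' : E → E →L[ℝ] ℝ) (g'' : E → E →L[ℝ] E →L[ℝ] ℝ) :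
    Prop where
  first : ∀ x, HasFDerivAt g (g' x) x
  second : ∀ x, HasFDerivAt g' (g'' x) x

namespace HasSecondDeriv

variable {g h : E → ℝ} {g' h' : E → E →L[ℝ] ℝ} {g'' h'' : E → E →L[ℝ] E →L[ℝ] ℝ}

lemma add (hg : HasSecondDeriv g g' g'') (hh : HasSecondDeriv h h' h'') :
    HasSecondDeriv (fun x => g x + h x) (fun x => g' x + h' x) (fun x => g'' x + h'' x) :=
  ⟨fun x => (hg.first x).add (hh.first x), fun x => (hg.second x).add (hh.second x)⟩

lemma sub (hg : HasSecondDeriv g g' g'') (hh : HasSecondDeriv h h' h'') :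
    HasSecondDeriv (fun x => g x - h x) (fun x => g' x - h' x) (fun x => g'' x - h'' x) :=
  ⟨fun x => (hg.first x).sub (hh.first x), fun x => (hg.second x).sub (hh.second x)⟩

lemma const_mul (hg : HasSecondDeriv g g' g'') (c : ℝ) :
    HasSecondDeriv (fun x => c * g x) (fun x => c • g' x) (fun x => c • g'' x) :=
  ⟨fun x => (hg.first x).const_mul c, fun x => (hg.second x).const_smul c⟩

lemma comp_sub_const (hg : HasSecondDeriv g g' g'') (y : E) :
    HasSecondDeriv (fun x => g (x - y)) (fun x => g' (x - y)) (fun x => g'' (x - y)) := by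
  have key : ∀ x, HasFDerivAt (fun x : E => x - y) (ContinuousLinearMap.id ℝ E) x :=
    fun x => (hasFDerivAt_id x).sub_const y
  exact ⟨fun x => (hg.first (x - y)).comp x (key x), fun x => (hg.second (x - y)).comp x (key x)⟩

lemma sum {ι : Type*} {s : Finset ι} {G : ι → E → ℝ} {G' : ι → E → E →L[ℝ] ℝ}
    {G'' : ι → E → E →L[ℝ] E →L[ℝ] ℝ} (hG : ∀ i ∈ s, HasSecondDeriv (G i) (G' i) (G'' i)) :
    HasSecondDeriv (fun x => ∑ i ∈ s, G i x) (fun x => ∑ i ∈ s, G' i x)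
      (fun x => ∑ i ∈ s, G'' i x) :=
  ⟨fun x => HasFDerivAt.fun_sum fun i hi => (hG i hi).first x,
    fun x => HasFDerivAt.fun_sum fun i hi => (hG i hi).second x⟩

lemma differentiable (hg : HasSecondDeriv g g' g'') : Differentiable ℝ g :=
  fun x => (hg.first x).differentiableAt

lemma fderiv_eq (hg : HasSecondDeriv g g' g'') : fderiv ℝ g = g' :=
  funext fun x => (hg.first x).fderiv

lemma iteratedFDeriv_two (hg : HasSecondDeriv g g' g'') (x : E) :
    ‖iteratedFDeriv ℝ 2 g x‖ = ‖g'' x‖ := by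
  rw [← norm_iteratedFDeriv_fderiv, hg.fderiv_eq, norm_iteratedFDeriv_one, (hg.second x).fderiv]

lemma symm (hg : HasSecondDeriv g g' g'') (x v w : E) : g'' x v w = g'' x w v :=
  second_derivative_symmetric hg.first (hg.second x) v w

lemma of_contDiff (hg : ContDiff ℝ 2 g) :
    HasSecondDeriv g (fderiv ℝ g) (fderiv ℝ (fderiv ℝ g)) :=
  ⟨fun x => (hg.differentiable (by norm_num) x).hasFDerivAt,
    fun x => ((hg.fderiv_right (m := 1) (by norm_num)).differentiable (by norm_num)
      x).hasFDerivAt⟩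

end HasSecondDeriv

lemma add_deriv_le_of_second_deriv_nonneg {u u' u'' : ℝ → ℝ} (h1 : ∀ t, HasDerivAt u (u' t) t)
    (h2 : ∀ t, HasDerivAt u' (u'' t) t) (h3 : ∀ t ∈ Set.Icc (0 : ℝ) 1, 0 ≤ u'' t) :
    u 0 + u' 0 ≤ u 1 := by
  have hc : ConvexOn ℝ (Set.Icc (0 : ℝ) 1) u :=
    convexOn_of_hasDerivWithinAt2_nonneg (convex_Icc 0 1)
      (fun t _ => (h1 t).continuousAt.continuousWithinAt)
      (fun t _ => (h1 t).hasDerivWithinAt) (fun t _ => (h2 t).hasDerivWithinAt)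
      (fun t ht => h3 t (interior_subset ht))
  have := hc.le_slope_of_hasDerivAt (by simp) (by simp) zero_lt_one (h1 0)
  simp [slope_def_field] at this
  linarith

lemma HasSecondDeriv.line {g : E → ℝ} {g' : E → E →L[ℝ] ℝ} {g'' : E → E →L[ℝ] E →L[ℝ] ℝ}
    (hg : HasSecondDeriv g g' g'') (x v : E) :
    (∀ t : ℝ, HasDerivAt (fun t : ℝ => g (x + t • v)) (g' (x + t • v) v) t) ∧
    (∀ t : ℝ, HasDerivAt (fun t : ℝ => g' (x + t • v) v) (g'' (x + t • v) v v) t) := by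
  have hline : ∀ t : ℝ, HasDerivAt (fun t : ℝ => x + t • v) v t := fun t => by
    simpa using ((hasDerivAt_id t).smul_const v).const_add x
  refine ⟨fun t => (hg.first _).comp_hasDerivAt t (hline t), fun t => ?_⟩
  have := ((hg.second _).comp_hasDerivAt t (hline t)).clm_apply (hasDerivAt_const t v)
  simpa using this

lemma convexOn_of_bregman_nonneg {g : E → ℝ} (h : ∀ x y, 0 ≤ bregman g x y) :
    ConvexOn ℝ Set.univ g := by
  refine ⟨convex_univ, fun x _ y _ a b ha hb hab => ?_⟩
  set z := a • x + b • y with hz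
  have h1 := mul_nonneg ha (h z x)
  have h2 := mul_nonneg hb (h z y)
  have h3 : a * fderiv ℝ g z (x - z) + b * fderiv ℝ g z (y - z) = 0 := by
    rw [← smul_eq_mul, ← smul_eq_mul, ← map_smul, ← map_smul, ← map_add]
    have : a • (x - z) + b • (y - z) = z - (a + b) • z := by rw [hz]; module
    rw [this, hab]; simp
  simp only [bregman] at h1 h2
  have h4 : (a + b) * g z = g z := by rw [hab, one_mul]
  simp only [smul_eq_mul]
  linarith

lemma bregman_nonneg_of_convexOn {g : E → ℝ} (hc : ConvexOn ℝ Set.univ g) {x : E}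
    (hd : DifferentiableAt ℝ g x) (y : E) : 0 ≤ bregman g x y := by
  have hline : HasDerivAt (fun t : ℝ => x + t • (y - x)) (y - x) 0 := by
    simpa using ((hasDerivAt_id (0 : ℝ)).smul_const (y - x)).const_add x
  have hder : HasDerivAt (fun t : ℝ => g (x + t • (y - x))) (fderiv ℝ g x (y - x)) 0 :=
    HasFDerivAt.comp_hasDerivAt (0 : ℝ) (by simpa using hd.hasFDerivAt) hline
  have hcl : ConvexOn ℝ Set.univ (fun t : ℝ => g (x + t • (y - x))) := by
    have := hc.comp_affineMap (AffineMap.lineMap x y : ℝ →ᵃ[ℝ] E)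
    refine this.congr fun t _ => ?_
    simp [AffineMap.lineMap_apply, add_comm]
  have := hcl.le_slope_of_hasDerivAt (Set.mem_univ _) (Set.mem_univ _) zero_lt_one hder
  simp [slope_def_field] at this
  simp only [bregman, map_sub]
  linarith

lemma HasSecondDeriv.convexOn {g : E → ℝ} {g' : E → E →L[ℝ] ℝ} {g'' : E → E →L[ℝ] E →L[ℝ] ℝ}
    (hg : HasSecondDeriv g g' g'') (h : ∀ x v, 0 ≤ g'' x v v) : ConvexOn ℝ Set.univ g := by
  refine convexOn_of_bregman_nonneg fun x y => ?_
  obtain ⟨h1, h2⟩ := hg.line x (y - x)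
  have := add_deriv_le_of_second_deriv_nonneg h1 h2 fun t _ => h _ _
  simp only [bregman, hg.fderiv_eq, map_sub]
  simp at this
  linarith

lemma HasSecondDeriv.nonneg_of_convexOn {g : E → ℝ} {g' : E → E →L[ℝ] ℝ}
    {g'' : E → E →L[ℝ] E →L[ℝ] ℝ}
    (hg : HasSecondDeriv g g' g'') (hc : ConvexOn ℝ Set.univ g) (x v : E) : 0 ≤ g'' x v v := by
  obtain ⟨h1, h2⟩ := hg.line x v
  have hcl : ConvexOn ℝ Set.univ (fun t : ℝ => g (x + t • v)) := by
    have := hc.comp_affineMap (AffineMap.lineMap x (x + v) : ℝ →ᵃ[ℝ] E)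
    refine this.congr fun t _ => ?_
    simp [AffineMap.lineMap_apply, add_comm]
  have hmono : Monotone (fun t : ℝ => g' (x + t • v) v) := by
    have := hcl.monotoneOn_deriv fun t _ => (h1 t).differentiableAt
    rw [show deriv (fun t : ℝ => g (x + t • v)) = fun t => g' (x + t • v) v from
      funext fun t => (h1 t).deriv] at this
    exact monotoneOn_univ.1 this
  have := hmono.deriv_nonneg (x := 0)
  rw [(h2 0).deriv] at this
  simpa using this

/-- Comparison of `g` on a segment with a function of one variable. -/
lemma HasSecondDeriv.bregman_le {g : E → ℝ} {g' : E → E →L[ℝ] ℝ} {g'' : E → E →L[ℝ] E →L[ℝ] ℝ}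
    (hg : HasSecondDeriv g g' g'') {k k' k'' : ℝ → ℝ} (h1 : ∀ t, HasDerivAt k (k' t) t)
    (h2 : ∀ t, HasDerivAt k' (k'' t) t) (x y : E)
    (h : ∀ t ∈ Set.Icc (0 : ℝ) 1, g'' (x + t • (y - x)) (y - x) (y - x) ≤ k'' t) :
    bregman g x y ≤ k 1 - k 0 - k' 0 := by
  obtain ⟨g1, g2⟩ := hg.line x (y - x)
  have := add_deriv_le_of_second_deriv_nonneg (fun t => (h1 t).sub (g1 t))
    (fun t => (h2 t).sub (g2 t)) fun t ht => sub_nonneg.2 (h t ht)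
  simp only [bregman, hg.fderiv_eq, map_sub]
  simp at this
  linarith

/-- A positive semidefinite symmetric form is bounded by its values on the diagonal. -/
lemma norm_le_of_diag_le {B : E →L[ℝ] E →L[ℝ] ℝ} (hs : ∀ v w, B v w = B w v)
    (h0 : ∀ v, 0 ≤ B v v) {C : ℝ} (hC : 0 ≤ C) (h : ∀ v, B v v ≤ C * ‖v‖ ^ 2) : ‖B‖ ≤ C := by
  refine ContinuousLinearMap.opNorm_le_bound _ hC fun v =>
    ContinuousLinearMap.opNorm_le_bound _ (by positivity) fun w => ?_
  -- Cauchy–Schwarz: the quadratic t ↦ B(v + tw, v + tw) is nonnegative, so its discriminant is not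
  -- positive.
  have hcs : (B v w) ^ 2 ≤ B v v * B w w := by
    have := discrim_le_zero (a := B w w) (b := 2 * B v w) (c := B v v) fun t => by
      have := h0 (v + t • w)
      simp only [map_add, map_smul, add_apply, smul_apply,
        smul_eq_mul, hs w v] at this
      linarith
    simp only [discrim] at this
    linarith
  rw [Real.norm_eq_abs]
  refine abs_le_of_sq_le_sq ?_ (by positivity)
  calc (B v w) ^ 2 ≤ B v v * B w w := hcs
    _ ≤ (C * ‖v‖ ^ 2) * (C * ‖w‖ ^ 2) := mul_le_mul (h v) (h w) (h0 w) (by positivity)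
    _ = _ := by ring

end Convexity

/-! ### The power of the norm -/

section PowerProx

variable {E : Type*} [NormedAddCommGroup E] [InnerProductSpace ℝ E]

/-- The inner product as a bilinear form. -/
noncomputable def innerForm : E →L[ℝ] E →L[ℝ] ℝ := innerSL ℝ

@[simp] lemma innerForm_apply (v w : E) : innerForm v w = inner ℝ v w := rfl

lemma norm_innerForm_apply (v : E) : ‖innerForm v‖ = ‖v‖ := innerSL_apply_norm ℝ v

/-- The gradient `‖x‖^{p-1} ⟨x, ·⟩` of `d_{p+1}`. -/
noncomputable def dGrad (p : ℕ) (x : E) : E →L[ℝ] ℝ := ‖x‖ ^ (p - 1) • innerForm x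

/-- The second derivative of `d_{p+1}`. -/
noncomputable def dHess (p : ℕ) (x : E) : E →L[ℝ] E →L[ℝ] ℝ :=
  ‖x‖ ^ (p - 1) • innerForm +
    (((p : ℝ) - 1) * (‖x‖ ^ (p - 1) / ‖x‖ ^ 2)) • (innerForm x).smulRight (innerForm x)

lemma norm_dGrad {p : ℕ} (hp : 2 ≤ p) (x : E) : ‖dGrad p x‖ = ‖x‖ ^ p := by
  obtain ⟨q, rfl⟩ := Nat.exists_eq_add_of_le' (show 1 ≤ p by omega)
  simp [dGrad, norm_smul, pow_succ, norm_innerForm_apply]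

lemma dHess_apply (p : ℕ) (x v w : E) : dHess p x v w = ‖x‖ ^ (p - 1) * inner ℝ v w +
    ((p : ℝ) - 1) * (‖x‖ ^ (p - 1) / ‖x‖ ^ 2) * (inner ℝ x v * inner ℝ x w) := by
  simp [dHess]

lemma hasFDerivAt_norm {x : E} (hx : x ≠ 0) :
    HasFDerivAt (fun z : E => ‖z‖) (‖x‖⁻¹ • innerForm x) x := by
  have h1 : HasFDerivAt (fun z : E => ‖z‖ ^ 2) (2 • innerForm x) x :=
    (hasStrictFDerivAt_norm_sq x).hasFDerivAt
  have h2 := h1.sqrt (by positivity)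
  simp only [Real.sqrt_sq (norm_nonneg _)] at h2
  refine h2.congr_fderiv ?_
  ext v
  simp
  field_simp

lemma hasFDerivAt_norm_pow {x : E} (hx : x ≠ 0) (n : ℕ) :
    HasFDerivAt (fun z : E => ‖z‖ ^ n) ((n * (‖x‖ ^ n / ‖x‖ ^ 2)) • innerForm x) x := by
  refine ((hasFDerivAt_norm hx).pow n).congr_fderiv ?_
  have : ‖x‖ ≠ 0 := norm_ne_zero_iff.2 hx
  cases n with
  | zero => simp
  | succ n =>
    ext v
    simp
    field_simp
    ring

lemma hasSecondDeriv_d {p : ℕ} (hp : 2 ≤ p) :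
    HasSecondDeriv (d p : E → ℝ) (dGrad p) (dHess p) := by
  refine ⟨fun x => ?_, fun x => ?_⟩
  · by_cases hx : x = 0
    · subst hx
      have h0 : dGrad p (0 : E) = 0 := by simp [dGrad]
      rw [h0, hasFDerivAt_iff_isLittleO_nhds_zero]
      have : (fun h : E => ‖h‖ ^ (p + 1)) =o[nhds 0] fun h : E => h :=
        Asymptotics.isLittleO_norm_pow_id (by omega)
      refine (this.const_mul_left (((p : ℝ) + 1)⁻¹)).congr_left fun h => ?_
      simp [d, div_eq_inv_mul]
    · have hn : ‖x‖ ≠ 0 := norm_ne_zero_iff.2 hx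
      have := (hasFDerivAt_norm_pow hx (p + 1)).mul_const (((p : ℝ) + 1)⁻¹)
      simp only [← div_eq_mul_inv] at this
      refine this.congr_fderiv ?_
      obtain ⟨q, rfl⟩ := Nat.exists_eq_add_of_le' (show 1 ≤ p by omega)
      ext v
      simp [dGrad]
      field_simp
      ring
  · by_cases hx : x = 0
    · subst hx
      -- The quotient by ‖0‖² in `dHess` has a default value, but it multiplies the zero form; the
      -- other term vanishes because p ≥ 2.
      have h0 : dHess p (0 : E) = 0 := by
        ext v w; simp [dHess_apply, zero_pow (show p - 1 ≠ 0 by omega)]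
      rw [h0, hasFDerivAt_iff_isLittleO_nhds_zero]
      have : (fun h : E => ‖h‖ ^ p) =o[nhds 0] fun h : E => h :=
        Asymptotics.isLittleO_norm_pow_id (by omega)
      refine Asymptotics.IsLittleO.of_norm_left (this.congr_left fun h => ?_)
      simp [norm_dGrad hp, show dGrad p (0 : E) = 0 by simp [dGrad]]
    · have h1 := (hasFDerivAt_norm_pow hx (p - 1)).smul
        (innerForm (E := E)).hasFDerivAt
      refine h1.congr_fderiv ?_
      ext v w
      rw [dHess_apply]
      simp [Nat.cast_sub (show 1 ≤ p by omega)]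
      ring

lemma dHess_diag_ge {p : ℕ} (hp : 2 ≤ p) (x v : E) :
    ‖x‖ ^ (p - 1) * ‖v‖ ^ 2 ≤ dHess p x v v := by
  rw [dHess_apply, real_inner_self_eq_norm_sq]
  have : (0 : ℝ) ≤ (p : ℝ) - 1 := by
    have : (2 : ℝ) ≤ p := by exact_mod_cast hp
    linarith
  have : 0 ≤ ((p : ℝ) - 1) * (‖x‖ ^ (p - 1) / ‖x‖ ^ 2) * (inner ℝ x v * inner ℝ x v) :=
    mul_nonneg (by positivity) (mul_self_nonneg _)
  linarith

lemma norm_dHess_le {p : ℕ} (hp : 2 ≤ p) (x : E) : ‖dHess p x‖ ≤ p * ‖x‖ ^ (p - 1) := by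
  have hp1 : (0 : ℝ) ≤ (p : ℝ) - 1 := by
    have : (2 : ℝ) ≤ p := by exact_mod_cast hp
    linarith
  refine ContinuousLinearMap.opNorm_le_bound _ (by positivity) fun v =>
    ContinuousLinearMap.opNorm_le_bound _ (by positivity) fun w => ?_
  rw [dHess_apply]
  by_cases hx : x = 0
  · simp [hx, zero_pow (show p - 1 ≠ 0 by omega)]
  have hn : 0 < ‖x‖ := norm_pos_iff.2 hx
  have h1 : |inner ℝ v w| ≤ ‖v‖ * ‖w‖ := abs_real_inner_le_norm v w
  have h2 : |inner ℝ x v * inner ℝ x w| ≤ (‖x‖ * ‖v‖) * (‖x‖ * ‖w‖) := by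
    rw [abs_mul]
    exact mul_le_mul (abs_real_inner_le_norm x v) (abs_real_inner_le_norm x w) (abs_nonneg _)
      (by positivity)
  rw [Real.norm_eq_abs]
  calc _ ≤ |‖x‖ ^ (p - 1) * inner ℝ v w|
        + |((p : ℝ) - 1) * (‖x‖ ^ (p - 1) / ‖x‖ ^ 2) * (inner ℝ x v * inner ℝ x w)| :=
        abs_add_le _ _
    _ = ‖x‖ ^ (p - 1) * |inner ℝ v w|
        + ((p : ℝ) - 1) * (‖x‖ ^ (p - 1) / ‖x‖ ^ 2) * |inner ℝ x v * inner ℝ x w| := by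
        rw [abs_mul, abs_mul, abs_of_nonneg (a := ‖x‖ ^ (p - 1)) (by positivity),
          abs_of_nonneg (a := ((p : ℝ) - 1) * (‖x‖ ^ (p - 1) / ‖x‖ ^ 2)) (by positivity)]
    _ ≤ ‖x‖ ^ (p - 1) * (‖v‖ * ‖w‖)
        + ((p : ℝ) - 1) * (‖x‖ ^ (p - 1) / ‖x‖ ^ 2) * ((‖x‖ * ‖v‖) * (‖x‖ * ‖w‖)) := by gcongr
    _ = p * ‖x‖ ^ (p - 1) * ‖v‖ * ‖w‖ := by field_simp; ring

lemma dHess_self_self {p : ℕ} (hp : 2 ≤ p) (x : E) : dHess p x x x = p * ‖x‖ ^ (p + 1) := by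
  rw [dHess_apply, real_inner_self_eq_norm_sq]
  by_cases hx : x = 0
  · simp [hx]
  have hn : ‖x‖ ≠ 0 := norm_ne_zero_iff.2 hx
  obtain ⟨q, rfl⟩ := Nat.exists_eq_add_of_le' (show 1 ≤ p by omega)
  simp
  field_simp
  ring

/-- With q = p − 1, the right side is ½(‖y‖^q + ‖x‖^q)‖y − x‖² plus ½(‖y‖^q − ‖x‖^q)(‖y‖² − ‖x‖²).
The second term is nonnegative, and convexity of r ↦ r^q bounds the mean in the first below by (‖y −
x‖/2)^q. -/
lemma dGrad_mono {p : ℕ} (hp : 2 ≤ p) (x y : E) :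
    ((2 : ℝ) ^ (p - 1))⁻¹ * ‖y - x‖ ^ (p + 1) ≤ (dGrad p y - dGrad p x) (y - x) := by
  obtain ⟨q, rfl⟩ := Nat.exists_eq_add_of_le' (show 1 ≤ p by omega)
  have hq : q + 1 - 1 = q := by omega
  have hsq := norm_sub_sq_real y x
  have h1 : (dGrad (q + 1) y - dGrad (q + 1) x) (y - x)
      = ‖y‖ ^ q * (‖y‖ ^ 2 - inner ℝ y x) - ‖x‖ ^ q * (inner ℝ y x - ‖x‖ ^ 2) := by
    simp [dGrad, inner_sub_right, real_inner_comm]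
  have h2 : (‖y‖ ^ q - ‖x‖ ^ q) * (‖y‖ ^ 2 - ‖x‖ ^ 2) ≥ 0 := by
    rcases le_total ‖x‖ ‖y‖ with h | h
    · exact mul_nonneg (sub_nonneg.2 (pow_le_pow_left₀ (norm_nonneg _) h _))
        (sub_nonneg.2 (pow_le_pow_left₀ (norm_nonneg _) h _))
    · exact mul_nonneg_of_nonpos_of_nonpos (sub_nonpos.2 (pow_le_pow_left₀ (norm_nonneg _) h _))
        (sub_nonpos.2 (pow_le_pow_left₀ (norm_nonneg _) h _))
  have h3 : ((2 : ℝ) ^ q)⁻¹ * ‖y - x‖ ^ q ≤ (‖y‖ ^ q + ‖x‖ ^ q) / 2 := by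
    have hc := (convexOn_pow (𝕜 := ℝ) q).2 (Set.mem_Ici.2 (norm_nonneg y))
      (Set.mem_Ici.2 (norm_nonneg x)) (show (0 : ℝ) ≤ 1 / 2 by norm_num)
      (show (0 : ℝ) ≤ 1 / 2 by norm_num) (by norm_num)
    simp only [smul_eq_mul] at hc
    calc ((2 : ℝ) ^ q)⁻¹ * ‖y - x‖ ^ q = (‖y - x‖ / 2) ^ q := by rw [div_pow]; ring
      _ ≤ (1 / 2 * ‖y‖ + 1 / 2 * ‖x‖) ^ q := by
        gcongr
        have := norm_sub_le y x
        linarith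
      _ ≤ _ := by linarith
  have h4 := mul_le_mul_of_nonneg_right h3 (sq_nonneg ‖y - x‖)
  rw [h1, hq]
  calc ((2 : ℝ) ^ q)⁻¹ * ‖y - x‖ ^ (q + 1 + 1) = ((2 : ℝ) ^ q)⁻¹ * ‖y - x‖ ^ q * ‖y - x‖ ^ 2 := by
        ring
    _ ≤ (‖y‖ ^ q + ‖x‖ ^ q) / 2 * ‖y - x‖ ^ 2 := h4
    _ ≤ _ := by rw [hsq]; linarith

/-- Uniform convexity of the power of the norm. -/
lemma uniformlyConvex_d {p : ℕ} (hp : 2 ≤ p) :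
    UniformlyConvex (d p : E → ℝ) p ((2 : ℝ) ^ (p - 1))⁻¹ := by
  intro x y
  have hd := hasSecondDeriv_d (E := E) hp
  set c : ℝ := ((2 : ℝ) ^ (p - 1))⁻¹
  set v := y - x with hv
  obtain ⟨h1, -⟩ := hd.line x v
  set u : ℝ → ℝ := fun t => d p (x + t • v) - t * dGrad p x v
    - c / ((p : ℝ) + 1) * ‖v‖ ^ (p + 1) * t ^ (p + 1) with hu
  have hder : ∀ t, HasDerivAt u
      ((dGrad p (x + t • v) - dGrad p x) v - c * ‖v‖ ^ (p + 1) * t ^ p) t := by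
    intro t
    have h2 := ((h1 t).sub ((hasDerivAt_id t).mul_const (dGrad p x v))).sub
      ((hasDerivAt_pow (p + 1) t).const_mul (c / ((p : ℝ) + 1) * ‖v‖ ^ (p + 1)))
    refine h2.congr_deriv ?_
    have : (p : ℝ) + 1 ≠ 0 := by positivity
    simp
    field_simp
  have hmono : MonotoneOn u (Set.Icc 0 1) := by
    refine monotoneOn_of_deriv_nonneg (convex_Icc 0 1)
      (fun t _ => (hder t).continuousAt.continuousWithinAt)
      (fun t _ => (hder t).differentiableAt.differentiableWithinAt) fun t ht => ?_
    rw [(hder t).deriv]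
    rw [interior_Icc] at ht
    -- Monotonicity for the increment tv, divided by t > 0, is exactly u'(t) ≥ 0.
    have := dGrad_mono hp x (x + t • v)
    simp only [add_sub_cancel_left, norm_smul, Real.norm_of_nonneg ht.1.le, map_smul,
      smul_eq_mul, mul_pow] at this
    have h3 : t * (c * ‖v‖ ^ (p + 1) * t ^ p) ≤ t * (dGrad p (x + t • v) - dGrad p x) v := by
      calc _ = c * (t ^ (p + 1) * ‖v‖ ^ (p + 1)) := by ring
        _ ≤ _ := this
    exact sub_nonneg.2 (le_of_mul_le_mul_left h3 ht.1)
  have := hmono (by simp) (by simp) (zero_le_one)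
  simp only [hu] at this
  simp [hv] at this
  simp only [bregman, hd.fderiv_eq]
  rw [← hv, hv, map_sub, ← hv]
  linarith

end PowerProx

end BiOPT

namespace BiOPT

/-! ### The scaling function -/

section Scaling

universe u
variable {E : Type u} [NormedAddCommGroup E] [InnerProductSpace ℝ E]

/-- The second derivative at `y + h` of the even Taylor part of `f` at `y`. -/
noncomputable def evenHess (f : E → ℝ) (p : ℕ) (y h : E) : E →L[ℝ] E →L[ℝ] ℝ :=
  ∑ k ∈ Finset.range (p / 2),
    (((2 * k).factorial : ℝ)⁻¹) • iteratedFDeriv ℝ (2 * k) (fderiv ℝ (fderiv ℝ f)) y (fun _ => h)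

lemma sum_Icc_one_eq_sum_range {A : Type*} [AddCommMonoid A] (c : ℕ → A) (q : ℕ) :
    ∑ j ∈ Finset.Icc 1 q, c j = ∑ k ∈ Finset.range q, c (k + 1) := by
  induction q with
  | zero => simp
  | succ q ih => rw [Finset.sum_Icc_succ_top (by omega), ih, Finset.sum_range_succ]

lemma sum_range_add_neg_one_pow {A : Type*} [AddCommGroup A] [Module ℝ A] (c : ℕ → A) (n : ℕ) :
    ∑ i ∈ Finset.range n, (c i + (-1 : ℝ) ^ i • c i)
      = (2 : ℝ) • ∑ k ∈ Finset.range ((n + 1) / 2), c (2 * k) := by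
  induction n with
  | zero => simp
  | succ n ih =>
    rw [Finset.sum_range_succ, ih]
    rcases Nat.even_or_odd' n with ⟨m, rfl | rfl⟩
    · rw [show (2 * m + 1) / 2 = m by omega, show (2 * m + 1 + 1) / 2 = m + 1 by omega,
        Finset.sum_range_succ, smul_add, pow_mul]
      simp [two_smul]
    · rw [show (2 * m + 1 + 1) / 2 = m + 1 by omega, show (2 * m + 1 + 1 + 1) / 2 = m + 1 by omega,
        pow_succ, pow_mul]
      simp

lemma norm_le_add_of_norm_sub_le {F : Type*} [NormedAddCommGroup F]
    {a b : F} {C K : ℝ} (ha : ‖a‖ ≤ K) (h : ‖a - b‖ ≤ C) :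
    ‖b‖ ≤ K + C := by
  have := norm_sub_norm_le b a
  rw [norm_sub_rev] at this
  linarith

section Half

variable {F : Type*} [NormedAddCommGroup F] [NormedSpace ℝ F]

lemma eq_half_smul {a b : F} (h : a = (2 : ℝ) • b) : b = (1 / 2 : ℝ) • a := by
  rw [h, smul_smul]; norm_num

lemma norm_half_smul_add_le {a b : F} {C : ℝ} (ha : ‖a‖ ≤ C) (hb : ‖b‖ ≤ C) :
    ‖(1 / 2 : ℝ) • (a + b)‖ ≤ C := by
  rw [norm_smul, show ‖(1 / 2 : ℝ)‖ = 1 / 2 by norm_num]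
  have := norm_add_le a b
  linarith

lemma norm_half_smul_add_sub_le {a b c e : F} {C : ℝ} (ha : ‖a - c‖ ≤ C) (hb : ‖b - e‖ ≤ C) :
    ‖(1 / 2 : ℝ) • (a + b) - (1 / 2 : ℝ) • (c + e)‖ ≤ C := by
  rw [← smul_sub, add_sub_add_comm]
  exact norm_half_smul_add_le ha hb

lemma norm_smul_le_of_nonneg {a : F} {t C : ℝ} (ht : 0 ≤ t) (ha : ‖a‖ ≤ C) :
    ‖t • a‖ ≤ t * C := by
  rw [norm_smul, Real.norm_of_nonneg ht]
  exact mul_le_mul_of_nonneg_left ha ht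

lemma norm_add_smul_le {a b : F} {t C K : ℝ} (ht : 0 ≤ t) (ha : ‖a‖ ≤ C) (hb : ‖b‖ ≤ K) :
    ‖a + t • b‖ ≤ C + t * K := by
  exact (norm_add_le _ _).trans (add_le_add ha (norm_smul_le_of_nonneg ht hb))

end Half

/-- Averaging over h and −h cancels the odd terms. This is how convexity of f at both y + h and y −
h acts on ρ. -/
lemma evenHess_eq_taylorPoly {p : ℕ} (hp : 2 ≤ p) (f : E → ℝ) (y h : E) :
    evenHess f p y h = (1 / 2 : ℝ) • (taylorPoly (fderiv ℝ (fderiv ℝ f)) (p - 1) y h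
      + taylorPoly (fderiv ℝ (fderiv ℝ f)) (p - 1) y (-h)) := by
  have hneg : ∀ i : ℕ, iteratedFDeriv ℝ i (fderiv ℝ (fderiv ℝ f)) y (fun _ => -h)
      = (-1 : ℝ) ^ i • iteratedFDeriv ℝ i (fderiv ℝ (fderiv ℝ f)) y (fun _ => h) := by
    intro i
    have := (iteratedFDeriv ℝ i (fderiv ℝ (fderiv ℝ f)) y).map_smul_univ
      (fun _ => (-1 : ℝ)) (fun _ => h)
    simpa using this
  have := sum_range_add_neg_one_pow (fun i => ((i.factorial : ℝ)⁻¹) •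
    iteratedFDeriv ℝ i (fderiv ℝ (fderiv ℝ f)) y (fun _ => h)) (p - 1)
  rw [show p - 1 + 1 = p by omega] at this
  simp only [taylorPoly, ← Finset.sum_add_distrib, hneg]
  simp only [smul_comm _ ((-1 : ℝ) ^ _)]
  exact eq_half_smul (F := E →L[ℝ] E →L[ℝ] ℝ) this

variable {f : E → ℝ} {p : ℕ} {H : ℝ}

lemma contDiff_fderiv_fderiv (hp : 2 ≤ p) (hfs : ContDiff ℝ ((p + 1 : ℕ) : WithTop ℕ∞) f) :
    ContDiff ℝ ((p - 1 : ℕ) : WithTop ℕ∞) (fderiv ℝ (fderiv ℝ f)) := by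
  have h1 : ContDiff ℝ (p : ℕ) (fderiv ℝ f) := hfs.fderiv_right (by norm_cast)
  exact h1.fderiv_right (by norm_cast; omega)

lemma hasSecondDeriv_of_contDiff (hp : 2 ≤ p)
    (hfs : ContDiff ℝ ((p + 1 : ℕ) : WithTop ℕ∞) f) :
    HasSecondDeriv f (fderiv ℝ f) (fderiv ℝ (fderiv ℝ f)) :=
  HasSecondDeriv.of_contDiff (hfs.of_le (by norm_cast; omega))

lemma hasSecondDeriv_form (hf : ContDiff ℝ (2 * k + 2 : ℕ) f) (y : E) :
    HasSecondDeriv (fun h : E => iteratedFDeriv ℝ (2 * k + 2) f y (fun _ => h)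
        / ((2 * k + 2).factorial : ℝ))
      (fun h => (((2 * k + 1).factorial : ℝ)⁻¹) •
        iteratedFDeriv ℝ (2 * k + 1) (fderiv ℝ f) y (fun _ => h))
      (fun h => (((2 * k).factorial : ℝ)⁻¹) •
        iteratedFDeriv ℝ (2 * k) (fderiv ℝ (fderiv ℝ f)) y (fun _ => h)) := by
  have h0 : ((2 * k).factorial : ℝ) ≠ 0 := by positivity
  refine ⟨fun h => ?_, fun h => ?_⟩
  · have := ((diagSymm_real hf y).hasFDerivAt h).mul_const
      (((2 * k + 2).factorial : ℝ)⁻¹)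
    simp only [← div_eq_mul_inv] at this
    refine this.congr_fderiv ?_
    rw [smul_smul]
    congr 1
    rw [Nat.factorial_succ (2 * k + 1), Nat.factorial_succ]
    push_cast
    field_simp
  · have hf' : ContDiff ℝ (2 * k + 1 : ℕ) (fderiv ℝ f) := hf.fderiv_right (by norm_cast)
    refine (((diagSymm _ hf' y).hasFDerivAt h).fun_const_smul _).congr_fderiv ?_
    rw [smul_smul]
    congr 1
    rw [Nat.factorial_succ]
    push_cast
    field_simp

lemma hasSecondDeriv_scaling (hp : 2 ≤ p) (hfs : ContDiff ℝ ((p + 1 : ℕ) : WithTop ℕ∞) f)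
    (H : ℝ) (y : E) :
    HasSecondDeriv (scaling f p H y) (fderiv ℝ (scaling f p H y))
      (fun x => evenHess f p y (x - y) + H • dHess p (x - y)) := by
  have h1 : ∀ k ∈ Finset.range (p / 2), _ := fun k hk =>
    hasSecondDeriv_form (k := k) (f := f) (hfs.of_le (by
      have := Finset.mem_range.1 hk
      norm_cast
      omega)) y
  have h2 := ((HasSecondDeriv.sum h1).add ((hasSecondDeriv_d (E := E) hp).const_mul H)
    ).comp_sub_const y
  have h3 : scaling f p H y = fun x => (∑ k ∈ Finset.range (p / 2),
      iteratedFDeriv ℝ (2 * k + 2) f y (fun _ => x - y) / ((2 * k + 2).factorial : ℝ))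
        + H * d p (x - y) := by
    ext x
    rw [scaling, sum_Icc_one_eq_sum_range]
    rfl
  rw [← h3] at h2
  rw [h2.fderiv_eq]
  exact h2

lemma hasSecondDeriv_proxSmooth (hp : 2 ≤ p) (hfs : ContDiff ℝ ((p + 1 : ℕ) : WithTop ℕ∞) f)
    (H : ℝ) (y : E) :
    HasSecondDeriv (proxSmooth f p H y) (fderiv ℝ (proxSmooth f p H y))
      (fun x => fderiv ℝ (fderiv ℝ f) x + H • dHess p (x - y)) := by
  have h2 := (hasSecondDeriv_of_contDiff hp hfs).add
    (((hasSecondDeriv_d (E := E) hp).const_mul H).comp_sub_const y)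
  have h4 : HasSecondDeriv (proxSmooth f p H y) _ _ := h2
  rw [h4.fderiv_eq]
  exact h4

lemma fderiv_proxSmooth (hp : 2 ≤ p) {x : E} (hf : DifferentiableAt ℝ f x) (H : ℝ) (y : E) :
    fderiv ℝ (proxSmooth f p H y) x = fderiv ℝ f x + H • dGrad p (x - y) :=
  (hf.hasFDerivAt.add ((((hasSecondDeriv_d (E := E) hp).const_mul H).comp_sub_const y).first
    x)).fderiv

lemma norm_taylor_hess_sub_le (hp : 2 ≤ p) (hfs : ContDiff ℝ ((p + 1 : ℕ) : WithTop ℕ∞) f)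
    (hM : MFinite f (p + 1)) (y h : E) :
    ‖fderiv ℝ (fderiv ℝ f) (y + h) - taylorPoly (fderiv ℝ (fderiv ℝ f)) (p - 1) y h‖
      ≤ M f (p + 1) / ((p - 1).factorial : ℝ) * ‖h‖ ^ (p - 1) := by
  have := norm_sub_taylorPoly_le (p - 1) (contDiff_fderiv_fderiv hp hfs) (C := M f (p + 1))
    (fun x => by
      rw [norm_iteratedFDeriv_fderiv, norm_iteratedFDeriv_fderiv,
        show p - 1 + 1 + 1 = p + 1 by omega]
      exact le_ciSup hM x) y h
  calc _ ≤ _ := this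
    _ = _ := by ring

lemma abs_apply_le {B : E →L[ℝ] E →L[ℝ] ℝ} {C : ℝ} (h : ‖B‖ ≤ C) (v : E) :
    |B v v| ≤ C * ‖v‖ ^ 2 := by
  calc |B v v| = ‖B v v‖ := rfl
    _ ≤ ‖B v‖ * ‖v‖ := ContinuousLinearMap.le_opNorm _ _
    _ ≤ ‖B‖ * ‖v‖ * ‖v‖ := by gcongr; exact ContinuousLinearMap.le_opNorm _ _
    _ ≤ C * ‖v‖ * ‖v‖ := by gcongr
    _ = _ := by ring

lemma norm_evenHess_sub_le (hp : 2 ≤ p) (hfs : ContDiff ℝ ((p + 1 : ℕ) : WithTop ℕ∞) f)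
    (hM : MFinite f (p + 1)) (y h : E) :
    ‖(1 / 2 : ℝ) • (fderiv ℝ (fderiv ℝ f) (y + h) + fderiv ℝ (fderiv ℝ f) (y - h))
      - evenHess f p y h‖ ≤ M f (p + 1) / ((p - 1).factorial : ℝ) * ‖h‖ ^ (p - 1) := by
  have h1 := norm_taylor_hess_sub_le hp hfs hM y h
  have h2 := norm_taylor_hess_sub_le hp hfs hM y (-h)
  rw [norm_neg, ← sub_eq_add_neg] at h2
  rw [evenHess_eq_taylorPoly hp]
  exact norm_half_smul_add_sub_le (F := E →L[ℝ] E →L[ℝ] ℝ) h1 h2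

lemma fderiv_fderiv_nonneg (hf : ConvexOn ℝ Set.univ f) (hp : 2 ≤ p)
    (hfs : ContDiff ℝ ((p + 1 : ℕ) : WithTop ℕ∞) f) (x v : E) :
    0 ≤ fderiv ℝ (fderiv ℝ f) x v v :=
  (hasSecondDeriv_of_contDiff hp hfs).nonneg_of_convexOn hf x v

/-- The Hessians of f at y ± h are nonnegative, so the even part can be negative only by the Taylor
error. -/
lemma evenHess_diag_ge (hf : ConvexOn ℝ Set.univ f) (hp : 2 ≤ p)
    (hfs : ContDiff ℝ ((p + 1 : ℕ) : WithTop ℕ∞) f) (hM : MFinite f (p + 1)) (y h v : E) :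
    -(M f (p + 1) / ((p - 1).factorial : ℝ) * ‖h‖ ^ (p - 1) * ‖v‖ ^ 2) ≤ evenHess f p y h v v := by
  have h1 := (abs_le.1 (abs_apply_le (norm_evenHess_sub_le hp hfs hM y h) v)).2
  have h2 := fderiv_fderiv_nonneg hf hp hfs (y + h) v
  have h3 := fderiv_fderiv_nonneg hf hp hfs (y - h) v
  simp at h1
  linarith

lemma regH_eq (f : E → ℝ) (p : ℕ) :
    M f (p + 1) / ((p - 1).factorial : ℝ) = regH f p / 6 := by
  rw [regH]; ring

lemma regH_pos (hM0 : 0 < M f (p + 1)) : 0 < regH f p := by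
  rw [regH]; positivity

/-- Five sixths of the power term account for the uniform convexity of `ρ`. -/
lemma scaling_hess_ge (hf : ConvexOn ℝ Set.univ f) (hp : 2 ≤ p)
    (hfs : ContDiff ℝ ((p + 1 : ℕ) : WithTop ℕ∞) f) (hM : MFinite f (p + 1))
    (hM0 : 0 < M f (p + 1)) (y x v : E) :
    5 / 6 * regH f p * dHess p (x - y) v v
      ≤ (evenHess f p y (x - y) + regH f p • dHess p (x - y)) v v := by
  have h1 := evenHess_diag_ge hf hp hfs hM y (x - y) v
  rw [regH_eq] at h1
  have h2 := mul_le_mul_of_nonneg_left (dHess_diag_ge hp (x - y) v) (regH_pos hM0).le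
  simp
  linarith

/-- By `scaling_hess_ge`, ρ − (5/6)H d_{p+1}(· − y) is convex, so ρ inherits 5/6 H times the modulus
of the power. -/
lemma uniformlyConvex_scaling (hf : ConvexOn ℝ Set.univ f) (hp : 2 ≤ p)
    (hfs : ContDiff ℝ ((p + 1 : ℕ) : WithTop ℕ∞) f) (hM : MFinite f (p + 1))
    (hM0 : 0 < M f (p + 1)) (y : E) :
    UniformlyConvex (scaling f p (regH f p) y) p (sigma₀ p (regH f p)) := by
  intro x z
  set H := regH f p with hH
  have hH0 : 0 < H := regH_pos hM0
  have hd := (((hasSecondDeriv_d (E := E) hp).const_mul (5 / 6 * H)).comp_sub_const y)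
  have hρ := hasSecondDeriv_scaling hp hfs H y
  have hc := (hρ.sub hd).convexOn fun w v => by
    have := scaling_hess_ge hf hp hfs hM hM0 y w v
    simp at this ⊢
    linarith
  have hb := bregman_nonneg_of_convexOn hc ((hρ.sub hd).differentiable x) z
  have hu := uniformlyConvex_d (E := E) hp (x - y) (z - y)
  simp only [bregman, (hρ.sub hd).fderiv_eq, (hasSecondDeriv_d (E := E) hp).fderiv_eq] at hb hu ⊢
  rw [show z - y - (x - y) = z - x by abel] at hu
  have hu' := mul_le_mul_of_nonneg_left hu (show 0 ≤ 5 / 6 * H by positivity)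
  simp only [sub_apply, smul_apply, smul_eq_mul] at hb
  calc sigma₀ p H / ((p : ℝ) + 1) * ‖z - x‖ ^ (p + 1)
      = 5 / 6 * H * (((2 : ℝ) ^ (p - 1))⁻¹ / ((p : ℝ) + 1) * ‖z - x‖ ^ (p + 1)) := by
        rw [sigma₀]; ring
    _ ≤ _ := hu'
    _ ≤ _ := by linarith

lemma sigma₀_pos (hM0 : 0 < M f (p + 1)) : 0 < sigma₀ p (regH f p) := by
  have := regH_pos hM0
  rw [sigma₀]; positivity

lemma evenHess_of_le_three (hp : 2 ≤ p) (hp3 : p ≤ 3) (f : E → ℝ) (y h : E) :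
    evenHess f p y h = fderiv ℝ (fderiv ℝ f) y := by
  have : p / 2 = 1 := by omega
  simp [evenHess, this]

/-- In the case `p = 2`, the constant `1/2` of relative strong convexity improves to `5/6`. -/
lemma relStronglyConvex_of_eq_two (hf : ConvexOn ℝ Set.univ f)
    (hfs : ContDiff ℝ ((2 + 1 : ℕ) : WithTop ℕ∞) f) (hM : MFinite f (2 + 1))
    (hM0 : 0 < M f (2 + 1)) (y : E) :
    RelStronglyConvex (proxSmooth f 2 (regH f 2) y) (scaling f 2 (regH f 2) y) (5 / 6) := by
  refine ((hasSecondDeriv_proxSmooth le_rfl hfs _ y).sub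
    ((hasSecondDeriv_scaling le_rfl hfs _ y).const_mul (5 / 6))).convexOn fun x v => ?_
  have h0 := regH_pos hM0
  have h1 := (abs_le.1 (abs_apply_le (norm_taylor_hess_sub_le le_rfl hfs hM y (x - y)) v))
  rw [regH_eq] at h1
  have h2 := fderiv_fderiv_nonneg hf le_rfl hfs y v
  have h3 := mul_le_mul_of_nonneg_left (dHess_diag_ge le_rfl (x - y) v) h0.le
  simp [taylorPoly] at h1 h3
  simp [evenHess_of_le_three le_rfl (show 2 ≤ 3 by norm_num)]
  linarith [h1.1]

lemma relSmooth_relStronglyConvex (hf : ConvexOn ℝ Set.univ f) (hp : 2 ≤ p) (hp3 : p ≤ 3)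
    (hfs : ContDiff ℝ ((p + 1 : ℕ) : WithTop ℕ∞) f) (hM : MFinite f (p + 1))
    (hM0 : 0 < M f (p + 1)) (y : E) :
    RelSmooth (proxSmooth f p (regH f p) y) (scaling f p (regH f p) y) relL ∧
      RelStronglyConvex (proxSmooth f p (regH f p) y) (scaling f p (regH f p) y) relMu := by
  have h0 := regH_pos hM0
  -- Since L − 1 = 1 − μ = 1/2, the power term leaves exactly H/2 times its Hessian in both
  -- comparisons, and that Hessian is at least ‖h‖^{p-1}‖v‖².
  have key : ∀ h v : E,
      1 / 2 * fderiv ℝ (fderiv ℝ f) y v v - regH f p / 2 * (‖h‖ ^ (p - 1) * ‖v‖ ^ 2)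
        ≤ fderiv ℝ (fderiv ℝ f) (y + h) v v ∧
      fderiv ℝ (fderiv ℝ f) (y + h) v v
        ≤ 3 / 2 * fderiv ℝ (fderiv ℝ f) y v v + regH f p / 2 * (‖h‖ ^ (p - 1) * ‖v‖ ^ 2) := by
    intro h v
    have h2 := fderiv_fderiv_nonneg hf hp hfs y v
    have h1 := fun h : E => abs_le.1 (abs_apply_le (norm_taylor_hess_sub_le hp hfs hM y h) v)
    simp only [regH_eq] at h1
    have hnn : 0 ≤ regH f p * (‖h‖ ^ (p - 1) * ‖v‖ ^ 2) := by positivity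
    obtain rfl | rfl : p = 2 ∨ p = 3 := by omega
    · have h3 := h1 h
      simp [taylorPoly] at h3 hnn ⊢
      constructor <;> linarith
    · have h3 := h1 h
      -- For p = 3 the odd term D³f(y)[h, v, v] remains. Positivity of D²f at y ± 2h bounds it by
      -- ½D²f(y)[v, v] + (H/3)‖h‖²‖v‖²; adding the Taylor error H/6 gives H/2.
      have h4 := h1 ((2 : ℝ) • h)
      have h5 := h1 ((-2 : ℝ) • h)
      have h6 := fderiv_fderiv_nonneg hf hp hfs (y + (2 : ℝ) • h) v
      have h7 := fderiv_fderiv_nonneg hf hp hfs (y + (-2 : ℝ) • h) v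
      simp [taylorPoly, Finset.sum_range_succ, norm_smul, mul_pow] at h3 h4 h5 h6 h7 hnn ⊢
      constructor <;> linarith
  have hd := fun h v : E => mul_le_mul_of_nonneg_left (dHess_diag_ge hp h v) h0.le
  constructor
  · refine (((hasSecondDeriv_scaling hp hfs _ y).const_mul relL).sub
      (hasSecondDeriv_proxSmooth hp hfs _ y)).convexOn fun x v => ?_
    have := (key (x - y) v).2
    have := hd (x - y) v
    simp [evenHess_of_le_three hp hp3, relL] at *
    linarith
  · refine ((hasSecondDeriv_proxSmooth hp hfs _ y).sub
      ((hasSecondDeriv_scaling hp hfs _ y).const_mul relMu)).convexOn fun x v => ?_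
    have := (key (x - y) v).1
    have := hd (x - y) v
    simp [evenHess_of_le_three hp hp3, relMu] at *
    linarith

/-! ### Upper bounds for the Hessian and the Bregman distances of ρ -/

lemma M_nonneg (f : E → ℝ) (j : ℕ) : 0 ≤ M f j := Real.iSup_nonneg fun _ => norm_nonneg _

lemma norm_fderiv_fderiv_le (h : MFinite f 2) (x : E) : ‖fderiv ℝ (fderiv ℝ f) x‖ ≤ M f 2 := by
  have := le_ciSup h x
  rwa [← norm_iteratedFDeriv_fderiv, norm_iteratedFDeriv_one] at this

/-- The even part is within the Taylor error of an average of two Hessians of f, each of norm at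
most M₂; the M₄ term of `hessianBound` is slack. -/
lemma norm_scaling_hess_le (hp : 2 ≤ p) (hfs : ContDiff ℝ ((p + 1 : ℕ) : WithTop ℕ∞) f)
    (hM : MFinite f (p + 1)) (hM2 : MFinite f 2) (hH : 0 ≤ H) {y x : E} {Δ : ℝ}
    (hx : ‖x - y‖ ≤ Δ) :
    ‖iteratedFDeriv ℝ 2 (scaling f p H y) x‖ ≤ hessianBound f p H Δ := by
  have hΔ : 0 ≤ Δ := (norm_nonneg _).trans hx
  rw [(hasSecondDeriv_scaling hp hfs H y).iteratedFDeriv_two]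
  set h := x - y
  have h1 : ‖evenHess f p y h‖ ≤ M f 2 +
      M f (p + 1) / ((p - 1).factorial : ℝ) * ‖h‖ ^ (p - 1) := by
    exact norm_le_add_of_norm_sub_le (F := E →L[ℝ] E →L[ℝ] ℝ)
      (norm_half_smul_add_le (F := E →L[ℝ] E →L[ℝ] ℝ) (norm_fderiv_fderiv_le hM2 (y + h))
      (norm_fderiv_fderiv_le hM2 (y - h))) (norm_evenHess_sub_le hp hfs hM y h)
  have h3 : (M f (p + 1) / ((p - 1).factorial : ℝ) + p * H) * ‖h‖ ^ (p - 1)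
      ≤ (M f (p + 1) / ((p - 1).factorial : ℝ) + p * H) * Δ ^ (p - 1) := by
    have := M_nonneg f (p + 1)
    gcongr
  have h4 : 0 ≤ (if 3 ≤ p then M f 4 / 2 * Δ ^ 2 else 0) := by
    have := M_nonneg f 4
    split_ifs <;> positivity
  have h5 := norm_add_smul_le (F := E →L[ℝ] E →L[ℝ] ℝ) hH h1 (norm_dHess_le hp h)
  rw [hessianBound]
  linarith

lemma hasDerivAt_pow_line (n : ℕ) (R τ t : ℝ) :
    HasDerivAt (fun t : ℝ => (R + t * τ) ^ n) (n * (R + t * τ) ^ (n - 1) * τ) t := by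
  have h1 : HasDerivAt (fun t : ℝ => R + t * τ) τ t := by
    simpa using ((hasDerivAt_id t).mul_const τ).const_add R
  exact h1.fun_pow n

lemma hasDerivAt_pow_line' (n : ℕ) (R τ t : ℝ) :
    HasDerivAt (fun t : ℝ => n * (R + t * τ) ^ (n - 1) * τ)
      (n * (((n - 1 : ℕ) : ℝ) * (R + t * τ) ^ (n - 2) * τ) * τ) t :=
  ((hasDerivAt_pow_line (n - 1) R τ t).const_mul (n : ℝ)).mul_const τ

lemma powBregman_nonneg (n : ℕ) {R τ : ℝ} (hR : 0 ≤ R) (hτ : 0 ≤ τ) : 0 ≤ powBregman n R τ := by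
  have := add_deriv_le_of_second_deriv_nonneg (hasDerivAt_pow_line n R τ)
    (hasDerivAt_pow_line' n R τ) fun t ht => by
      have := ht.1
      positivity
  simp at this
  rw [powBregman]
  linarith

lemma convexOn_powBregman (n : ℕ) {R : ℝ} (hR : 0 ≤ R) :
    ConvexOn ℝ (Set.Ici 0) (powBregman n R) := by
  have h1 : ∀ t : ℝ, HasDerivAt (powBregman n R) (n * (R + t) ^ (n - 1) - n * R ^ (n - 1)) t := by
    intro t
    have := ((hasDerivAt_pow_line n R 1 t).sub_const (R ^ n)).sub
      ((hasDerivAt_id t).const_mul (n * R ^ (n - 1)))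
    simp only [mul_one] at this
    exact this
  have h2 : ∀ t : ℝ, HasDerivAt (fun t => n * (R + t) ^ (n - 1) - n * R ^ (n - 1))
      (n * (((n - 1 : ℕ) : ℝ) * (R + t) ^ (n - 2))) t := by
    intro t
    have := (hasDerivAt_pow_line' n R 1 t).sub_const (n * R ^ (n - 1))
    simp only [mul_one] at this
    exact this
  refine convexOn_of_hasDerivWithinAt2_nonneg (convex_Ici 0)
    (fun t _ => (h1 t).continuousAt.continuousWithinAt) (fun t _ => (h1 t).hasDerivWithinAt)
    (fun t _ => (h2 t).hasDerivWithinAt) fun t ht => ?_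
  have : 0 ≤ t := interior_subset ht
  positivity

lemma powBregman_zero (n : ℕ) (R : ℝ) : powBregman n R 0 = 0 := by simp [powBregman]

lemma convexOn_thetaBound {R : ℝ} (hR : 0 ≤ R) (hH : 0 ≤ H) :
    ConvexOn ℝ (Set.Ici 0) (thetaBound f p H R) := by
  have hsum : ∀ s : Finset ℕ, ConvexOn ℝ (Set.Ici (0 : ℝ)) fun τ => ∑ j ∈ s,
      M f (2 * j) / ((2 * j).factorial : ℝ) * powBregman (2 * j) R τ := by
    intro s
    induction s using Finset.induction_on with
    | empty => simpa using convexOn_const (0 : ℝ) (convex_Ici (0 : ℝ))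
    | insert a s ha ih =>
      simp only [Finset.sum_insert ha]
      exact ((convexOn_powBregman (2 * a) hR).smul
        (div_nonneg (M_nonneg f _) (by positivity))).add ih
  exact (hsum _).add ((convexOn_powBregman (p + 1) hR).smul (by positivity))

lemma thetaBound_nonneg {R τ : ℝ} (hR : 0 ≤ R) (hH : 0 ≤ H) (hτ : 0 ≤ τ) :
    0 ≤ thetaBound f p H R τ :=
  add_nonneg (Finset.sum_nonneg fun _ _ => mul_nonneg (div_nonneg (M_nonneg f _) (by positivity))
    (powBregman_nonneg _ hR hτ)) (mul_nonneg (by positivity) (powBregman_nonneg _ hR hτ))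

lemma norm_evenHess_le (hMj : ∀ j, 1 ≤ j → j ≤ p / 2 → MFinite f (2 * j)) (y h : E) :
    ‖evenHess f p y h‖ ≤ ∑ k ∈ Finset.range (p / 2),
      M f (2 * (k + 1)) / ((2 * k).factorial : ℝ) * ‖h‖ ^ (2 * k) := by
  refine (norm_sum_le (E := E →L[ℝ] E →L[ℝ] ℝ) _ _).trans (Finset.sum_le_sum fun k hk => ?_)
  have hk' := Finset.mem_range.1 hk
  have h1 : ‖iteratedFDeriv ℝ (2 * k) (fderiv ℝ (fderiv ℝ f)) y‖ ≤ M f (2 * (k + 1)) := by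
    rw [norm_iteratedFDeriv_fderiv, norm_iteratedFDeriv_fderiv]
    exact le_ciSup (hMj (k + 1) (by omega) (by omega)) y
  have h2 := (iteratedFDeriv ℝ (2 * k) (fderiv ℝ (fderiv ℝ f)) y).le_opNorm (fun _ => h)
  have h3 : ‖iteratedFDeriv ℝ (2 * k) (fderiv ℝ (fderiv ℝ f)) y (fun _ => h)‖
      ≤ M f (2 * (k + 1)) * ‖h‖ ^ (2 * k) := by
    refine h2.trans ?_
    simp only [Finset.prod_const, Finset.card_univ, Fintype.card_fin]
    gcongr
  have h4 := norm_smul_le_of_nonneg (F := E →L[ℝ] E →L[ℝ] ℝ) (t := ((2 * k).factorial : ℝ)⁻¹) (by positivity) h3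
  calc _ ≤ _ := h4
    _ = _ := by ring

/-- At x + t(z − x) the distance to y is at most R + tτ, so the second derivative of ρ along the
segment is dominated by that of the scalar function with powers (R + tτ)^n in place of the forms.
Its Bregman distance from t = 0 to t = 1 is `thetaBound`. -/
lemma normDominated_scaling (hp : 2 ≤ p) (hfs : ContDiff ℝ ((p + 1 : ℕ) : WithTop ℕ∞) f)
    (hMj : ∀ j, 1 ≤ j → j ≤ p / 2 → MFinite f (2 * j)) (hH : 0 ≤ H) {R : ℝ} (hR : 0 ≤ R) (y : E) :
    NormDominated (scaling f p H y) (Metric.closedBall y R) (thetaBound f p H R) := by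
  refine ⟨convexOn_thetaBound hR hH, by simp [thetaBound, powBregman_zero],
    fun τ hτ => thetaBound_nonneg hR hH hτ, fun x hx z => ?_⟩
  rw [Metric.mem_closedBall, dist_eq_norm] at hx
  set τ := ‖x - z‖ with hτ
  have hτ' : ‖z - x‖ = τ := norm_sub_rev _ _
  have hk1 : ∀ t : ℝ, HasDerivAt
      (fun t : ℝ => (∑ k ∈ Finset.range (p / 2), M f (2 * (k + 1)) /
        ((2 * (k + 1)).factorial : ℝ) * (R + t * τ) ^ (2 * (k + 1)))
        + H / ((p : ℝ) + 1) * (R + t * τ) ^ (p + 1)) _ t := fun t =>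
    (HasDerivAt.fun_sum fun k _ => (hasDerivAt_pow_line (2 * (k + 1)) R τ t).const_mul _).add
      ((hasDerivAt_pow_line (p + 1) R τ t).const_mul _)
  have hk2 := fun t : ℝ =>
    (HasDerivAt.fun_sum (u := Finset.range (p / 2)) fun k _ =>
      (hasDerivAt_pow_line' (2 * (k + 1)) R τ t).const_mul
        (M f (2 * (k + 1)) / ((2 * (k + 1)).factorial : ℝ))).add
      ((hasDerivAt_pow_line' (p + 1) R τ t).const_mul (H / ((p : ℝ) + 1)))
  have := (hasSecondDeriv_scaling hp hfs H y).bregman_le hk1 hk2 x z fun t ht => by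
    set h := x + t • (z - x) - y with hh
    have hn : ‖h‖ ≤ R + t * τ := by
      calc ‖h‖ = ‖(x - y) + t • (z - x)‖ := by rw [hh]; congr 1; abel
        _ ≤ ‖x - y‖ + ‖t • (z - x)‖ := norm_add_le _ _
        _ ≤ _ := by rw [norm_smul, Real.norm_of_nonneg ht.1, hτ']; gcongr
    have h1 := (abs_le.1 (abs_apply_le (norm_evenHess_le hMj y h) (z - x))).2
    have h2 := (abs_le.1 (abs_apply_le (norm_dHess_le hp h) (z - x))).2
    rw [hτ'] at h1 h2
    simp only [add_apply, smul_apply, smul_eq_mul]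
    refine add_le_add (h1.trans ?_) ((mul_le_mul_of_nonneg_left h2 hH).trans ?_)
    · rw [Finset.sum_mul]
      refine Finset.sum_le_sum fun k _ => ?_
      have hM0 := M_nonneg f (2 * (k + 1))
      have hf : ((2 * k).factorial : ℝ) ≠ 0 := by positivity
      calc M f (2 * (k + 1)) / ((2 * k).factorial : ℝ) * ‖h‖ ^ (2 * k) * τ ^ 2
          ≤ M f (2 * (k + 1)) / ((2 * k).factorial : ℝ) * (R + t * τ) ^ (2 * k) * τ ^ 2 := by
            gcongr
        _ = _ := by
          rw [show 2 * (k + 1) = 2 * k + 1 + 1 by ring, Nat.factorial_succ, Nat.factorial_succ]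
          push_cast
          field_simp
          try simp
    · have hp0 : (p : ℝ) + 1 ≠ 0 := by positivity
      calc H * (p * ‖h‖ ^ (p - 1) * τ ^ 2) ≤ H * (p * (R + t * τ) ^ (p - 1) * τ ^ 2) := by
            gcongr
        _ = _ := by
          rw [show p + 1 - 2 = p - 1 by omega]
          push_cast
          field_simp
          try simp
  refine this.trans (le_of_eq ?_)
  rw [thetaBound, sum_Icc_one_eq_sum_range]
  simp only [powBregman, mul_sub, Finset.sum_sub_distrib, one_mul, zero_mul, add_zero]
  ring

end Scaling

end BiOPT

namespace BiOPT

/-! ### The upper level -/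

section UpperLevel

universe u
variable {E : Type u} [NormedAddCommGroup E] [InnerProductSpace ℝ E]

/-- First-order optimality for the minimization of `s + ψ` over `Q`. -/
lemma sub_fderiv_le_of_isMinOn {Q : Set E} {ψ s : E → ℝ} (hψ : ConvexOn ℝ Q ψ) {z : E} (hz : z ∈ Q)
    (hmin : IsMinOn (fun w => s w + ψ w) Q z) {s' : E →L[ℝ] ℝ} (hs : HasFDerivAt s s' z) {w : E}
    (hw : w ∈ Q) : ψ z - s' (w - z) ≤ ψ w := by
  have hline : HasDerivAt (fun t : ℝ => z + t • (w - z)) (w - z) 0 := by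
    simpa using ((hasDerivAt_id (0 : ℝ)).smul_const (w - z)).const_add z
  have hder : HasDerivAt (fun t : ℝ => s (z + t • (w - z))) (s' (w - z)) 0 :=
    HasFDerivAt.comp_hasDerivAt (0 : ℝ) (by simpa using hs) hline
  -- ψ need not be differentiable: its convexity along the segment replaces its difference quotient
  -- by ψ w − ψ z, and only s is differentiated as t decreases to 0.
  have hev : ∀ᶠ t : ℝ in nhdsWithin 0 (Set.Ioi 0),
      ψ z - ψ w ≤ t⁻¹ • (s (z + (0 + t) • (w - z)) - s (z + (0 : ℝ) • (w - z))) := by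
    filter_upwards [Ioc_mem_nhdsGT (zero_lt_one (α := ℝ))] with t ht
    have hmem : z + t • (w - z) ∈ Q := by
      have := hψ.1 hz hw (sub_nonneg.2 ht.2) ht.1.le (by ring)
      convert this using 1
      module
    have h1 := hψ.2 hz hw (sub_nonneg.2 ht.2) ht.1.le (by ring)
    have h2 : s z + ψ z ≤ s (z + t • (w - z)) + ψ (z + t • (w - z)) := hmin hmem
    rw [show (1 - t) • z + t • w = z + t • (w - z) by module] at h1
    simp only [smul_eq_mul] at h1
    simp only [zero_add, zero_smul, add_zero, smul_eq_mul]
    rw [inv_mul_eq_div, le_div_iff₀ ht.1]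
    linarith
  have := ge_of_tendsto hder.tendsto_slope_zero_right hev
  linarith

variable {P : Problem E} {p : ℕ} {H β lam : ℝ}

/-- At z' the differentiable part of the step's objective has gradient −g, so this is first-order
optimality. -/
lemma Problem.InnerStep.isSubgradient (hp : 2 ≤ p)
    (hfs : ContDiff ℝ ((p + 1 : ℕ) : WithTop ℕ∞) P.f) (hψ : P.ClosedConvex) {y z z' : E}
    (h : P.InnerStep p H lam y z z') : P.IsSubgradient z' (P.innerSubgrad p H lam y z z') := by
  refine ⟨h.1, fun w hw => ?_⟩
  have hd := (hasSecondDeriv_scaling hp hfs H y).differentiable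
  have hs : HasFDerivAt (fun w => fderiv ℝ (proxSmooth P.f p H y) z (w - z)
      + lam * bregman (scaling P.f p H y) z w)
      (fderiv ℝ (proxSmooth P.f p H y) z
        + lam • (fderiv ℝ (scaling P.f p H y) z' - fderiv ℝ (scaling P.f p H y) z)) z' := by
    have hsub : ∀ A : E →L[ℝ] ℝ, HasFDerivAt (fun w => A (w - z)) A z' := fun A => by
      have := A.hasFDerivAt.comp z' ((hasFDerivAt_id z').sub_const z)
      rwa [ContinuousLinearMap.comp_id] at this
    exact (hsub _).add ((((hd z').hasFDerivAt.sub_const _).sub (hsub _)).const_mul lam)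
  have hmin : IsMinOn (fun w => (fderiv ℝ (proxSmooth P.f p H y) z (w - z)
      + lam * bregman (scaling P.f p H y) z w) + P.ψ w) P.Q z' := by
    refine isMinOn_iff.2 fun w hw => ?_
    have := isMinOn_iff.1 h.2 w hw
    linarith
  have := sub_fderiv_le_of_isMinOn hψ.1 h.1 hmin hs hw
  simp only [Problem.innerSubgrad, sub_apply, smul_apply, add_apply, smul_eq_mul] at this ⊢
  linarith

/-- Weighted inequality of the arithmetic and geometric means with integer exponents. -/
lemma add_mul_pow_mul_pow_le (m n : ℕ) (hmn : 0 < m + n) {a b : ℝ} (ha : 0 ≤ a) (hb : 0 ≤ b) :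
    ((m : ℝ) + n) * (a ^ m * b ^ n) ≤ m * a ^ (m + n) + n * b ^ (m + n) := by
  have hs : (0 : ℝ) < (m : ℝ) + n := by exact_mod_cast hmn
  have h := Real.geom_mean_le_arith_mean2_weighted (w₁ := m / ((m : ℝ) + n))
    (w₂ := n / ((m : ℝ) + n)) (p₁ := a ^ (m + n)) (p₂ := b ^ (m + n))
    (by positivity) (by positivity) (by positivity) (by positivity) (by field_simp)
  have key : ∀ (c : ℝ) (k : ℕ), 0 ≤ c → (c ^ (m + n)) ^ ((k : ℝ) / ((m : ℝ) + n)) = c ^ k := by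
    intro c k hc
    rw [← Real.rpow_natCast c (m + n), ← Real.rpow_mul hc, ← Real.rpow_natCast c k]
    congr 1
    push_cast
    field_simp
  rw [key a m ha, key b n hb] at h
  calc _ ≤ ((m : ℝ) + n) * (m / ((m : ℝ) + n) * a ^ (m + n) + n / ((m : ℝ) + n) * b ^ (m + n)) := by
        gcongr
    _ = _ := by field_simp

/-- Here h = T − y and g is the gradient of F at T; c and v are p-th roots, so that all exponents
stay natural. Expanding the square of the hypothesis bounds −⟨g, h⟩ below by a combination of ‖g‖²
and ‖h‖^{2p}, and AM-GM reduces it to the pure power of ‖g‖. -/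
lemma inner_ge_of_norm_add_le (hp : 2 ≤ p) (hH : 0 < H) (hβ : β ≤ 1 / (p : ℝ))
    {g h : E} (hgh : ‖g + (H * ‖h‖ ^ (p - 1)) • h‖ ≤ β * ‖g‖) {c v : ℝ} (hc : 0 < c) (hv : 0 ≤ v)
    (hcp : c ^ p = (1 - β) / H) (hvp : v ^ p = ‖g‖) :
    c * v ^ (p + 1) ≤ -inner ℝ g h := by
  have hp2 : (2 : ℝ) ≤ p := by exact_mod_cast hp
  have hβ1 : β < 1 := hβ.trans_lt (by rw [div_lt_one (by linarith)]; linarith)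
  set r := ‖h‖ with hr
  set u := ‖g‖ with hu
  have hr0 : 0 ≤ r := norm_nonneg _
  have hu0 : 0 ≤ u := norm_nonneg _
  have hpow : r ^ (p - 1) * r = r ^ p := by
    rw [← pow_succ]; congr 1; omega
  have hnorm : ‖(H * r ^ (p - 1)) • h‖ = H * r ^ p := by
    rw [norm_smul, Real.norm_of_nonneg (by positivity), ← hr, mul_assoc, hpow]
  have hrev : (1 - β) * u ≤ H * r ^ p := by
    have := norm_sub_norm_le g (-((H * r ^ (p - 1)) • h))
    rw [norm_neg, hnorm, sub_neg_eq_add] at this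
    linarith
  set ξ := c * v with hξ
  have hξ0 : 0 ≤ ξ := by positivity
  have hξp : H * ξ ^ p = (1 - β) * u := by
    rw [hξ, mul_pow, hcp, hvp]; field_simp
  have hξr : ξ ≤ r := by
    refine le_of_pow_le_pow_left₀ (show p ≠ 0 by omega) hr0 ?_
    exact le_of_mul_le_mul_left (hξp.trans_le hrev) hH
  have hsq : ‖g + (H * r ^ (p - 1)) • h‖ ^ 2
      = u ^ 2 + 2 * (H * r ^ (p - 1)) * inner ℝ g h + (H * r ^ p) ^ 2 := by
    rw [norm_add_sq_real, inner_smul_right, hnorm]; ring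
  have hsq' : ‖g + (H * r ^ (p - 1)) • h‖ ^ 2 ≤ (β * u) ^ 2 := by gcongr
  rw [hsq] at hsq'
  have hamgm := add_mul_pow_mul_pow_le (p - 1) (p + 1) (by omega) hr0 hξ0
  rw [show p - 1 + (p + 1) = p * 2 by omega, Nat.cast_sub (by omega)] at hamgm
  push_cast at hamgm
  have hmon : ξ ^ (p * 2) ≤ r ^ (p * 2) := by gcongr
  -- AM-GM gives the weights (p+1)/p and (p−1)/p. Moving weight 1/p − β ≥ 0 from ξ to r only
  -- increases the right side because ξ ≤ r.
  have hmix : 2 * (r ^ (p - 1) * ξ ^ (p + 1)) ≤ (1 + β) * ξ ^ (p * 2) + (1 - β) * r ^ (p * 2) := by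
    have hpβ : β * p ≤ 1 := by rwa [le_div_iff₀ (by linarith)] at hβ
    have := mul_nonneg (sub_nonneg.2 hpβ) (sub_nonneg.2 hmon)
    have hp0 : (0 : ℝ) < p := by linarith
    refine le_of_mul_le_mul_left ?_ hp0
    nlinarith
  have hξu : ξ ^ (p + 1) * H = (1 - β) * (c * v ^ (p + 1)) := by
    rw [pow_succ, mul_comm, ← mul_assoc, hξp, ← hvp, hξ]; ring
  have h2 : (H * ξ ^ p) ^ 2 = ((1 - β) * u) ^ 2 := by rw [hξp]
  have hfin : (1 - β) * (2 * (H * r ^ (p - 1)) * (c * v ^ (p + 1)))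
      ≤ (1 - β) * (2 * (H * r ^ (p - 1)) * (-inner ℝ g h)) := by
    have h3 : (1 - β) * (2 * (H * r ^ (p - 1)) * (c * v ^ (p + 1)))
        = H ^ 2 * (2 * (r ^ (p - 1) * ξ ^ (p + 1))) := by
      calc _ = 2 * H * r ^ (p - 1) * ((1 - β) * (c * v ^ (p + 1))) := by ring
        _ = _ := by rw [← hξu]; ring
    have h4 : H ^ 2 * ((1 + β) * ξ ^ (p * 2) + (1 - β) * r ^ (p * 2))
        = (1 + β) * (H * ξ ^ p) ^ 2 + (1 - β) * (H * r ^ p) ^ 2 := by ring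
    have h5 := mul_le_mul_of_nonneg_left hmix (sq_nonneg H)
    rw [h4, h2] at h5
    rw [h3]
    refine h5.trans ?_
    have := mul_le_mul_of_nonneg_left hsq' (sub_nonneg.2 hβ1.le)
    linarith
  have hfin' := le_of_mul_le_mul_left hfin (sub_pos.2 hβ1)
  -- The factor r^{p-1} can be cancelled only if r > 0; for r = 0 both sides of the claim vanish.
  rcases hr0.eq_or_lt with h0 | h0
  · have hξ0' : ξ = 0 := le_antisymm (h0 ▸ hξr) hξ0
    have hv0 : v = 0 := by
      rcases mul_eq_zero.1 hξ0' with h | h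
      · exact absurd h hc.ne'
      · exact h
    have hh : h = 0 := norm_eq_zero.1 h0.symm
    simp [hv0, hh]
  · exact le_of_mul_le_mul_left hfin' (by positivity)

/-- The Riesz isometry carries the stopping test from the dual to E, where the norm can be squared.
-/
lemma Problem.Acceptable.exists_bound [FiniteDimensional ℝ E] (hp : 2 ≤ p) (hH : 0 < H)
    (hβ : β ≤ 1 / (p : ℝ)) {y T : E} {g : E →L[ℝ] ℝ}
    (hd : DifferentiableAt ℝ P.f T) (hg : P.Acceptable p H β y T g) {c : ℝ} (hc : 0 < c)
    (hcp : c ^ p = (1 - β) / H) :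
    ∃ v : ℝ, 0 ≤ v ∧ v ^ p = ‖fderiv ℝ P.f T + g‖ ∧
      c * v ^ (p + 1) ≤ (fderiv ℝ P.f T + g) (y - T) := by
  have : CompleteSpace E := FiniteDimensional.complete ℝ E
  set G := fderiv ℝ P.f T + g with hG
  obtain ⟨γ, hγ⟩ := (InnerProductSpace.toDual ℝ E).surjective G
  have hγn : ‖γ‖ = ‖G‖ := by rw [← hγ, LinearIsometryEquiv.norm_map]
  have hγa : ∀ w, G w = inner ℝ γ w := fun w => by rw [← hγ]; simp
  refine ⟨‖G‖ ^ (1 / (p : ℝ)), by positivity, ?_, ?_⟩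
  · rw [one_div]; exact Real.rpow_inv_natCast_pow (norm_nonneg _) (by omega)
  · have h2 := hg.2
    rw [fderiv_proxSmooth hp hd, add_right_comm, ← hG] at h2
    have h3 : G + H • dGrad p (T - y)
        = InnerProductSpace.toDual ℝ E (γ + (H * ‖T - y‖ ^ (p - 1)) • (T - y)) := by
      ext w
      simp [hγa, dGrad]
      ring
    rw [h3, LinearIsometryEquiv.norm_map, ← hγn] at h2
    have := inner_ge_of_norm_add_le hp hH hβ h2 (v := ‖G‖ ^ (1 / (p : ℝ))) hc (by positivity)
      hcp (by rw [one_div, hγn]; exact Real.rpow_inv_natCast_pow (norm_nonneg _) (by omega))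
    rw [hγa, ← neg_sub T y, inner_neg_right]
    exact this

/-- The constant `c_p = ((1-β)/H)^{1/p}`. -/
noncomputable def cRoot (p : ℕ) (H β : ℝ) : ℝ := ((1 - β) / H) ^ (1 / (p : ℝ))

/-! ### The coefficients A_k and the estimating functions -/

lemma beta_lt_one (hp : 2 ≤ p) (hβ : β ≤ 1 / (p : ℝ)) : β < 1 := by
  have hp2 : (2 : ℝ) ≤ p := by exact_mod_cast hp
  exact hβ.trans_lt (by rw [div_lt_one (by linarith)]; linarith)

lemma cRoot_pos (hp : 2 ≤ p) (hH : 0 < H) (hβ : β ≤ 1 / (p : ℝ)) : 0 < cRoot p H β :=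
  Real.rpow_pos_of_pos (div_pos (sub_pos.2 (beta_lt_one hp hβ)) hH) _

lemma cRoot_pow (hp : 2 ≤ p) (hH : 0 < H) (hβ : β ≤ 1 / (p : ℝ)) :
    cRoot p H β ^ p = (1 - β) / H := by
  rw [cRoot, one_div]
  exact Real.rpow_inv_natCast_pow (div_pos (sub_pos.2 (beta_lt_one hp hβ)) hH).le (by omega)

lemma coefA_eq (p : ℕ) (H β : ℝ) (k : ℕ) :
    coefA p H β k = (cRoot p H β / 2) ^ p * ((k : ℝ) / ((p : ℝ) + 1)) ^ (p + 1) := rfl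

lemma coefA_zero (p : ℕ) (H β : ℝ) : coefA p H β 0 = 0 := by simp [coefA_eq]

lemma coefA_pos (hp : 2 ≤ p) (hH : 0 < H) (hβ : β ≤ 1 / (p : ℝ)) {k : ℕ} (hk : 0 < k) :
    0 < coefA p H β k := by
  have := cRoot_pos hp hH hβ
  have : (0 : ℝ) < k := by exact_mod_cast hk
  rw [coefA_eq]; positivity

lemma coefA_nonneg (hp : 2 ≤ p) (hH : 0 < H) (hβ : β ≤ 1 / (p : ℝ)) (k : ℕ) :
    0 ≤ coefA p H β k := by
  have := cRoot_pos hp hH hβ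
  rw [coefA_eq]; positivity

lemma coefA_step_nonneg (hp : 2 ≤ p) (hH : 0 < H) (hβ : β ≤ 1 / (p : ℝ)) (k : ℕ) :
    0 ≤ coefA p H β (k + 1) - coefA p H β k := by
  have := cRoot_pos hp hH hβ
  rw [coefA_eq, coefA_eq, sub_nonneg]
  gcongr
  simp

lemma coefA_step_le (hp : 2 ≤ p) (hH : 0 < H) (hβ : β ≤ 1 / (p : ℝ)) (k : ℕ) :
    coefA p H β (k + 1) - coefA p H β k
      ≤ (cRoot p H β / 2) ^ p * (((k + 1 : ℕ) : ℝ) / ((p : ℝ) + 1)) ^ p := by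
  have hc := cRoot_pos hp hH hβ
  -- For a = k + 1 and b = k this is Bernoulli's inequality (k+1)^{p+1} − k^{p+1} ≤ (p+1)(k+1)^p.
  have h := add_mul_pow_mul_pow_le p 1 (by omega) (a := (k : ℝ) + 1) (b := k) (by positivity)
    (by positivity)
  rw [coefA_eq, coefA_eq, ← mul_sub]
  gcongr
  push_cast at h ⊢
  have hp1 : (0 : ℝ) < (p : ℝ) + 1 := by positivity
  rw [div_pow, div_pow, div_pow, ← sub_div, div_le_div_iff₀ (by positivity) (by positivity)]
  have h2 : ((k : ℝ) + 1) ^ (p + 1) - (k : ℝ) ^ (p + 1) ≤ ((p : ℝ) + 1) * ((k : ℝ) + 1) ^ p := by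
    have : ((k : ℝ) + 1) ^ (p + 1) = ((k : ℝ) + 1) ^ p * ((k : ℝ) + 1) := pow_succ _ _
    nlinarith
  calc _ ≤ (((p : ℝ) + 1) * ((k : ℝ) + 1) ^ p) * ((p : ℝ) + 1) ^ p := by gcongr
    _ = _ := by ring

lemma estSeq_eq (P : Problem E) (p : ℕ) (H β : ℝ) (x₀ : E) (T : ℕ → E) (k : ℕ) :
    ∃ (l : E →L[ℝ] ℝ) (c : ℝ), ∀ x, P.estSeq p H β x₀ T k x
      = (d p (x - x₀) + l x + c) + coefA p H β k * P.ψ x := by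
  induction k with
  | zero => exact ⟨0, 0, fun x => by simp [Problem.estSeq, coefA_zero]⟩
  | succ k ih =>
    obtain ⟨l, c, h⟩ := ih
    refine ⟨l + (coefA p H β (k + 1) - coefA p H β k) • fderiv ℝ P.f (T k),
      c + (coefA p H β (k + 1) - coefA p H β k) * (P.f (T k) - fderiv ℝ P.f (T k) (T k)),
      fun x => ?_⟩
    simp only [Problem.estSeq, h, map_sub, add_apply, smul_apply, smul_eq_mul]
    ring

/-- Beyond d_{p+1} the function Ψ_k contains only affine terms and A_k ψ; optimality of υ controls
these, and the uniform convexity of d_{p+1} is left over. -/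
lemma estSeq_ge (hp : 2 ≤ p) (hH : 0 < H) (hβ : β ≤ 1 / (p : ℝ)) (hψ : P.ClosedConvex)
    {x₀ υ : E} {T : ℕ → E} {k : ℕ} (hυ : υ ∈ P.Q)
    (hmin : IsMinOn (P.estSeq p H β x₀ T k) P.Q υ) {x : E} (hx : x ∈ P.Q) :
    P.estSeq p H β x₀ T k υ + ((2 : ℝ) ^ (p - 1))⁻¹ / ((p : ℝ) + 1) * ‖x - υ‖ ^ (p + 1)
      ≤ P.estSeq p H β x₀ T k x := by
  obtain ⟨l, c, h⟩ := estSeq_eq P p H β x₀ T k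
  have hA := coefA_nonneg hp hH hβ k
  have hd := ((hasSecondDeriv_d (E := E) hp).comp_sub_const x₀).first υ
  have hs : HasFDerivAt (fun w => d p (w - x₀) + l w + c) (dGrad p (υ - x₀) + l) υ :=
    (hd.add l.hasFDerivAt).add_const c
  have hmin' : IsMinOn (fun w => (d p (w - x₀) + l w + c) + coefA p H β k • P.ψ w) P.Q υ := by
    refine isMinOn_iff.2 fun w hw => ?_
    have := isMinOn_iff.1 hmin w hw
    rwa [h, h] at this
  have h1 := sub_fderiv_le_of_isMinOn (hψ.1.smul hA) hυ hmin' hs hx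
  have h2 := uniformlyConvex_d (E := E) hp (υ - x₀) (x - x₀)
  simp only [bregman, (hasSecondDeriv_d (E := E) hp).fderiv_eq] at h2
  rw [show x - x₀ - (υ - x₀) = x - υ by abel] at h2
  rw [h, h]
  simp only [add_apply, smul_eq_mul, map_sub] at h1 h2 ⊢
  linarith

/-- Each linearization of f lies below f, and the increments A_{k+1} − A_k sum to A_k because A_0 =
0. -/
lemma estSeq_le (hp : 2 ≤ p) (hH : 0 < H) (hβ : β ≤ 1 / (p : ℝ))
    (hf : ConvexOn ℝ Set.univ P.f) (hd : Differentiable ℝ P.f) (x₀ : E) (T : ℕ → E) (k : ℕ)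
    (x : E) : P.estSeq p H β x₀ T k x ≤ d p (x - x₀) + coefA p H β k * P.F x := by
  induction k with
  | zero => simp [Problem.estSeq, coefA_zero]
  | succ k ih =>
    have h1 := bregman_nonneg_of_convexOn hf (hd (T k)) x
    have h2 := mul_le_mul_of_nonneg_left (show P.f (T k) + fderiv ℝ P.f (T k) (x - T k) + P.ψ x
      ≤ P.F x by simp only [bregman, Problem.F] at h1 ⊢; linarith) (coefA_step_nonneg hp hH hβ k)
    rw [Problem.estSeq]
    linarith

/-- One step of the estimating sequence. -/
lemma estSeq_step [FiniteDimensional ℝ E] (hp : 2 ≤ p) (hH : 0 < H)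
    (hβ : β ≤ 1 / (p : ℝ)) (hf : ConvexOn ℝ Set.univ P.f) (hd : Differentiable ℝ P.f)
    (hψ : P.ClosedConvex) {x₀ xk υ y : E} {T : ℕ → E} {k : ℕ} (hxk : xk ∈ P.Q) (hυ : υ ∈ P.Q)
    (hmin : IsMinOn (P.estSeq p H β x₀ T k) P.Q υ)
    (hy : y = (coefA p H β k / coefA p H β (k + 1)) • xk +
      ((coefA p H β (k + 1) - coefA p H β k) / coefA p H β (k + 1)) • υ)
    {g : E →L[ℝ] ℝ} (hg : P.Acceptable p H β y (T k) g)
    (ih : coefA p H β k * P.F xk ≤ P.estSeq p H β x₀ T k υ) {x : E} (hx : x ∈ P.Q) :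
    coefA p H β (k + 1) * P.F (T k) ≤ P.estSeq p H β x₀ T (k + 1) x := by
  have hc := cRoot_pos hp hH hβ
  obtain ⟨v, hv0, hvp, hv⟩ := hg.exists_bound hp hH hβ (hd _) hc (cRoot_pow hp hH hβ)
  have hge := estSeq_ge hp hH hβ hψ hυ hmin hx
  have hA1 : 0 < coefA p H β (k + 1) := coefA_pos hp hH hβ (Nat.succ_pos k)
  have ha0 := coefA_step_nonneg hp hH hβ k
  have ha1 := coefA_step_le hp hH hβ k
  have hA0 := coefA_nonneg hp hH hβ k
  have hAeq := coefA_eq p H β (k + 1)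
  set A := coefA p H β k
  set A' := coefA p H β (k + 1)
  set G := fderiv ℝ P.f (T k) + g with hG
  set c := cRoot p H β
  set m : ℝ := ((k + 1 : ℕ) : ℝ) / ((p : ℝ) + 1) with hm
  have hm0 : 0 ≤ m := by positivity
  -- the subgradient inequality for `F` at `T k`
  have hsub : ∀ w ∈ P.Q, P.F (T k) + G (w - T k)
      ≤ P.f (T k) + fderiv ℝ P.f (T k) (w - T k) + P.ψ w := by
    intro w hw
    have := hg.1.2 w hw
    simp only [Problem.F, hG, add_apply]
    linarith
  have hFx : P.F (T k) + G (xk - T k) ≤ P.F xk := by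
    have h1 := hsub xk hxk
    have h2 := bregman_nonneg_of_convexOn hf (hd (T k)) xk
    simp only [bregman] at h2
    simp only [Problem.F] at h1 ⊢
    linarith
  -- The choice of y as the combination of x_k and υ is made for this: the linear terms merge into
  -- G(y − T), where the stopping test gives a gain, at the price of G(x − υ).
  have hcomb : A * G (xk - T k) + (A' - A) * G (x - T k)
      = A' * G (y - T k) + (A' - A) * G (x - υ) := by
    have : A' • y = A • xk + (A' - A) • υ := by
      rw [hy, smul_add, smul_smul, smul_smul, mul_div_cancel₀ _ hA1.ne', mul_div_cancel₀ _ hA1.ne']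
    have hGy := congrArg G this
    simp only [map_add, map_smul, smul_eq_mul] at hGy
    simp only [map_sub]
    linear_combination -hGy
  -- With W and Y as below the three terms are at most 2W^p Y, equal to 2W^{p+1}, and equal to
  -- 4Y^{p+1}/(p+1). AM-GM for W^p Y then suffices.
  have hyoung : (A' - A) * (v ^ p * ‖x - υ‖) ≤ A' * (c * v ^ (p + 1))
      + ((2 : ℝ) ^ (p - 1))⁻¹ / ((p : ℝ) + 1) * ‖x - υ‖ ^ (p + 1) := by
    set Y := ‖x - υ‖ / 2 with hY
    set W := c * m * v / 2 with hW
    have hY0 : 0 ≤ Y := by positivity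
    have hW0 : 0 ≤ W := by positivity
    have h1 := add_mul_pow_mul_pow_le p 1 (by omega) hW0 hY0
    have h2 : (A' - A) * (v ^ p * ‖x - υ‖) ≤ 2 * (W ^ p * Y) := by
      calc _ ≤ ((c / 2) ^ p * m ^ p) * (v ^ p * ‖x - υ‖) := by gcongr
        _ = _ := by rw [hW, hY]; ring
    have h3 : A' * (c * v ^ (p + 1)) = 2 * W ^ (p + 1) := by
      rw [hAeq, hW]; ring
    have h4 : ((2 : ℝ) ^ (p - 1))⁻¹ / ((p : ℝ) + 1) * ‖x - υ‖ ^ (p + 1)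
        = 4 / ((p : ℝ) + 1) * Y ^ (p + 1) := by
      have h5 : (2 : ℝ) ^ (p + 1) = 4 * 2 ^ (p - 1) := by
        rw [show p + 1 = p - 1 + 2 by omega, pow_add]; norm_num; ring
      rw [hY, div_pow, h5]
      field_simp
    rw [h3, h4]
    refine h2.trans ?_
    have hp1 : (0 : ℝ) < (p : ℝ) + 1 := by positivity
    have h6 : W ^ p * Y ≤ (p * W ^ (p + 1) + Y ^ (p + 1)) / ((p : ℝ) + 1) := by
      rw [le_div_iff₀ hp1]
      simp only [pow_one, Nat.cast_one, one_mul] at h1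
      linarith
    have h7 : p * W ^ (p + 1) / ((p : ℝ) + 1) ≤ W ^ (p + 1) := by
      rw [div_le_iff₀ hp1]
      nlinarith [pow_nonneg hW0 (p + 1)]
    have h8 : 0 ≤ Y ^ (p + 1) / ((p : ℝ) + 1) := by positivity
    rw [add_div] at h6
    rw [div_mul_eq_mul_div, mul_div_assoc]
    linarith
  have hGn : -(v ^ p * ‖x - υ‖) ≤ G (x - υ) := by
    rw [hvp]
    exact (abs_le.1 (G.le_opNorm (x - υ))).1
  have h1 := mul_le_mul_of_nonneg_left hFx hA0
  have h2 := mul_le_mul_of_nonneg_left (hsub x hx) ha0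
  have h3 := mul_le_mul_of_nonneg_left hGn ha0
  have h4 := mul_le_mul_of_nonneg_left hv hA1.le
  rw [Problem.estSeq]
  linarith

/-! ### Bounds along an execution -/

lemma Problem.IsRun.mono {x₀ : E} {K k : ℕ} {t : Trace E} (h : P.IsRun p H β lam x₀ K t)
    (hk : k ≤ K) : P.IsRun p H β lam x₀ k t where
  start := h.start
  argmin := fun j hj => h.argmin j (hj.trans hk)
  combine := fun j hj => h.combine j (hj.trans hk)
  inner := fun j hj => h.inner j (hj.trans_le hk)
  running := fun j hj => h.running j (hj.trans_le hk)
  stopped := fun j hj => h.stopped j (hj.trans_le hk)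
  next := fun j hj => h.next j (hj.trans_le hk)

lemma Problem.IsRun.x_mem {x₀ : E} (hx₀ : x₀ ∈ P.Q) {K : ℕ} {t : Trace E}
    (h : P.IsRun p H β lam x₀ K t) {k : ℕ} (hk : k ≤ K) : t.x k ∈ P.Q := by
  cases k with
  | zero => rw [h.start]; exact hx₀
  | succ k => exact (h.next k (by omega)).1

lemma Problem.IsRun.acceptable (hp : 2 ≤ p)
    (hfs : ContDiff ℝ ((p + 1 : ℕ) : WithTop ℕ∞) P.f) (hψ : P.ClosedConvex)
    {x₀ : E} {K : ℕ} {t : Trace E} (h : P.IsRun p H β lam x₀ K t) {k : ℕ} (hk : k < K) :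
    P.Acceptable p H β (t.y k) (t.T k)
      (P.innerSubgrad p H lam (t.y k) (t.z k (t.m k)) (t.T k)) :=
  ⟨((h.inner k hk).2 _ (h.running k hk)).isSubgradient hp hfs hψ, h.stopped k hk⟩

/-- The invariant of the method. It starts from A_0 = 0, and `estSeq_step` is applied at the next
minimizer υ_{K+1}. -/
lemma Problem.IsRun.coefA_mul_le [FiniteDimensional ℝ E] (hp : 2 ≤ p) (hH : 0 < H)
    (hβ : β ≤ 1 / (p : ℝ)) (hf : ConvexOn ℝ Set.univ P.f)
    (hfs : ContDiff ℝ ((p + 1 : ℕ) : WithTop ℕ∞) P.f) (hψ : P.ClosedConvex)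
    {x₀ : E} (hx₀ : x₀ ∈ P.Q) {K : ℕ} {t : Trace E} (h : P.IsRun p H β lam x₀ K t) :
    coefA p H β K * P.F (t.x K) ≤ P.estSeq p H β x₀ t.T K (t.υ K) := by
  have hd : Differentiable ℝ P.f := hfs.differentiable (by simp)
  induction K with
  | zero =>
    simp [coefA_zero, Problem.estSeq, d]
    positivity
  | succ K ih =>
    have h' := h.mono (Nat.le_succ K)
    have hstep := estSeq_step hp hH hβ hf hd hψ (h.x_mem hx₀ (Nat.le_succ K))
      (h.argmin K (Nat.le_succ K)).1 (h.argmin K (Nat.le_succ K)).2 (h.combine K (Nat.le_succ K))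
      (h.acceptable hp hfs hψ (Nat.lt_succ_self K)) (ih h') (h.argmin (K + 1) le_rfl).1
    exact (mul_le_mul_of_nonneg_left (h.next K (Nat.lt_succ_self K)).2
      (coefA_nonneg hp hH hβ _)).trans hstep

/-- The estimates on function values and prox-centres provided by the estimating sequence. -/
lemma Problem.IsRun.main_bound [FiniteDimensional ℝ E] (hp : 2 ≤ p) (hH : 0 < H)
    (hβ : β ≤ 1 / (p : ℝ)) (hf : ConvexOn ℝ Set.univ P.f)
    (hfs : ContDiff ℝ ((p + 1 : ℕ) : WithTop ℕ∞) P.f) (hψ : P.ClosedConvex)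
    {x₀ xs : E} (hx₀ : x₀ ∈ P.Q) (hxs : xs ∈ P.Q) {K : ℕ} {t : Trace E}
    (h : P.IsRun p H β lam x₀ K t) :
    coefA p H β K * (P.F (t.x K) - P.F xs)
      + ((2 : ℝ) ^ (p - 1))⁻¹ / ((p : ℝ) + 1) * ‖xs - t.υ K‖ ^ (p + 1)
      ≤ ‖x₀ - xs‖ ^ (p + 1) / ((p : ℝ) + 1) := by
  have h1 := h.coefA_mul_le hp hH hβ hf hfs hψ hx₀
  have h2 := estSeq_ge hp hH hβ hψ (h.argmin K le_rfl).1 (h.argmin K le_rfl).2 hxs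
  have h3 := estSeq_le hp hH hβ hf (hfs.differentiable (by simp)) x₀ t.T K xs
  rw [d, norm_sub_rev xs x₀] at h3
  linarith

lemma Problem.IsRun.norm_υ_sub_le [FiniteDimensional ℝ E] (hp : 2 ≤ p) (hH : 0 < H)
    (hβ : β ≤ 1 / (p : ℝ)) (hf : ConvexOn ℝ Set.univ P.f)
    (hfs : ContDiff ℝ ((p + 1 : ℕ) : WithTop ℕ∞) P.f) (hψ : P.ClosedConvex)
    {x₀ xs : E} (hx₀ : x₀ ∈ P.Q) (hxs : xs ∈ P.Q) (hmin : IsMinOn P.F P.Q xs) {K : ℕ}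
    {t : Trace E} (h : P.IsRun p H β lam x₀ K t) :
    ‖t.υ K - xs‖ ≤ (2 : ℝ) ^ (((p : ℝ) - 1) / ((p : ℝ) + 1)) * ‖x₀ - xs‖ := by
  have h1 := h.main_bound hp hH hβ hf hfs hψ hx₀ hxs
  have h2 : 0 ≤ coefA p H β K * (P.F (t.x K) - P.F xs) :=
    mul_nonneg (coefA_nonneg hp hH hβ K) (sub_nonneg.2 (hmin (h.x_mem hx₀ le_rfl)))
  have hp1 : (0 : ℝ) < (p : ℝ) + 1 := by positivity
  refine le_of_pow_le_pow_left₀ (show p + 1 ≠ 0 by omega) (by positivity) ?_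
  have h3 : ((2 : ℝ) ^ (((p : ℝ) - 1) / ((p : ℝ) + 1))) ^ (p + 1) = 2 ^ (p - 1) := by
    rw [← Real.rpow_natCast, ← Real.rpow_mul (by norm_num), ← Real.rpow_natCast]
    congr 1
    rw [Nat.cast_sub (by omega)]
    push_cast
    field_simp
  rw [mul_pow, h3, norm_sub_rev]
  have h4 : ((2 : ℝ) ^ (p - 1))⁻¹ / ((p : ℝ) + 1) * ‖xs - t.υ K‖ ^ (p + 1)
      ≤ ‖x₀ - xs‖ ^ (p + 1) / ((p : ℝ) + 1) := by linarith
  rw [div_mul_eq_mul_div, div_le_div_iff_of_pos_right hp1, inv_mul_eq_div,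
    div_le_iff₀ (by positivity)] at h4
  linarith

/-- The complexity bound for the upper level. -/
lemma Problem.IsRun.sub_le_of_outerBound_le [FiniteDimensional ℝ E] (hp : 2 ≤ p)
    (hβ : β ≤ 1 / (p : ℝ)) (hf : ConvexOn ℝ Set.univ P.f)
    (hfs : ContDiff ℝ ((p + 1 : ℕ) : WithTop ℕ∞) P.f) (hM0 : 0 < M P.f (p + 1))
    (hψ : P.ClosedConvex) {x₀ xs : E} (hx₀ : x₀ ∈ P.Q) (hxs : xs ∈ P.Q) {ε : ℝ} (hε : 0 < ε)
    {K : ℕ} {t : Trace E} (h : P.IsRun p (regH P.f p) β lam x₀ K t)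
    (hK : outerBound P.f p ε ‖x₀ - xs‖ ≤ K) : P.F (t.x K) - P.F xs ≤ ε := by
  have hH : 0 < regH P.f p := regH_pos hM0
  have hp2 : (2 : ℝ) ≤ p := by exact_mod_cast hp
  have hp1 : (0 : ℝ) < (p : ℝ) - 1 := by linarith
  set B := 3 * p * M P.f (p + 1) /
    (((p : ℝ) - 1) * ((p : ℝ) + 1) * ((p - 1).factorial : ℝ) * ε) with hB
  have hB0 : 0 < B := by positivity
  set R := ‖x₀ - xs‖ with hR
  have hR0 : 0 ≤ R := norm_nonneg _
  -- A_0 = 0 carries no information, but K = 0 can reach the bound only if R = 0, that is, x₀ = x*.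
  rcases Nat.eq_zero_or_pos K with rfl | hK0
  · have : R = 0 := by
      by_contra hne
      have hRp : 0 < R := lt_of_le_of_ne hR0 (Ne.symm hne)
      have : 0 < outerBound P.f p ε R := by
        rw [outerBound, ← hB]; positivity
      simp at hK
      linarith
    rw [h.start, sub_eq_zero.1 (norm_eq_zero.1 this)]
    simpa using hε.le
  · have h1 := h.main_bound hp hH hβ hf hfs hψ hx₀ hxs
    have hA := coefA_pos hp hH hβ hK0
    refine le_of_mul_le_mul_left ?_ hA
    have h0 : 0 ≤ ((2 : ℝ) ^ (p - 1))⁻¹ / ((p : ℝ) + 1) * ‖xs - t.υ K‖ ^ (p + 1) := by positivity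
    have h2 : B * R ^ (p + 1) ≤ (K / (2 * (p : ℝ) + 2)) ^ (p + 1) := by
      have h3 : B ^ (1 / ((p : ℝ) + 1)) * R ≤ K / (2 * (p : ℝ) + 2) := by
        rw [le_div_iff₀ (by positivity)]
        rw [outerBound, ← hB] at hK
        linarith
      have h4 : (B ^ (1 / ((p : ℝ) + 1))) ^ (p + 1) = B := by
        have := Real.rpow_inv_natCast_pow hB0.le (n := p + 1) (by omega)
        rw [one_div]; push_cast at this; exact this
      calc B * R ^ (p + 1) = (B ^ (1 / ((p : ℝ) + 1)) * R) ^ (p + 1) := by rw [mul_pow, h4]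
        _ ≤ _ := by gcongr
    have h5 : coefA p (regH P.f p) β K
        = 2 * ((1 - β) / regH P.f p) * (K / (2 * (p : ℝ) + 2)) ^ (p + 1) := by
      rw [coefA_eq, div_pow, cRoot_pow hp hH hβ,
        show (K : ℝ) / (2 * (p : ℝ) + 2) = K / ((p : ℝ) + 1) / 2 by field_simp, div_pow _ (2 : ℝ)]
      ring
    have hβp : ((p : ℝ) - 1) / p ≤ 1 - β := by
      rw [sub_div, div_self (by linarith)]; linarith
    -- B is chosen to make this an identity, with 1 − β replaced by its least value (p − 1)/p.
    have h6 : R ^ (p + 1) / ((p : ℝ) + 1)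
        = 2 * (((p : ℝ) - 1) / p / regH P.f p) * (B * R ^ (p + 1)) * ε := by
      rw [hB, regH]
      have := hM0.ne'
      field_simp
      ring
    have h7 : 2 * (((p : ℝ) - 1) / p / regH P.f p) * (B * R ^ (p + 1)) * ε
        ≤ coefA p (regH P.f p) β K * ε := by
      rw [h5]
      have : 0 ≤ 1 - β := by linarith [beta_lt_one hp hβ]
      gcongr
    linarith

end UpperLevel

end BiOPT

namespace BiOPT

/-! ### Transfer of executions between functions with the same oracle answers -/

section Oracle

universe u
variable {E : Type u} [NormedAddCommGroup E] [InnerProductSpace ℝ E]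
  {P : Problem E} {p : ℕ} {H β lam : ℝ} {f' : E → ℝ}

lemma eq_of_iteratedFDeriv_zero_eq {f g : E → ℝ} {w : E}
    (h : iteratedFDeriv ℝ 0 f w = iteratedFDeriv ℝ 0 g w) : f w = g w := by
  have := congrArg (fun A => A (fun _ => 0)) h
  simpa using this

lemma fderiv_eq_of_iteratedFDeriv_one_eq {f g : E → ℝ} {w : E}
    (h : iteratedFDeriv ℝ 1 f w = iteratedFDeriv ℝ 1 g w) : fderiv ℝ f w = fderiv ℝ g w := by
  ext v
  have := congrArg (fun A => A (fun _ => v)) h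
  simpa using this

lemma scaling_eq_of_iteratedFDeriv_eq {f g : E → ℝ} {y : E}
    (h : ∀ j ≤ 2 * (p / 2), iteratedFDeriv ℝ j f y = iteratedFDeriv ℝ j g y) :
    scaling f p H y = scaling g p H y := by
  ext x
  simp only [scaling]
  congr 1
  refine Finset.sum_congr rfl fun j hj => ?_
  rw [h (2 * j) (by have := (Finset.mem_Icc.1 hj).2; omega)]

lemma estSeq_eq_of_agree {x₀ : E} {T : ℕ → E} {k : ℕ}
    (h : ∀ j < k, f' (T j) = P.f (T j) ∧ fderiv ℝ f' (T j) = fderiv ℝ P.f (T j)) :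
    Problem.estSeq { P with f := f' } p H β x₀ T k = P.estSeq p H β x₀ T k := by
  induction k with
  | zero => rfl
  | succ k ih =>
    ext x
    simp only [Problem.estSeq, ih fun j hj => h j (by omega), h k (by omega)]

lemma innerSubgrad_eq_of_agree {y z z' : E}
    (hs : scaling f' p H y = scaling P.f p H y)
    (hz : fderiv ℝ (proxSmooth f' p H y) z = fderiv ℝ (proxSmooth P.f p H y) z) :
    Problem.innerSubgrad { P with f := f' } p H lam y z z' = P.innerSubgrad p H lam y z z' := by
  simp only [Problem.innerSubgrad, hs, hz]

/-- The conditions of a run see f only through values and gradients at queried points and through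
ρ_{y_k}, which is built from even derivatives at y_k of order at most 2q. -/
theorem Problem.IsRun.transfer (hp : 2 ≤ p) (hd : Differentiable ℝ P.f)
    (hd' : Differentiable ℝ f') {x₀ : E} {K : ℕ} {t : Trace E}
    (h : P.IsRun p H β lam x₀ K t)
    (hq : ∀ w ∈ t.queried K, ∀ j ≤ 2 * (p / 2),
      iteratedFDeriv ℝ j f' w = iteratedFDeriv ℝ j P.f w) :
    Problem.IsRun { P with f := f' } p H β lam x₀ K t := by
  have hval : ∀ w ∈ t.queried K, f' w = P.f w := fun w hw =>
    eq_of_iteratedFDeriv_zero_eq (hq w hw 0 (by omega))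
  have hder : ∀ w ∈ t.queried K, fderiv ℝ f' w = fderiv ℝ P.f w := fun w hw =>
    fderiv_eq_of_iteratedFDeriv_one_eq (hq w hw 1 (by omega))
  have hprox : ∀ w ∈ t.queried K, ∀ y,
      fderiv ℝ (proxSmooth f' p H y) w = fderiv ℝ (proxSmooth P.f p H y) w := fun w hw y => by
    rw [fderiv_proxSmooth hp (hd w), fderiv_proxSmooth hp (hd' w), hder w hw]
  have hx : ∀ k ≤ K, t.x k ∈ t.queried K := fun k hk => Or.inl ⟨k, hk, rfl⟩
  have hy : ∀ k < K, t.y k ∈ t.queried K := fun k hk => Or.inr (Or.inl ⟨k, hk, rfl⟩)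
  have hz : ∀ k < K, ∀ i ≤ t.m k + 1, t.z k i ∈ t.queried K := fun k hk i hi =>
    Or.inr (Or.inr ⟨k, hk, i, hi, rfl⟩)
  have hscal : ∀ k < K, scaling f' p H (t.y k) = scaling P.f p H (t.y k) := fun k hk =>
    scaling_eq_of_iteratedFDeriv_eq (hq _ (hy k hk))
  have hdone : ∀ k < K, ∀ i ≤ t.m k,
      Problem.Stops { P with f := f' } p H β lam (t.y k) (t.z k i) (t.z k (i + 1))
        ↔ P.Stops p H β lam (t.y k) (t.z k i) (t.z k (i + 1)) := fun k hk i hi => by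
    have h1 := hz k hk i (by omega)
    have h2 := hz k hk (i + 1) (by omega)
    simp only [Problem.Stops, innerSubgrad_eq_of_agree (hscal k hk) (hprox _ h1 _), hprox _ h2,
      hder _ h2]
  refine ⟨h.start, fun k hk => ⟨(h.argmin k hk).1, ?_⟩, h.combine, fun k hk =>
    ⟨(h.inner k hk).1, fun i hi => ?_⟩, fun k hk i hi => ?_, fun k hk => ?_, fun k hk =>
    ⟨(h.next k hk).1, ?_⟩⟩
  · rw [estSeq_eq_of_agree fun j hj => ?_]
    · exact (h.argmin k hk).2
    · have := hz j (by omega) (t.m j + 1) le_rfl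
      exact ⟨hval _ this, hder _ this⟩
  -- Agreement of the two functions is known only up to the stopping iteration; activity for f'
  -- excludes later indices.
  · have him : i ≤ t.m k := by
      by_contra hlt
      exact hi (t.m k) (by omega) ((hdone k hk _ le_rfl).2 (h.stopped k hk))
    have hstep := (h.inner k hk).2 i fun j hj hs =>
      hi j hj ((hdone k hk j (by omega)).2 hs)
    refine ⟨hstep.1, ?_⟩
    have := hstep.2
    simp only [hscal k hk, hprox _ (hz k hk i (by omega))]
    exact this
  · exact fun hs => h.running k hk i hi ((hdone k hk i hi.le).1 hs)
  · exact (hdone k hk _ le_rfl).2 (h.stopped k hk)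
  · have h1 := hval _ (hx (k + 1) hk)
    have h2 := hval (t.T k) (hz k hk (t.m k + 1) le_rfl)
    have := (h.next k hk).2
    simp only [Problem.F, h1, h2] at this ⊢
    exact this

end Oracle

end BiOPT

namespace BiOPT

/-! ### The lower level -/

section LowerLevel

universe u
variable {E : Type u} [NormedAddCommGroup E] [InnerProductSpace ℝ E]

lemma bregman_self (ρ : E → ℝ) (x : E) : bregman ρ x x = 0 := by simp [bregman]

/-- Standing assumptions on the proximal problem centred at `y`. -/
structure ProxSetup (P : Problem E) (p : ℕ) (lam : ℝ) (y : E) : Prop where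
  two_le : 2 ≤ p
  convex : ConvexOn ℝ Set.univ P.f
  smooth : ContDiff ℝ ((p + 1 : ℕ) : WithTop ℕ∞) P.f
  finite : MFinite P.f (p + 1)
  pos : 0 < M P.f (p + 1)
  closedConvex : P.ClosedConvex
  mem : y ∈ P.Q
  lam_eq : lam = relL ∨ lam = 2 * relL
  relSmooth : RelSmooth (proxSmooth P.f p (regH P.f p) y) (scaling P.f p (regH P.f p) y) relL
  relStronglyConvex :
    RelStronglyConvex (proxSmooth P.f p (regH P.f p) y) (scaling P.f p (regH P.f p) y) relMu

namespace ProxSetup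

variable {P : Problem E} {p : ℕ} {lam : ℝ} {y : E}

lemma regH_pos (S : ProxSetup P p lam y) : 0 < regH P.f p := BiOPT.regH_pos S.pos

lemma relL_le (S : ProxSetup P p lam y) : relL ≤ lam := by
  rcases S.lam_eq with h | h <;> rw [h] <;> norm_num [relL]

lemma lam_le_three (S : ProxSetup P p lam y) : lam ≤ 3 := by
  rcases S.lam_eq with h | h <;> rw [h] <;> norm_num [relL]

lemma scalingDeriv (S : ProxSetup P p lam y) :
    HasSecondDeriv (scaling P.f p (regH P.f p) y) (fderiv ℝ (scaling P.f p (regH P.f p) y))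
      (fun x => evenHess P.f p y (x - y) + regH P.f p • dHess p (x - y)) :=
  hasSecondDeriv_scaling S.two_le S.smooth _ y

lemma proxDeriv (S : ProxSetup P p lam y) :
    HasSecondDeriv (proxSmooth P.f p (regH P.f p) y)
      (fderiv ℝ (proxSmooth P.f p (regH P.f p) y))
      (fun x => fderiv ℝ (fderiv ℝ P.f) x + regH P.f p • dHess p (x - y)) :=
  hasSecondDeriv_proxSmooth S.two_le S.smooth _ y

lemma differentiable (S : ProxSetup P p lam y) : Differentiable ℝ P.f :=
  S.smooth.differentiable (by simp)

lemma scaling_diag_nonneg (S : ProxSetup P p lam y) (x v : E) :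
    0 ≤ (evenHess P.f p y (x - y) + regH P.f p • dHess p (x - y)) v v := by
  have h1 := scaling_hess_ge S.convex S.two_le S.smooth S.finite S.pos y x v
  have h2 : 0 ≤ dHess p (x - y) v v :=
    le_trans (by positivity) (dHess_diag_ge S.two_le (x - y) v)
  have := S.regH_pos
  exact le_trans (by positivity) h1

lemma bregman_nonneg (S : ProxSetup P p lam y) (x z : E) :
    0 ≤ bregman (scaling P.f p (regH P.f p) y) x z :=
  bregman_nonneg_of_convexOn (S.scalingDeriv.convexOn S.scaling_diag_nonneg)
    (S.scalingDeriv.differentiable x) z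

/-- Progress of one inner step, with any admissible constant of relative strong convexity. -/
lemma step_le (S : ProxSetup P p lam y) {μ : ℝ}
    (hμ : RelStronglyConvex (proxSmooth P.f p (regH P.f p) y) (scaling P.f p (regH P.f p) y) μ)
    {z z' : E} (h : P.InnerStep p (regH P.f p) lam y z z') {w : E} (hw : w ∈ P.Q) :
    P.phi p (regH P.f p) y z' + lam * bregman (scaling P.f p (regH P.f p) y) z' w
      ≤ P.phi p (regH P.f p) y w
        + (lam - μ) * bregman (scaling P.f p (regH P.f p) y) z w := by
  have hL := S.relSmooth
  have hρd := S.scalingDeriv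
  have hfd := S.proxDeriv
  have hsub := (h.isSubgradient S.two_le S.smooth S.closedConvex).2 w hw
  have hpos := mul_nonneg (sub_nonneg.2 S.relL_le) (S.bregman_nonneg z z')
  simp only [Problem.innerSubgrad] at hsub
  simp only [Problem.phi]
  set ρ := scaling P.f p (regH P.f p) y
  set fy := proxSmooth P.f p (regH P.f p) y
  -- Relative smoothness bounds f_y(z') above and relative strong convexity bounds f_y(w) below,
  -- both from z. With the subgradient inequality and the slack (λ − L)β_ρ(z, z') ≥ 0, the
  -- three-point identity of ρ gives the claim.
  have h1 := bregman_nonneg_of_convexOn hL (((hρd.const_mul relL).sub hfd).differentiable z) z'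
  have h2 := bregman_nonneg_of_convexOn hμ ((hfd.sub (hρd.const_mul μ)).differentiable z) w
  simp only [bregman, ((hρd.const_mul relL).sub hfd).fderiv_eq,
    (hfd.sub (hρd.const_mul μ)).fderiv_eq, map_sub, sub_apply, smul_apply, smul_eq_mul]
    at h1 h2 hsub hpos ⊢
  linarith

variable {z : ℕ → E} {n : ℕ}

lemma iterate_mem (S : ProxSetup P p lam y) (h0 : z 0 = y)
    (hs : ∀ j < n, P.InnerStep p (regH P.f p) lam y (z j) (z (j + 1))) : z n ∈ P.Q := by
  cases n with
  | zero => rw [h0]; exact S.mem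
  | succ n => exact (hs n (Nat.lt_succ_self n)).1

lemma phi_step_le (S : ProxSetup P p lam y) {z z' : E} (hz : z ∈ P.Q)
    (h : P.InnerStep p (regH P.f p) lam y z z') :
    P.phi p (regH P.f p) y z' ≤ P.phi p (regH P.f p) y z := by
  have h1 := S.step_le S.relStronglyConvex h hz
  rw [bregman_self, mul_zero, add_zero] at h1
  have h2 : 0 ≤ lam := le_trans (by norm_num [relL]) S.relL_le
  have := mul_nonneg h2 (S.bregman_nonneg z' z)
  linarith

lemma phi_iterate_le (S : ProxSetup P p lam y) (h0 : z 0 = y)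
    (hs : ∀ j < n, P.InnerStep p (regH P.f p) lam y (z j) (z (j + 1))) {m : ℕ} (hm : m ≤ n) :
    P.phi p (regH P.f p) y (z n) ≤ P.phi p (regH P.f p) y (z m) := by
  induction n with
  | zero => rw [Nat.le_zero.1 hm]
  | succ n ih =>
    rcases hm.eq_or_lt with rfl | hm
    · exact le_rfl
    · exact (S.phi_step_le (S.iterate_mem h0 fun j hj => hs j (by omega)) (hs n (by omega))).trans
        (ih (fun j hj => hs j (by omega)) (by omega))

lemma phi_self (P : Problem E) (p : ℕ) (H : ℝ) (y : E) : P.phi p H y y = P.F y := by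
  simp [Problem.phi, proxSmooth, d, Problem.F]

lemma phi_eq (P : Problem E) (p : ℕ) (H : ℝ) (y w : E) :
    P.phi p H y w = P.F w + H * (‖w - y‖ ^ (p + 1) / ((p : ℝ) + 1)) := by
  simp only [Problem.phi, proxSmooth, d, Problem.F]; ring

/-- The Bregman distance of `ρ` splits into those of its even Taylor part and of the power. -/
lemma evenPartDeriv (S : ProxSetup P p lam y) :
    HasSecondDeriv (fun x => scaling P.f p (regH P.f p) y x - regH P.f p * d p (x - y))
      (fun x => fderiv ℝ (scaling P.f p (regH P.f p) y) x - regH P.f p • dGrad p (x - y))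
      (fun x => evenHess P.f p y (x - y)) := by
  have h := S.scalingDeriv.sub
    (((hasSecondDeriv_d (E := E) S.two_le).const_mul (regH P.f p)).comp_sub_const y)
  refine ⟨h.first, fun x => (h.second x).congr_fderiv ?_⟩
  ext v w; simp

lemma bregman_scaling_eq (S : ProxSetup P p lam y) (x w : E) :
    bregman (scaling P.f p (regH P.f p) y) x w
      = bregman (fun x => scaling P.f p (regH P.f p) y x - regH P.f p * d p (x - y)) x w
        + regH P.f p * bregman (d p) (x - y) (w - y) := by
  simp only [bregman, S.evenPartDeriv.fderiv_eq, (hasSecondDeriv_d (E := E) S.two_le).fderiv_eq,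
    map_sub, sub_apply, smul_apply, smul_eq_mul]
  ring

lemma bregman_d_zero (hp : 2 ≤ p) (h : E) :
    bregman (d p) h 0 = p / ((p : ℝ) + 1) * ‖h‖ ^ (p + 1) := by
  obtain ⟨q, rfl⟩ := Nat.exists_eq_add_of_le' (show 1 ≤ p by omega)
  simp only [bregman, (hasSecondDeriv_d (E := E) hp).fderiv_eq]
  have : ((q + 1 : ℕ) : ℝ) + 1 ≠ 0 := by positivity
  simp [d, dGrad]
  field_simp
  ring

/-- An upper bound for the modulus of uniform convexity of `ρ`, as a multiple of `H`. -/
noncomputable def modulusFactor (p : ℕ) : ℝ := if p = 2 then 16 / 27 else 1 / 3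

lemma one_le_modulusFactor_mul (hp : 2 ≤ p) : 1 ≤ modulusFactor p * 2 ^ (p - 1) := by
  rw [modulusFactor]
  split_ifs with h
  · subst h; norm_num
  · have : (2 : ℝ) ^ 2 ≤ 2 ^ (p - 1) := pow_le_pow_right₀ (by norm_num) (by omega)
    linarith

/-- All inner iterates stay near the centre `y`. -/
lemma radius_bound (S : ProxSetup P p lam y) {xs : E} (hmin : IsMinOn P.F P.Q xs)
    (h0 : z 0 = y) (hs : ∀ j < n, P.InnerStep p (regH P.f p) lam y (z j) (z (j + 1))) :
    3 * (modulusFactor p * regH P.f p) * ‖z n - y‖ ^ (p + 1)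
      ≤ ((p : ℝ) + 1) * (P.F y - P.F xs) := by
  have hH := S.regH_pos
  have hp1 : (0 : ℝ) < (p : ℝ) + 1 := by positivity
  have hF : ∀ m ≤ n, P.F xs ≤ P.F (z m) := fun m hm =>
    isMinOn_iff.1 hmin _ (S.iterate_mem h0 fun j hj => hs j (by omega))
  -- For p ≥ 3, φ(z_n) ≤ φ(y) already gives the factor 1/3. For p = 2 the larger 16/27 is needed,
  -- and the Bregman distances to y must be exploited too.
  by_cases h2 : p = 2
  · subst h2
    set H := regH P.f 2 with hHdef
    set δ := P.F y - P.F xs with hδ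
    have hμ := relStronglyConvex_of_eq_two S.convex S.smooth S.finite S.pos y
    -- The even part has the constant Hessian D²f(y) ≥ 0, so the power alone contributes p/(p+1) =
    -- 2/3.
    have hlow : ∀ w, 2 / 3 * (H * ‖w - y‖ ^ 3) ≤ bregman (scaling P.f 2 H y) w y := by
      intro w
      rw [S.bregman_scaling_eq, sub_self, bregman_d_zero le_rfl]
      have := bregman_nonneg_of_convexOn (S.evenPartDeriv.convexOn fun x v => by
        rw [evenHess_of_le_three le_rfl (by norm_num)]
        exact fderiv_fderiv_nonneg S.convex le_rfl S.smooth y v)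
        (S.evenPartDeriv.differentiable w) y
      norm_num at this ⊢
      linarith
    have hstep : ∀ m < n, P.F (z (m + 1)) + H * (‖z (m + 1) - y‖ ^ 3 / 3)
        + lam * bregman (scaling P.f 2 H y) (z (m + 1)) y
        ≤ P.F y + (lam - 5 / 6) * bregman (scaling P.f 2 H y) (z m) y := by
      intro m hm
      have := S.step_le hμ (hs m hm) S.mem
      rw [phi_self, phi_eq] at this
      norm_num at this ⊢
      exact this
    have hl1 := S.relL_le
    have hl2 := S.lam_le_three
    rw [relL] at hl1
    -- 6δ/5 is the fixed point of b ↦ (δ + (λ − 5/6)b)/λ, the recursion left by `hstep` when F(z) ≥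
    -- F*.
    have hb : ∀ m ≤ n, bregman (scaling P.f 2 H y) (z m) y ≤ 6 / 5 * δ := by
      intro m hm
      induction m with
      | zero =>
        rw [h0, bregman_self]
        have : 0 ≤ δ := sub_nonneg.2 (isMinOn_iff.1 hmin _ S.mem)
        positivity
      | succ m ih =>
        have h3 := hstep m (by omega)
        have h4 := mul_le_mul_of_nonneg_left (ih (by omega)) (show 0 ≤ lam - 5 / 6 by linarith)
        have h5 := hF (m + 1) hm
        have h6 : 0 ≤ H * (‖z (m + 1) - y‖ ^ 3 / 3) := by positivity
        refine le_of_mul_le_mul_left ?_ (show 0 < lam by linarith)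
        linarith
    rw [modulusFactor, if_pos rfl]
    norm_num
    cases n with
    | zero =>
      rw [h0, sub_self, norm_zero]
      have : 0 ≤ δ := sub_nonneg.2 (isMinOn_iff.1 hmin _ S.mem)
      norm_num
      exact this
    | succ m =>
      have h3 := hstep m (by omega)
      have h4 := mul_le_mul_of_nonneg_left (hb m (by omega)) (show 0 ≤ lam - 5 / 6 by linarith)
      have h5 := hF (m + 1) le_rfl
      have h6 := mul_le_mul_of_nonneg_left (hlow (z (m + 1))) (show 0 ≤ lam by linarith)
      set X := H * ‖z (m + 1) - y‖ ^ 3 with hX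
      have hX0 : 0 ≤ X := by positivity
      have hδ0 : 0 ≤ δ := sub_nonneg.2 (isMinOn_iff.1 hmin _ S.mem)
      have h7 : (1 + 2 * lam) * X ≤ 18 / 5 * lam * δ := by
        have : H * (‖z (m + 1) - y‖ ^ 3 / 3) = X / 3 := by rw [hX]; ring
        rw [this] at h3
        linarith
      have h8 : X ≤ 27 / 16 * δ := by
        refine le_of_mul_le_mul_left (h7.trans ?_) (show 0 < 1 + 2 * lam by linarith)
        nlinarith
      have : 16 / 9 * H * ‖z (m + 1) - y‖ ^ 3 = 16 / 9 * X := by rw [hX]; ring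
      linarith
  · have h1 := S.phi_iterate_le h0 hs (Nat.zero_le n)
    rw [h0, phi_self, phi_eq] at h1
    have h3 := hF n le_rfl
    rw [modulusFactor, if_neg h2]
    have h4 : regH P.f p * (‖z n - y‖ ^ (p + 1) / ((p : ℝ) + 1)) ≤ P.F y - P.F xs := by linarith
    rw [← mul_div_assoc, div_le_iff₀ hp1] at h4
    linarith

/-! ### Upper bound for the modulus of ρ, and localization of the iterates -/

lemma exists_norm_eq_one (hM0 : 0 < M P.f (p + 1)) : ∃ e : E, ‖e‖ = 1 := by
  by_contra hne
  have hsub : Subsingleton E := by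
    by_contra hns
    rw [not_subsingleton_iff_nontrivial] at hns
    exact hne (exists_norm_eq E zero_le_one)
  have : ∀ x, ‖iteratedFDeriv ℝ (p + 1) P.f x‖ = 0 := fun x => by
    rw [norm_eq_zero]
    ext v
    rw [show v = 0 from Subsingleton.elim _ _]
    exact (iteratedFDeriv ℝ (p + 1) P.f x).map_zero
  simp [M, this] at hM0

/-- An equality at p = 3, so the factor 1/3 in `modulusFactor` is what this comparison allows there.
-/
lemma three_mul_le_three_pow {p : ℕ} (hp : 3 ≤ p) :
    3 * ((2 : ℝ) ^ (p + 1) + (3 * p + 2)) ≤ 3 ^ (p + 1) := by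
  induction p, hp using Nat.le_induction with
  | base => norm_num
  | succ p hp ih =>
    have h3 : (3 : ℝ) ≤ p := by exact_mod_cast hp
    have h2 : (0 : ℝ) < 2 ^ (p + 1) := by positivity
    rw [pow_succ 3, pow_succ 2 (p + 1)]
    push_cast
    nlinarith

/-- Uniform convexity is tested on points y − (T/2)e and y + Te on opposite sides of y as T → ∞. The
even Taylor part contributes only O(T^p), so σ cannot exceed the corresponding ratio for H d_{p+1}:
16/27 of H if p = 2, at most 1/3 if p ≥ 3. -/
lemma modulus_le (S : ProxSetup P p lam y) {σ : ℝ}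
    (hσ : UniformlyConvex (scaling P.f p (regH P.f p) y) p σ) :
    σ ≤ modulusFactor p * regH P.f p := by
  obtain ⟨e, he⟩ := exists_norm_eq_one S.pos
  have hH := S.regH_pos
  have hp := S.two_le
  set H := regH P.f p
  have hp1 : (0 : ℝ) < (p : ℝ) + 1 := by positivity
  -- growth of the even Taylor part
  obtain ⟨C, hC0, hC⟩ : ∃ C : ℝ, 0 ≤ C ∧ ∀ T : ℝ, 1 ≤ T → ∀ h : E, ‖h‖ ≤ T →
      ‖evenHess P.f p y h‖ ≤ C * T ^ (p - 2) := by
    refine ⟨∑ k ∈ Finset.range (p / 2), ((2 * k).factorial : ℝ)⁻¹ *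
      ‖iteratedFDeriv ℝ (2 * k) (fderiv ℝ (fderiv ℝ P.f)) y‖,
      Finset.sum_nonneg fun k _ => by positivity, fun T hT h hh => ?_⟩
    rw [Finset.sum_mul]
    refine (norm_sum_le (E := E →L[ℝ] E →L[ℝ] ℝ) _ _).trans (Finset.sum_le_sum fun k hk => ?_)
    have hk' := Finset.mem_range.1 hk
    have h2 := (iteratedFDeriv ℝ (2 * k) (fderiv ℝ (fderiv ℝ P.f)) y).le_opNorm (fun _ => h)
    have h3 : ‖iteratedFDeriv ℝ (2 * k) (fderiv ℝ (fderiv ℝ P.f)) y (fun _ => h)‖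
        ≤ ‖iteratedFDeriv ℝ (2 * k) (fderiv ℝ (fderiv ℝ P.f)) y‖ * T ^ (p - 2) := by
      refine h2.trans ?_
      simp only [Finset.prod_const, Finset.card_univ, Fintype.card_fin]
      have : ‖h‖ ^ (2 * k) ≤ T ^ (p - 2) :=
        (pow_le_pow_left₀ (norm_nonneg h) hh _).trans (pow_le_pow_right₀ hT (by omega))
      gcongr
    have h4 := norm_smul_le_of_nonneg (F := E →L[ℝ] E →L[ℝ] ℝ) (t := ((2 * k).factorial : ℝ)⁻¹)
      (by positivity) h3
    calc _ ≤ _ := h4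
      _ = _ := by ring
  have hgrow : ∀ T : ℝ, 1 ≤ T → (σ * (3 / 2) ^ (p + 1)
      - H * (1 + (3 * p + 2) / 2 ^ (p + 1))) / ((p : ℝ) + 1) * T ≤ 9 / 8 * C := by
    intro T hT
    have hT0 : 0 < T := by linarith
    have huc := hσ (y - (T / 2) • e) (y + T • e)
    have hdiff : y + T • e - (y - (T / 2) • e) = (3 / 2 * T) • e := by module
    have hxy : y - (T / 2) • e - y = (-(T / 2)) • e := by module
    rw [S.bregman_scaling_eq, hdiff, norm_smul, he, mul_one, Real.norm_of_nonneg (by positivity),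
      hxy, add_sub_cancel_left] at huc
    have heven : bregman (fun x => scaling P.f p H y x - H * d p (x - y))
        (y - (T / 2) • e) (y + T • e) ≤ 9 / 8 * C * T ^ p := by
      have hk1 : ∀ t : ℝ, HasDerivAt (fun t : ℝ => 9 / 8 * C * T ^ p * t ^ 2)
          (9 / 4 * C * T ^ p * t) t := fun t => by
        refine ((hasDerivAt_pow 2 t).const_mul _).congr_deriv ?_
        norm_num; ring
      have hk2 : ∀ t : ℝ, HasDerivAt (fun t : ℝ => 9 / 4 * C * T ^ p * t)
          (9 / 4 * C * T ^ p) t := fun t => by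
        simpa using (hasDerivAt_id t).const_mul (9 / 4 * C * T ^ p)
      have := S.evenPartDeriv.bregman_le hk1 hk2 (y - (T / 2) • e) (y + T • e) fun t ht => by
        rw [hdiff]
        have hn : ‖y - (T / 2) • e + t • (3 / 2 * T) • e - y‖ ≤ T := by
          rw [show y - (T / 2) • e + t • (3 / 2 * T) • e - y
            = (T * (3 / 2 * t - 1 / 2)) • e by module, norm_smul, he, mul_one, Real.norm_eq_abs,
            abs_mul, abs_of_pos hT0]
          have : |3 / 2 * t - 1 / 2| ≤ 1 := abs_le.2 ⟨by linarith [ht.1], by linarith [ht.2]⟩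
          calc _ ≤ T * 1 := by gcongr
            _ = T := mul_one T
        have h1 := (abs_le.1 (abs_apply_le (hC T hT _ hn) ((3 / 2 * T) • e))).2
        refine h1.trans (le_of_eq ?_)
        rw [norm_smul, he, Real.norm_of_nonneg (by positivity)]
        obtain ⟨q, rfl⟩ := Nat.exists_eq_add_of_le' hp
        rw [show q + 2 - 2 = q by omega]
        ring
      norm_num at this
      exact this
    have hpow : bregman (d p) ((-(T / 2)) • e) (T • e)
        = T ^ (p + 1) * (1 + (3 * p + 2) / 2 ^ (p + 1)) / ((p : ℝ) + 1) := by
      simp only [bregman, (hasSecondDeriv_d (E := E) hp).fderiv_eq]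
      rw [← sub_smul]
      simp only [d, dGrad, norm_smul, he, mul_one, norm_neg, smul_apply, map_smul,
        innerForm_apply, real_inner_self_eq_norm_sq, smul_eq_mul, one_pow,
        Real.norm_of_nonneg (show 0 ≤ T / 2 by positivity), Real.norm_of_nonneg hT0.le]
      obtain ⟨q, rfl⟩ := Nat.exists_eq_add_of_le' (show 1 ≤ p by omega)
      rw [show q + 1 - 1 = q by omega]
      push_cast at hp1 ⊢
      simp only [div_pow, pow_succ]
      field_simp
      ring
    rw [hpow] at huc
    refine le_of_mul_le_mul_right ?_ (show 0 < T ^ p by positivity)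
    have h9 : (3 / 2 * T) ^ (p + 1) = (3 / 2) ^ (p + 1) * T ^ (p + 1) := mul_pow _ _ _
    rw [h9] at huc
    have : (σ * (3 / 2) ^ (p + 1) - H * (1 + (3 * p + 2) / 2 ^ (p + 1))) / ((p : ℝ) + 1) * T * T ^ p
        = σ / ((p : ℝ) + 1) * ((3 / 2) ^ (p + 1) * T ^ (p + 1))
          - H * (T ^ (p + 1) * (1 + (3 * p + 2) / 2 ^ (p + 1)) / ((p : ℝ) + 1)) := by
      rw [pow_succ T]; ring
    rw [this]
    linarith
  have hle : σ * (3 / 2) ^ (p + 1) ≤ H * (1 + (3 * p + 2) / 2 ^ (p + 1)) := by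
    by_contra hlt
    rw [not_le, ← sub_pos] at hlt
    set δ := (σ * (3 / 2) ^ (p + 1) - H * (1 + (3 * p + 2) / 2 ^ (p + 1))) / ((p : ℝ) + 1) with hδ
    have hδ0 : 0 < δ := div_pos hlt hp1
    have := hgrow (9 / 8 * C / δ + 1) (by
      have : 0 ≤ 9 / 8 * C / δ := by positivity
      linarith)
    rw [mul_add, mul_div_cancel₀ _ hδ0.ne'] at this
    linarith
  rw [modulusFactor]
  split_ifs with h2
  · subst h2
    norm_num at hle
    linarith
  · have h3 := three_mul_le_three_pow (p := p) (by omega)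
    have h2p : (0 : ℝ) < 2 ^ (p + 1) := by positivity
    have h3p : (0 : ℝ) < 3 ^ (p + 1) := by positivity
    rw [div_pow, ← mul_div_assoc, div_le_iff₀ h2p] at hle
    have h4 : H * (1 + (3 * p + 2) / 2 ^ (p + 1)) * 2 ^ (p + 1)
        = H * (2 ^ (p + 1) + (3 * p + 2)) := by field_simp
    rw [h4] at hle
    refine le_of_mul_le_mul_right ?_ h3p
    have := mul_le_mul_of_nonneg_left h3 hH.le
    linarith

lemma le_rpow_of_pow_le {r B : ℝ} (hr : 0 ≤ r) (h : r ^ (p + 1) ≤ B) :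
    r ≤ B ^ (1 / ((p : ℝ) + 1)) := by
  have hB : 0 ≤ B := le_trans (by positivity) h
  refine le_of_pow_le_pow_left₀ (show p + 1 ≠ 0 by omega) (by positivity) (h.trans (le_of_eq ?_))
  have := Real.rpow_inv_natCast_pow hB (n := p + 1) (by omega)
  rw [one_div]
  push_cast at this
  exact this.symm

/-- As 2σL = 3σ, the bound of σ by `modulus_le` turns `radius_bound` into the definition of Δ. -/
lemma norm_iterate_sub_le_radius (S : ProxSetup P p lam y) {xs : E} (hmin : IsMinOn P.F P.Q xs)
    (h0 : z 0 = y) (hs : ∀ j < n, P.InnerStep p (regH P.f p) lam y (z j) (z (j + 1)))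
    {σ : ℝ} (hσ0 : 0 < σ) (hσ : UniformlyConvex (scaling P.f p (regH P.f p) y) p σ) :
    ‖z n - y‖ ≤ P.radius p xs σ y := by
  refine le_rpow_of_pow_le (norm_nonneg _) ?_
  have h1 := S.radius_bound hmin h0 hs
  have h2 := mul_le_mul_of_nonneg_right (S.modulus_le hσ)
    (show 0 ≤ ‖z n - y‖ ^ (p + 1) by positivity)
  rw [relL, div_mul_eq_mul_div, le_div_iff₀ (by positivity)]
  linarith

lemma norm_iterate_sub_le_D₁ (S : ProxSetup P p lam y) {xs x₀ : E} (hmin : IsMinOn P.F P.Q xs)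
    (hy : P.F y ≤ max (P.F x₀) (P.FS xs x₀))
    (h0 : z 0 = y) (hs : ∀ j < n, P.InnerStep p (regH P.f p) lam y (z j) (z (j + 1))) :
    ‖z n - y‖ ≤ P.D₁ p (regH P.f p) xs x₀ := by
  refine le_rpow_of_pow_le (norm_nonneg _) ?_
  have hH := S.regH_pos
  have h1 := S.radius_bound hmin h0 hs
  have h2 := one_le_modulusFactor_mul S.two_le
  rw [div_mul_eq_mul_div, le_div_iff₀ (by positivity)]
  have h3 : 0 ≤ 3 * regH P.f p * ‖z n - y‖ ^ (p + 1) := by positivity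
  have h4 := mul_le_mul_of_nonneg_right h2 h3
  have h5 := mul_le_mul_of_nonneg_left h1 (show (0 : ℝ) ≤ 2 ^ (p - 1) by positivity)
  have h6 : ((p : ℝ) + 1) * 2 ^ (p - 1) * (P.F y - P.F xs)
      ≤ ((p : ℝ) + 1) * 2 ^ (p - 1) * (max (P.F x₀) (P.FS xs x₀) - P.F xs) := by gcongr
  linarith

/-- Convexity allows the mean value inequality between consecutive iterates. -/
lemma convex_levelSet (S : ProxSetup P p lam y) (Δ : ℝ) :
    Convex ℝ (P.levelSet p (regH P.f p) y Δ) := by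
  have hfy : ConvexOn ℝ Set.univ (proxSmooth P.f p (regH P.f p) y) :=
    S.proxDeriv.convexOn fun x v => by
      have h1 := fderiv_fderiv_nonneg S.convex S.two_le S.smooth x v
      have h2 : 0 ≤ dHess p (x - y) v v :=
        le_trans (by positivity) (dHess_diag_ge S.two_le (x - y) v)
      have := S.regH_pos
      simp only [add_apply, smul_apply, smul_eq_mul]
      positivity
  have hφ : ConvexOn ℝ P.Q (P.phi p (regH P.f p) y) :=
    (hfy.subset (Set.subset_univ _) S.closedConvex.1.1).add S.closedConvex.1
  have h1 := hφ.convex_le (P.phi p (regH P.f p) y y)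
  have h2 := h1.inter (convex_closedBall y Δ)
  convert h2 using 1
  ext w
  simp only [Problem.levelSet, Set.mem_ofPred_eq, Set.mem_inter_iff, Metric.mem_closedBall,
    dist_eq_norm, norm_sub_rev w y]
  tauto

lemma iterate_mem_levelSet (S : ProxSetup P p lam y) {xs : E} (hmin : IsMinOn P.F P.Q xs)
    (h0 : z 0 = y) (hs : ∀ j < n, P.InnerStep p (regH P.f p) lam y (z j) (z (j + 1)))
    {σ : ℝ} (hσ0 : 0 < σ) (hσ : UniformlyConvex (scaling P.f p (regH P.f p) y) p σ) :
    z n ∈ P.levelSet p (regH P.f p) y (P.radius p xs σ y) := by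
  refine ⟨S.iterate_mem h0 hs, ?_, ?_⟩
  · rw [norm_sub_rev]; exact S.norm_iterate_sub_le_radius hmin h0 hs hσ0 hσ
  · have := S.phi_iterate_le h0 hs (Nat.zero_le n)
    rwa [h0] at this

/-- The residual of a step is controlled by its length. -/
lemma norm_residual_le (S : ProxSetup P p lam y) {s : Set E} (hsc : Convex ℝ s) {Lbar : ℝ}
    (hL : ∀ w ∈ s, ‖iteratedFDeriv ℝ 2 (scaling P.f p (regH P.f p) y) w‖ ≤ Lbar) {w w' : E}
    (hw : w ∈ s) (hw' : w' ∈ s) :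
    ‖fderiv ℝ (proxSmooth P.f p (regH P.f p) y) w' + P.innerSubgrad p (regH P.f p) lam y w w'‖
      ≤ (lam - relMu) * Lbar * ‖w - w'‖ := by
  have hL0 : 0 ≤ Lbar := (norm_nonneg _).trans (hL w hw)
  have hG := (S.scalingDeriv.const_mul lam).sub S.proxDeriv
  have hlL := S.relL_le
  have hμ0 : 0 ≤ lam - relMu := by rw [relL] at hlL; rw [relMu]; linarith
  -- The residual is a difference of gradients of λρ − f_y, whose Hessian lies between 0 and (λ −
  -- μ)D²ρ by the two relative conditions.
  have hbound : ∀ x ∈ s, ‖lam • (evenHess P.f p y (x - y) + regH P.f p • dHess p (x - y))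
      - (fderiv ℝ (fderiv ℝ P.f) x + regH P.f p • dHess p (x - y))‖ ≤ (lam - relMu) * Lbar := by
    intro x hx
    have h1 := hL x hx
    rw [S.scalingDeriv.iteratedFDeriv_two] at h1
    refine norm_le_of_diag_le (fun v w => hG.symm x v w) (fun v => ?_)
      (mul_nonneg hμ0 hL0) fun v => ?_
    · have h2 := ((S.scalingDeriv.const_mul relL).sub S.proxDeriv).nonneg_of_convexOn
        S.relSmooth x v
      have h3 := mul_nonneg (sub_nonneg.2 hlL) (S.scaling_diag_nonneg x v)
      simp only [sub_apply, smul_apply, smul_eq_mul] at h2 h3 ⊢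
      linarith
    · have h2 := (S.proxDeriv.sub (S.scalingDeriv.const_mul relMu)).nonneg_of_convexOn
        S.relStronglyConvex x v
      have h3 := mul_le_mul_of_nonneg_left (abs_le.1 (abs_apply_le h1 v)).2 hμ0
      simp only [sub_apply, smul_apply, smul_eq_mul] at h2 h3 ⊢
      linarith
  have := hsc.norm_image_sub_le_of_norm_hasFDerivWithin_le
    (fun x _ => (hG.second x).hasFDerivWithinAt) hbound hw' hw
  refine le_trans (le_of_eq ?_) this
  congr 1
  simp only [Problem.innerSubgrad, smul_sub]
  abel

/-- Linear convergence of the inner method towards any later iterate. -/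
lemma bregman_iterate_le (S : ProxSetup P p lam y) (h0 : z 0 = y) {i : ℕ}
    (hs : ∀ j < i + 1, P.InnerStep p (regH P.f p) lam y (z j) (z (j + 1))) :
    bregman (scaling P.f p (regH P.f p) y) (z i) (z (i + 1))
      ≤ (5 / 6) ^ i * bregman (scaling P.f p (regH P.f p) y) y (z (i + 1)) := by
  have hw := S.iterate_mem h0 hs
  have hl1 := S.relL_le
  have hl2 := S.lam_le_three
  rw [relL] at hl1
  have key : ∀ j ≤ i, bregman (scaling P.f p (regH P.f p) y) (z j) (z (i + 1))
      ≤ (5 / 6) ^ j * bregman (scaling P.f p (regH P.f p) y) y (z (i + 1)) := by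
    intro j hj
    induction j with
    | zero => rw [h0]; simp
    | succ j ih =>
      have h1 := S.step_le S.relStronglyConvex (hs j (by omega)) hw
      -- The target z_{i+1} has the smaller φ, so the φ terms drop; 1 − μ/λ ≤ 5/6 since λ ≤ 3.
      have h2 := S.phi_iterate_le h0 hs (show j + 1 ≤ i + 1 by omega)
      have h3 := ih (by omega)
      have h4 := S.bregman_nonneg (z j) (z (i + 1))
      rw [relMu] at h1
      have h5 : bregman (scaling P.f p (regH P.f p) y) (z (j + 1)) (z (i + 1))
          ≤ 5 / 6 * bregman (scaling P.f p (regH P.f p) y) (z j) (z (i + 1)) := by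
        refine le_of_mul_le_mul_left ?_ (show 0 < lam by linarith)
        nlinarith
      calc _ ≤ _ := h5
        _ ≤ 5 / 6 * ((5 / 6) ^ j * _) := mul_le_mul_of_nonneg_left h3 (by norm_num)
        _ = _ := by ring
  exact key i le_rfl

/-! ### Counting the inner iterations -/

lemma theta_mono {θ : ℝ → ℝ} (hc : ConvexOn ℝ (Set.Ici 0) θ) (h0 : θ 0 = 0)
    (hn : ∀ τ, 0 ≤ τ → 0 ≤ θ τ) {s t : ℝ} (hs : 0 ≤ s) (hst : s ≤ t) : θ s ≤ θ t := by
  rcases (hs.trans hst).eq_or_lt with h | h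
  · rw [le_antisymm hst (h ▸ hs)]
  · have h1 := hc.2 (Set.mem_Ici.2 h.le) (Set.mem_Ici.2 (le_refl (0 : ℝ)))
      (show 0 ≤ s / t by positivity) (sub_nonneg.2 ((div_le_one h).2 hst)) (by ring)
    simp only [smul_eq_mul, h0, mul_zero, add_zero, div_mul_cancel₀ s h.ne'] at h1
    have h2 := hn t h.le
    have h3 : s / t * θ t ≤ 1 * θ t := by
      gcongr
      exact (div_le_one h).2 hst
    linarith

/-- The factor 2 pays for the shift from i to i + 1; it is the 2 in 2(p+1)/σ. -/
lemma five_sixths_pow_le (i : ℕ) :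
    ((5 : ℝ) / 6) ^ i ≤ 2 * Real.exp (-(((i : ℝ) + 1) / 6)) := by
  have h1 : (5 : ℝ) / 6 ≤ Real.exp (-(1 / 6)) := by
    have := Real.add_one_le_exp (-(1 / 6) : ℝ)
    linarith
  have h2 : (1 : ℝ) ≤ 2 * Real.exp (-(1 / 6)) := by linarith
  calc ((5 : ℝ) / 6) ^ i ≤ Real.exp (-(1 / 6)) ^ i := by gcongr
    _ ≤ (2 * Real.exp (-(1 / 6))) * Real.exp (-(1 / 6)) ^ i :=
        le_mul_of_one_le_left (by positivity) h2
    _ = _ := by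
      rw [← Real.exp_nat_mul, mul_assoc, ← Real.exp_add]
      congr 2
      ring

/-- An inner iteration whose residual is controlled by the length of the step is an early one. -/
lemma succ_le_log (S : ProxSetup P p lam y) {xs x₀ : E} (hxs : xs ∈ P.Q)
    (hmin : IsMinOn P.F P.Q xs) (hy : P.F y ≤ max (P.F x₀) (P.FS xs x₀)) (h0 : z 0 = y) {i : ℕ}
    (hs : ∀ j < i + 1, P.InnerStep p (regH P.f p) lam y (z j) (z (j + 1)))
    {β ε σ Lbar D : ℝ} {θ : ℝ → ℝ} (hβ : 0 < β) (hε : 0 < ε) (hσ0 : 0 < σ)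
    (hσ : UniformlyConvex (scaling P.f p (regH P.f p) y) p σ)
    (hθ : NormDominated (scaling P.f p (regH P.f p) y)
      (Metric.closedBall y (P.D₁ p (regH P.f p) xs x₀)) θ)
    (hεF : ε ≤ P.F (z (i + 1)) - P.F xs) (hD : ‖z (i + 1) - xs‖ ≤ D) (hL0 : 0 ≤ Lbar)
    (hres : β * ‖fderiv ℝ P.f (z (i + 1))
        + P.innerSubgrad p (regH P.f p) lam y (z i) (z (i + 1))‖
      ≤ (lam - relMu) * Lbar * ‖z i - z (i + 1)‖) :
    ((i + 1 : ℕ) : ℝ) ≤ 2 * ((p : ℝ) + 1) / relKappa *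
      Real.log (D * (lam - relMu) * Lbar / β *
        (2 * ((p : ℝ) + 1) / σ * θ (P.D₁ p (regH P.f p) xs x₀)) ^ (1 / ((p : ℝ) + 1)) / ε) := by
  set Γ := fderiv ℝ P.f (z (i + 1))
    + P.innerSubgrad p (regH P.f p) lam y (z i) (z (i + 1)) with hΓ
  set s := ‖z i - z (i + 1)‖ with hsdef
  set D1 := P.D₁ p (regH P.f p) xs x₀ with hD1
  have hp1 : (0 : ℝ) < (p : ℝ) + 1 := by positivity
  have hr := S.norm_iterate_sub_le_D₁ (x₀ := x₀) hmin hy h0 hs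
  have hD10 : 0 ≤ D1 := (norm_nonneg _).trans hr
  have hμ0 : 0 ≤ lam - relMu := by
    have := S.relL_le
    rw [relL] at this
    rw [relMu]; linarith
  -- the functional residual
  have hgap : ε ≤ ‖Γ‖ * D := by
    have h1 := ((hs i (Nat.lt_succ_self i)).isSubgradient S.two_le S.smooth S.closedConvex).2 xs hxs
    have h2 := bregman_nonneg_of_convexOn S.convex (S.differentiable (z (i + 1))) xs
    have h3 : P.F (z (i + 1)) - P.F xs ≤ -Γ (xs - z (i + 1)) := by
      simp only [bregman, Problem.F, hΓ, add_apply] at h1 h2 ⊢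
      linarith
    have h4 := (abs_le.1 (Γ.le_opNorm (xs - z (i + 1)))).1
    have h5 : ‖Γ‖ * ‖xs - z (i + 1)‖ ≤ ‖Γ‖ * D := by
      rw [norm_sub_rev]; gcongr
    linarith
  have hD0 : 0 ≤ D := (norm_nonneg _).trans hD
  -- the length of the step
  have hlen : s ^ (p + 1) ≤ (2 * ((p : ℝ) + 1) / σ * θ D1) * Real.exp (-(((i : ℝ) + 1) / 6)) := by
    have h1 := hσ (z i) (z (i + 1))
    rw [norm_sub_rev, ← hsdef] at h1
    have h2 := S.bregman_iterate_le h0 hs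
    have h3 : bregman (scaling P.f p (regH P.f p) y) y (z (i + 1)) ≤ θ D1 := by
      refine (hθ.2.2.2 y (Metric.mem_closedBall_self hD10) _).trans ?_
      rw [norm_sub_rev]
      exact theta_mono hθ.1 hθ.2.1 hθ.2.2.1 (norm_nonneg _) hr
    have hθ0 : 0 ≤ θ D1 := hθ.2.2.1 _ hD10
    have h4 : σ / ((p : ℝ) + 1) * s ^ (p + 1)
        ≤ 2 * Real.exp (-(((i : ℝ) + 1) / 6)) * θ D1 :=
      calc _ ≤ _ := h1
        _ ≤ _ := h2
        _ ≤ (5 / 6) ^ i * θ D1 := by gcongr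
        _ ≤ _ := mul_le_mul_of_nonneg_right (five_sixths_pow_le i) hθ0
    rw [div_mul_eq_mul_div, div_le_iff₀ hp1] at h4
    rw [div_mul_eq_mul_div, div_mul_eq_mul_div, le_div_iff₀ hσ0]
    linarith
  set B := 2 * ((p : ℝ) + 1) / σ * θ D1 with hB
  set X := B ^ (1 / ((p : ℝ) + 1)) with hX
  have hB0 : 0 ≤ B := mul_nonneg (by positivity) (hθ.2.2.1 _ hD10)
  have hX0 : 0 ≤ X := by positivity
  have hXp : X ^ (p + 1) = B := by
    have := Real.rpow_inv_natCast_pow hB0 (n := p + 1) (by omega)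
    rw [hX, one_div]
    push_cast at this
    exact this
  -- The rate 1/6 for the Bregman distance becomes 1/(6(p+1)) for the step length, and 6(p+1) =
  -- 2(p+1)/κ.
  set e := Real.exp (-(((i : ℝ) + 1) / (6 * ((p : ℝ) + 1)))) with he
  have hep : e ^ (p + 1) = Real.exp (-(((i : ℝ) + 1) / 6)) := by
    rw [he, ← Real.exp_nat_mul]
    congr 1
    push_cast
    field_simp
  have hsX : s ≤ X * e := by
    refine le_of_pow_le_pow_left₀ (show p + 1 ≠ 0 by omega) (by positivity) ?_
    rw [mul_pow, hXp, hep]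
    exact hlen
  set C := D * (lam - relMu) * Lbar / β * X with hC
  have hmain : ε ≤ C * e := by
    have h1 : β * ε ≤ D * ((lam - relMu) * Lbar * (X * e)) := by
      calc β * ε ≤ β * (‖Γ‖ * D) := by gcongr
        _ = D * (β * ‖Γ‖) := by ring
        _ ≤ D * ((lam - relMu) * Lbar * s) := by gcongr
        _ ≤ _ := by gcongr
    rw [hC, mul_assoc, div_mul_eq_mul_div, le_div_iff₀ hβ]
    linarith
  have hexp : Real.exp (((i : ℝ) + 1) / (6 * ((p : ℝ) + 1))) ≤ C / ε := by
    rw [le_div_iff₀ hε]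
    have h1 : Real.exp (((i : ℝ) + 1) / (6 * ((p : ℝ) + 1))) * e = 1 := by
      rw [he, ← Real.exp_add]; simp
    calc _ ≤ Real.exp (((i : ℝ) + 1) / (6 * ((p : ℝ) + 1))) * (C * e) := by gcongr
      _ = C * (Real.exp (((i : ℝ) + 1) / (6 * ((p : ℝ) + 1))) * e) := by ring
      _ = C := by rw [h1, mul_one]
  have hlog := (Real.le_log_iff_exp_le ((Real.exp_pos _).trans_le hexp)).2 hexp
  rw [div_le_iff₀ (by positivity)] at hlog
  rw [relKappa, relMu, relL]
  push_cast
  calc (i : ℝ) + 1 ≤ _ := hlog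
    _ = _ := by ring

/-- The complexity bound for the lower level. -/
theorem exists_stopping_index (S : ProxSetup P p lam y) {xs x₀ : E} (hxs : xs ∈ P.Q)
    (hmin : IsMinOn P.F P.Q xs) (hy : P.F y ≤ max (P.F x₀) (P.FS xs x₀))
    {β ε σ Lbar D : ℝ} {θ : ℝ → ℝ} (hβ0 : 0 < β) (hβ : β ≤ 1 / (p : ℝ)) (hε : 0 < ε)
    (hz : P.IsInnerRun p (regH P.f p) β lam y z)
    (hεF : ∀ i, P.Active p (regH P.f p) β lam y z i → ε ≤ P.F (z (i + 1)) - P.F xs)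
    (hσ0 : 0 < σ) (hσ : UniformlyConvex (scaling P.f p (regH P.f p) y) p σ)
    (hL : P.HessianBounded p (regH P.f p) xs σ y Lbar)
    (hθ : NormDominated (scaling P.f p (regH P.f p) y)
      (Metric.closedBall y (P.D₁ p (regH P.f p) xs x₀)) θ)
    (hD : ∀ i, P.Active p (regH P.f p) β lam y z i → ‖z (i + 1) - xs‖ ≤ D) :
    ∃ m : ℕ, ((m + 1 : ℕ) : ℝ)
        ≤ innerBound p β lam ε σ Lbar D (θ (P.D₁ p (regH P.f p) xs x₀)) ∧
      P.Active p (regH P.f p) β lam y z m ∧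
      P.Acceptable p (regH P.f p) β y (z (m + 1))
        (P.innerSubgrad p (regH P.f p) lam y (z m) (z (m + 1))) := by
  have hsteps : ∀ i, P.Active p (regH P.f p) β lam y z i →
      ∀ j < i + 1, P.InnerStep p (regH P.f p) lam y (z j) (z (j + 1)) := fun i hi j hj =>
    hz.2 j fun k hk => hi k (by omega)
  have hmem : ∀ i, P.Active p (regH P.f p) β lam y z i → ∀ j ≤ i + 1,
      z j ∈ P.levelSet p (regH P.f p) y (P.radius p xs σ y) := fun i hi j hj =>
    S.iterate_mem_levelSet hmin hz.1 (fun k hk => hsteps i hi k (by omega)) hσ0 hσ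
  have hL0 : 0 ≤ Lbar := (norm_nonneg _).trans
    (hL (z 0) (hmem 0 (fun j hj => absurd hj (Nat.not_lt_zero j)) 0 (by omega)))
  set C := 2 * ((p : ℝ) + 1) / relKappa *
      Real.log (D * (lam - relMu) * Lbar / β *
        (2 * ((p : ℝ) + 1) / σ * θ (P.D₁ p (regH P.f p) xs x₀)) ^ (1 / ((p : ℝ) + 1)) / ε) with hC
  have hnot : ∀ i, P.Active p (regH P.f p) β lam y z i →
      ¬ P.Stops p (regH P.f p) β lam y (z i) (z (i + 1)) → ((i + 1 : ℕ) : ℝ) ≤ C := by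
    intro i hi hdone
    refine S.succ_le_log hxs hmin hy hz.1 (hsteps i hi) hβ0 hε hσ0 hσ hθ (hεF i hi) (hD i hi)
      hL0 ?_
    exact (not_le.1 hdone).le.trans (S.norm_residual_le (S.convex_levelSet _) hL
      (hmem i hi i (by omega)) (hmem i hi (i + 1) le_rfl))
  have hex : ∃ m, P.Stops p (regH P.f p) β lam y (z m) (z (m + 1)) := by
    by_contra hne
    simp only [not_exists] at hne
    obtain ⟨N, hN⟩ := exists_nat_gt C
    have := hnot N (fun j _ => hne j) (hne N)
    push_cast at this
    linarith
  classical
  obtain ⟨m, hmdef⟩ : ∃ m, m = Nat.find hex := ⟨_, rfl⟩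
  have hdone : P.Stops p (regH P.f p) β lam y (z m) (z (m + 1)) :=
    hmdef ▸ Nat.find_spec hex
  have hact : P.Active p (regH P.f p) β lam y z m := fun j hj =>
    Nat.find_min hex (hmdef ▸ hj)
  refine ⟨m, ?_, hact, (hsteps m hact m (by omega)).isSubgradient S.two_le S.smooth
    S.closedConvex, hdone⟩
  have hmC : (m : ℝ) ≤ C := by
    -- For m = 0 one must still show C ≥ 0, since the logarithm is not visibly nonnegative.
    -- Acceptance gives (1 − β)‖Γ‖ ≤ H‖h‖^p ≤ Lbar‖h‖, so the residual estimate of a failed test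
    -- holds anyway, as β ≤ 1 − β and λ − μ ≥ 1.
    rcases Nat.eq_zero_or_pos m with hm0 | hm0
    · rw [hm0] at hdone hact ⊢
      have hH := S.regH_pos
      have hp2 : (2 : ℝ) ≤ p := by exact_mod_cast S.two_le
      -- a first step accepted at once is long
      set Γ := fderiv ℝ P.f (z (0 + 1))
        + P.innerSubgrad p (regH P.f p) lam y (z 0) (z (0 + 1)) with hΓ
      set h := z (0 + 1) - y with hh
      have hβ2 : β ≤ 1 / 2 := hβ.trans (one_div_le_one_div_of_le (by norm_num) hp2)
      have hΓ1 : (1 - β) * ‖Γ‖ ≤ regH P.f p * ‖h‖ ^ p := by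
        have h1 : ‖fderiv ℝ (proxSmooth P.f p (regH P.f p) y) (z (0 + 1))
          + P.innerSubgrad p (regH P.f p) lam y (z 0) (z (0 + 1))‖ ≤ β * ‖Γ‖ := hdone
        rw [fderiv_proxSmooth S.two_le (S.differentiable _), add_right_comm, ← hΓ, ← hh] at h1
        have h2 := norm_sub_norm_le Γ (-(regH P.f p • dGrad p h))
        rw [norm_neg, sub_neg_eq_add, norm_smul, Real.norm_of_nonneg hH.le,
          norm_dGrad S.two_le] at h2
        linarith
      have hLh : regH P.f p * ‖h‖ ^ p ≤ Lbar * ‖h‖ := by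
        have h1 := hL _ (hmem 0 hact 1 le_rfl)
        rw [S.scalingDeriv.iteratedFDeriv_two] at h1
        have h2 := (abs_le.1 (abs_apply_le h1 h)).2
        have h3 := scaling_hess_ge S.convex S.two_le S.smooth S.finite S.pos y (z (0 + 1)) h
        rw [← hh, dHess_self_self S.two_le] at h3
        have h4 : regH P.f p * ‖h‖ ^ (p + 1) ≤ Lbar * ‖h‖ ^ 2 := by
          have h5 : regH P.f p * ‖h‖ ^ (p + 1) * 1 ≤ regH P.f p * ‖h‖ ^ (p + 1) * (5 / 6 * p) :=
            mul_le_mul_of_nonneg_left (by linarith) (by positivity)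
          have h6 : (5 / 6 * regH P.f p * (p * ‖h‖ ^ (p + 1)))
              = regH P.f p * ‖h‖ ^ (p + 1) * (5 / 6 * p) := by ring
          rw [h6] at h3
          have h7 := h3.trans h2
          linarith
        rcases (norm_nonneg h).eq_or_lt with h0 | h0
        · rw [← h0, zero_pow (by have := S.two_le; omega)]; simp
        · refine le_of_mul_le_mul_right ?_ h0
          calc _ = regH P.f p * ‖h‖ ^ (p + 1) := by ring
            _ ≤ _ := h4
            _ = _ := by ring
      have hres : β * ‖Γ‖ ≤ (lam - relMu) * Lbar * ‖z 0 - z (0 + 1)‖ := by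
        rw [hz.1, norm_sub_rev, ← hh]
        have h1 : 1 ≤ lam - relMu := by
          have := S.relL_le
          rw [relL] at this
          rw [relMu]; linarith
        have h2 : β * ‖Γ‖ ≤ (1 - β) * ‖Γ‖ := by gcongr; linarith
        have h3 : 1 * (Lbar * ‖h‖) ≤ (lam - relMu) * (Lbar * ‖h‖) := by gcongr
        linarith
      have := S.succ_le_log hxs hmin hy hz.1 (hsteps 0 hact) hβ0 hε hσ0 hσ hθ (hεF 0 hact)
        (hD 0 hact) hL0 hres
      rw [← hC] at this
      push_cast at this ⊢
      linarith
    -- Index m − 1 is the last failed test and gives m ≤ C; the accepted iteration is the leading 1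
    -- of `innerBound`.
    · have := hnot (m - 1) (fun j hj => hact j (by omega)) (hact (m - 1) (by omega))
      rwa [Nat.sub_add_cancel hm0] at this
  rw [innerBound, ← hC]
  push_cast
  linarith

end ProxSetup

end LowerLevel

end BiOPT

namespace BiOPT

/-! ### Location of the prox-centres and assembly of the theorem -/

section MainResult

universe u
variable {E : Type u} [NormedAddCommGroup E] [InnerProductSpace ℝ E]
variable {P : Problem E} {p : ℕ} {β lam : ℝ} {x₀ xs : E} {K : ℕ} {t : Trace E}

lemma Problem.F_convexOn (hf : ConvexOn ℝ Set.univ P.f) (hψ : P.ClosedConvex) :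
    ConvexOn ℝ P.Q P.F :=
  (hf.subset (Set.subset_univ _) hψ.1.1).add hψ.1

/-- The centre of the proximal problem is a convex combination of `x_K` and `υ_K`. -/
lemma Problem.IsRun.exists_y_eq {H : ℝ} (hp : 2 ≤ p) (hH : 0 < H) (hβ : β ≤ 1 / (p : ℝ))
    (h : P.IsRun p H β lam x₀ K t) :
    ∃ a b : ℝ, 0 ≤ a ∧ 0 ≤ b ∧ a + b = 1 ∧ t.y K = a • t.x K + b • t.υ K := by
  have hA := coefA_pos (k := K + 1) hp hH hβ (Nat.succ_pos K)
  refine ⟨_, _, div_nonneg (coefA_nonneg hp hH hβ K) hA.le,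
    div_nonneg (coefA_step_nonneg hp hH hβ K) hA.le, ?_, h.combine K le_rfl⟩
  rw [← add_div, add_sub_cancel, div_self hA.ne']

variable [FiniteDimensional ℝ E]

/-- The factor 2^{(p-1)/(p+1)} is at most 2. Membership in S is needed because F(υ_K) may exceed
F(x₀). -/
lemma Problem.IsRun.υ_mem_S {H : ℝ} (hp : 2 ≤ p) (hH : 0 < H)
    (hβ : β ≤ 1 / (p : ℝ)) (hf : ConvexOn ℝ Set.univ P.f)
    (hfs : ContDiff ℝ ((p + 1 : ℕ) : WithTop ℕ∞) P.f) (hψ : P.ClosedConvex)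
    (hx₀ : x₀ ∈ P.Q) (hxs : xs ∈ P.Q) (hmin : IsMinOn P.F P.Q xs)
    (h : P.IsRun p H β lam x₀ K t) : t.υ K ∈ P.S xs x₀ := by
  refine ⟨(h.argmin K le_rfl).1,
    (h.norm_υ_sub_le hp hH hβ hf hfs hψ hx₀ hxs hmin).trans ?_⟩
  gcongr
  have hp1 : (0 : ℝ) < (p : ℝ) + 1 := by positivity
  calc (2 : ℝ) ^ (((p : ℝ) - 1) / ((p : ℝ) + 1)) ≤ (2 : ℝ) ^ (1 : ℝ) :=
        Real.rpow_le_rpow_of_exponent_le (by norm_num)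
          ((div_le_one hp1).2 (by linarith))
    _ = 2 := Real.rpow_one 2

/-- Location and objective value of the centre of the proximal problem. -/
lemma Problem.IsRun.y_bounds {H : ℝ} (hp : 2 ≤ p) (hH : 0 < H)
    (hβ : β ≤ 1 / (p : ℝ)) (hf : ConvexOn ℝ Set.univ P.f)
    (hfs : ContDiff ℝ ((p + 1 : ℕ) : WithTop ℕ∞) P.f) (hψ : P.ClosedConvex)
    (hx₀ : x₀ ∈ P.Q) (hxs : xs ∈ P.Q) (hmin : IsMinOn P.F P.Q xs)
    (hD₀ : BddAbove ((fun z => ‖z - xs‖) '' P.initLevel x₀))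
    (hFS : BddAbove (P.F '' P.S xs x₀))
    (h : P.IsRun p H β lam x₀ K t) (hx : P.F (t.x K) ≤ P.F x₀) :
    t.y K ∈ P.Q ∧ P.F (t.y K) ≤ max (P.F x₀) (P.FS xs x₀) ∧
      ‖t.y K - xs‖ ≤ max (P.D₀ xs x₀)
        ((2 : ℝ) ^ (((p : ℝ) - 1) / ((p : ℝ) + 1)) * ‖x₀ - xs‖) := by
  obtain ⟨a, b, ha, hb, hab, hy⟩ := h.exists_y_eq hp hH hβ
  have hxQ := h.x_mem hx₀ le_rfl
  have hυ := h.υ_mem_S hp hH hβ hf hfs hψ hx₀ hxs hmin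
  have hFυ : P.F (t.υ K) ≤ P.FS xs x₀ := le_csSup hFS ⟨_, hυ, rfl⟩
  have hxD : ‖t.x K - xs‖ ≤ P.D₀ xs x₀ := le_csSup hD₀ ⟨_, ⟨hxQ, hx⟩, rfl⟩
  have hυD := h.norm_υ_sub_le hp hH hβ hf hfs hψ hx₀ hxs hmin
  rw [hy]
  refine ⟨hψ.1.1 hxQ hυ.1 ha hb hab, ?_, ?_⟩
  · refine ((Problem.F_convexOn hf hψ).2 hxQ hυ.1 ha hb hab).trans ?_
    exact (convex_Iic (max (P.F x₀) (P.FS xs x₀))) (Set.mem_Iic.2 (hx.trans (le_max_left _ _)))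
      (Set.mem_Iic.2 (hFυ.trans (le_max_right _ _))) ha hb hab
  · have hball := convex_closedBall xs (max (P.D₀ xs x₀)
      ((2 : ℝ) ^ (((p : ℝ) - 1) / ((p : ℝ) + 1)) * ‖x₀ - xs‖))
    have := hball (x := t.x K) (mem_closedBall_iff_norm.2 (hxD.trans (le_max_left _ _)))
      (mem_closedBall_iff_norm.2 (hυD.trans (le_max_right _ _))) ha hb hab
    exact mem_closedBall_iff_norm.1 this

lemma Problem.D₁_nonneg {H : ℝ} (hH : 0 < H) (hx₀ : x₀ ∈ P.Q) (hmin : IsMinOn P.F P.Q xs) :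
    0 ≤ P.D₁ p H xs x₀ := by
  have : 0 ≤ max (P.F x₀) (P.FS xs x₀) - P.F xs :=
    sub_nonneg.2 ((hmin hx₀ : P.F xs ≤ P.F x₀).trans (le_max_left _ _))
  rw [Problem.D₁]; positivity

end MainResult

end BiOPT
open BiOPT
theorem mainTheorem6 {E : Type*} [NormedAddCommGroup E] [InnerProductSpace ℝ E]
    [FiniteDimensional ℝ E] (P : Problem E) (p : ℕ) (hp : 2 ≤ p)
    (hf : ConvexOn ℝ Set.univ P.f) (hfs : ContDiff ℝ ((p + 1 : ℕ) : WithTop ℕ∞) P.f)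
    (hM : MFinite P.f (p + 1)) (hM0 : 0 < M P.f (p + 1)) (hψ : P.ClosedConvex)
    (xs : E) (hxs : xs ∈ P.Q) (hmin : IsMinOn P.F P.Q xs) (x₀ : E) (hx₀ : x₀ ∈ P.Q)
    (hD₀ : BddAbove ((fun z => ‖z - xs‖) '' P.initLevel x₀))
    (hFS : BddAbove (P.F '' P.S xs x₀))
    (β : ℝ) (hβ0 : 0 ≤ β) (hβ : β ≤ 1 / (p : ℝ))
    (lam : ℝ) (hlam : lam = relL ∨ lam = 2 * relL) (ε : ℝ) (hε : 0 < ε)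
    (H : ℝ) (hH : H = regH P.f p) :
    (∀ (K : ℕ) (t : Trace E), P.IsRun p H β lam x₀ K t →
      -- upper level: the number of outer iterations
      (outerBound P.f p ε ‖x₀ - xs‖ ≤ K → P.F (t.x K) - P.F xs ≤ ε) ∧
      ((∀ k < K, ε < P.F (t.x k) - P.F xs) → K ≤ ⌈outerBound P.f p ε ‖x₀ - xs‖⌉₊) ∧
      -- the method uses the oracle of `f` of order `2q` only
      (∀ f' : E → ℝ, ContDiff ℝ ((2 * (p / 2) : ℕ) : WithTop ℕ∞) f' →
        (∀ w ∈ t.queried K, ∀ j ≤ 2 * (p / 2),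
          iteratedFDeriv ℝ j f' w = iteratedFDeriv ℝ j P.f w) →
        Problem.IsRun { P with f := f' } p H β lam x₀ K t) ∧
      -- lower level: the number of inner iterations
      (P.F (t.x K) ≤ P.F x₀ →
        P.F (t.y K) ≤ max (P.F x₀) (P.FS xs x₀) ∧
        ∀ z : ℕ → E, P.IsInnerRun p H β lam (t.y K) z →
          (4 ≤ p →
            RelSmooth (proxSmooth P.f p H (t.y K)) (scaling P.f p H (t.y K)) relL ∧
            RelStronglyConvex (proxSmooth P.f p H (t.y K)) (scaling P.f p H (t.y K)) relMu) →
          (∀ i, P.Active p H β lam (t.y K) z i →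
            ‖z (i + 1) - xs‖ ≤ P.Dmax p H xs x₀) ∧
          (0 < β →
            (∀ i, P.Active p H β lam (t.y K) z i → ε ≤ P.F (z (i + 1)) - P.F xs) →
            ∀ σ Lbar D : ℝ, ∀ θ : ℝ → ℝ, 0 < σ →
              UniformlyConvex (scaling P.f p H (t.y K)) p σ →
              P.HessianBounded p H xs σ (t.y K) Lbar →
              NormDominated (scaling P.f p H (t.y K))
                (Metric.closedBall (t.y K) (P.D₁ p H xs x₀)) θ →
              (∀ i, P.Active p H β lam (t.y K) z i → ‖z (i + 1) - xs‖ ≤ D) →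
              ∃ m : ℕ, ((m + 1 : ℕ) : ℝ) ≤
                  innerBound p β lam ε σ Lbar D (θ (P.D₁ p H xs x₀)) ∧
                P.Active p H β lam (t.y K) z m ∧
                P.Acceptable p H β (t.y K) (z (m + 1))
                  (P.innerSubgrad p H lam (t.y K) (z m) (z (m + 1)))))) ∧
    -- explicit admissible constants
    (∀ y ∈ P.Q,
      (0 < sigma₀ p H ∧ UniformlyConvex (scaling P.f p H y) p (sigma₀ p H)) ∧
      (p ≤ 3 → RelSmooth (proxSmooth P.f p H y) (scaling P.f p H y) relL ∧
        RelStronglyConvex (proxSmooth P.f p H y) (scaling P.f p H y) relMu) ∧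
      ((∀ j, 1 ≤ j → j ≤ p / 2 → MFinite P.f (2 * j)) →
        (∀ σ : ℝ, 0 < σ → P.HessianBounded p H xs σ y
          (hessianBound P.f p H (P.radius p xs σ y))) ∧
        NormDominated (scaling P.f p H y) (Metric.closedBall y (P.D₁ p H xs x₀))
          (thetaBound P.f p H (P.D₁ p H xs x₀)))) := by
  subst hH
  have hH := regH_pos hM0
  refine ⟨fun K t h => ⟨h.sub_le_of_outerBound_le hp hβ hf hfs hM0 hψ hx₀ hxs hε, fun hlt => ?_,
    fun f' hf' hq => ?_, fun hx => ?_⟩, fun y _ => ⟨⟨sigma₀_pos hM0, ?_⟩, ?_, fun hMj => ⟨?_, ?_⟩⟩⟩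
  -- A longer run restricts to ⌈N⌉ iterations, where the accuracy is already reached.
  · by_contra! hK
    exact (hlt _ hK).not_ge
      ((h.mono hK.le).sub_le_of_outerBound_le hp hβ hf hfs hM0 hψ hx₀ hxs hε (Nat.le_ceil _))
  · exact h.transfer hp (hfs.differentiable (by simp))
      (hf'.differentiable (by exact_mod_cast (show 2 * (p / 2) ≠ 0 by omega))) hq
  · obtain ⟨hyQ, hyF, hyD⟩ :=
      h.y_bounds hp hH hβ hf hfs hψ hx₀ hxs hmin hD₀ hFS hx
    refine ⟨hyF, fun z hz hrel => ?_⟩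
    have hrel' : RelSmooth (proxSmooth P.f p (regH P.f p) (t.y K))
          (scaling P.f p (regH P.f p) (t.y K)) relL ∧
        RelStronglyConvex (proxSmooth P.f p (regH P.f p) (t.y K))
          (scaling P.f p (regH P.f p) (t.y K)) relMu := by
      rcases le_or_gt 4 p with h4 | h4
      · exact hrel h4
      · exact relSmooth_relStronglyConvex hf hp (by omega) hfs hM hM0 _
    have S : ProxSetup P p lam (t.y K) :=
      ⟨hp, hf, hfs, hM, hM0, hψ, hyQ, hlam, hrel'.1, hrel'.2⟩
    refine ⟨fun i hi => ?_, fun hβpos hεF σ Lbar D θ hσ0 hσ hL hθ hD =>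
      S.exists_stopping_index hxs hmin hyF hβpos hβ hε hz hεF hσ0 hσ hL hθ hD⟩
    have h1 := S.norm_iterate_sub_le_D₁ (n := i + 1) hmin hyF hz.1
      fun j hj => hz.2 j fun k hk => hi k (by omega)
    calc ‖z (i + 1) - xs‖ ≤ ‖z (i + 1) - t.y K‖ + ‖t.y K - xs‖ := norm_sub_le_norm_sub_add_norm_sub _ _ _
      _ ≤ _ := add_le_add h1 hyD
  · exact uniformlyConvex_scaling hf hp hfs hM hM0 y
  · exact fun hp3 => relSmooth_relStronglyConvex hf hp hp3 hfs hM hM0 y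
  · intro σ _ z hz
    refine norm_scaling_hess_le hp hfs hM (hMj 1 le_rfl (by omega)) hH.le ?_
    rw [norm_sub_rev]
    exact hz.2.1
  · exact normDominated_scaling hp hfs hMj hH.le (Problem.D₁_nonneg hH hx₀ hmin) y
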